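/- Let $\mathfrak n=\mathfrak n_0\oplus\mathfrak n_1$ be a finite-dimensional real nilpotent Lie superalgebra. For a Grassmann algebra $A=A_0\oplus A_1=\Lambda\mathbb R^q$ let $\mathfrak n_A=(A\otimes\mathfrak n)_0=A_0\otimes\mathfrak n_0\oplus A_1\otimes\mathfrak n_1$ be the $A_0$-module of $A$-points, with the bracket $[aX,bY]_A=ba[X,Y]$. Let $N$ be the exponential supergroup of $\mathfrak n$: its $A$-points $N_A$ are the manifold $\mathfrak n_A$ with the group law given by the Baker--Campbell--Hausdorff series, and a homomorphism of Grassmann algebras (an algebra homomorphism preserving parity) $f:A\to B$ induces $N_f=(f\otimes 1)_0:N_A\to N_B$. A map between finite-dimensional $A_0$-modules is called $A_0$-smooth if it is $C^\infty$ and its derivative at each point is $A_0$-linear. Let $C_0^p(\mathfrak n)$ be the space of even (parity-preserving) graded-antisymmetric $p$-linear maps $\omega:\mathfrak n^p\to\mathbb R$, with the coboundary given on homogeneous elements by $$d\omega(X_1,\dots,X_{p+1})=\sum_{i<j}(-1)^{i+j}(-1)^{|X_i||X_j|}\epsilon_1^{i-1}(i)\,\epsilon_1^{j-1}(j)\,\omega([X_i,X_j],X_1,\dots,\hat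 X_i,\dots,\hat X_j,\dots,X_{p+1}),$$ where $\epsilon_1^{k-1}(k)=(-1)^{|X_k|(|X_1|+\dots+|X_{k-1}|)}$. Let $C^p(N)$ be the space of maps of supermanifolds $N^p\to\mathbb R$, that is, of families of $A_0$-smooth maps $f_A:N_A^p\to A_0$, for all Grassmann algebras $A$, which are natural in $A$; its coboundary is $$df_A(g_1,\dots,g_{p+1})=f_A(g_2,\dots,g_{p+1})+\sum_{i=1}^p(-1)^if_A(g_1,\dots,g_ig_{i+1},\dots,g_{p+1})+(-1)^{p+1}f_A(g_1,\dots,g_p).$$ Suppose that $N$ is equipped with a left-invariant notion of simplices: for all $p\ge 0$ and all $A$ a smooth map $(\varphi_p)_A:\Delta^p\times N_A^{p+1}\to N_A$, where $\Delta^p\subset\mathbb R^{p+1}$ is the standard simplex, written $[n_0,\dots,n_p](x)=(\varphi_p)_A(x,n_0,\dots,n_p)$, such that it is $A_0$-smooth in $(n_0,\dots,n_p)$ for each fixed $x\in\Delta^p$; $[n_0,\dots,n_p]$ sends the vertices of $\Delta^p$ to $n_0,\dots,n_p$ in that order; $g[n_0,\dots,n_p]=[gn_0,\dots,gn_p]$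 for $g\in N_A$; the restriction of $[n_0,\dots,n_p]$ to the face opposite to the $i$th vertex is $[n_0,\dots,\hat n_i,\dots,n_p]$; and $N_f\circ[n_0,\dots,n_p]=[N_f(n_0),\dots,N_f(n_p)]$ for every homomorphism $f:A\to B$ of Grassmann algebras. For $\omega\in C_0^p(\mathfrak n)$ let $\omega_A:\mathfrak n_A^p\to A_0$ be the induced map, $\omega_A(a_1X_1,\dots,a_pX_p)=a_p\cdots a_1\,\omega(X_1,\dots,X_p)$, regarded as a left-invariant $A_0$-valued $p$-form on $N_A$ via $T_1N_A=\mathfrak n_A$. For $n_1,\dots,n_p\in N_A$ put $$\Bigl(\int\omega\Bigr)_A(n_1,\dots,n_p)=\int_{[1,\,n_1,\,n_1n_2,\,\dots,\,n_1n_2\cdots n_p]}\omega_A .$$ Then these maps are $A_0$-smooth and natural in $A$, so that $\int\omega\in C^p(N)$; the coboundaries map $C_0^p(\mathfrak n)$ to $C_0^{p+1}(\mathfrak n)$ and $C^p(N)$ to $C^{p+1}(N)$; and $\int:C_0^\bullet(\mathfrak n)\to C^\bullet(N)$ is a cochain map: it is linear and $\int d\omega=d\int\omega$ for all $p\ge 0$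 and all $\omega\in C_0^p(\mathfrak n)$. -/

import Mathlib

open Set MeasureTheory
open scoped TensorProduct Nat

/-! ## Grassmann algebras -/

/-- The Grassmann algebra `Λ ℝ^q`. -/
abbrev Gr (q : ℕ) : Type := ExteriorAlgebra ℝ (Fin q → ℝ)

/-- The part of `Λ ℝ^q` of parity `i`. -/
def grPart (q : ℕ) (i : ZMod 2) : Submodule ℝ (Gr q) :=
  CliffordAlgebra.evenOdd (0 : QuadraticForm ℝ (Fin q → ℝ)) i

/-- The even part `A₀` of the Grassmann algebra `A = Λ ℝ^q`, as an algebra. -/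
abbrev GrEven (q : ℕ) : Type :=
  ↥(CliffordAlgebra.even (0 : QuadraticForm ℝ (Fin q → ℝ)))

/-- A homomorphism of Grassmann algebras: a unital algebra homomorphism which preserves parity. -/
structure GrHom (q r : ℕ) where
  toAlgHom : Gr q →ₐ[ℝ] Gr r
  map_mem : ∀ (i : ZMod 2) (a : Gr q), a ∈ grPart q i → toAlgHom a ∈ grPart r i

theorem mem_even_iff {q : ℕ} {a : Gr q} :
    a ∈ CliffordAlgebra.even (0 : QuadraticForm ℝ (Fin q → ℝ)) ↔ a ∈ grPart q 0 := Iff.rfl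

theorem grPart_mul {q : ℕ} {i j : ZMod 2} {a b : Gr q} (ha : a ∈ grPart q i)
    (hb : b ∈ grPart q j) : a * b ∈ grPart q (i + j) :=
  CliffordAlgebra.evenOdd_mul_le _ i j (Submodule.mul_mem_mul ha hb)

/-- The map `A₀ → B₀` induced by a homomorphism `A → B`. -/
def GrHom.mapEven {q r : ℕ} (f : GrHom q r) (a : GrEven q) : GrEven r :=
  ⟨f.toAlgHom a, f.map_mem 0 a a.2⟩

instance Gr.instFinite (q : ℕ) : Module.Finite ℝ (Gr q) :=
  Module.Finite.of_basis (Pi.basisFun ℝ (Fin q)).ExteriorAlgebra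

instance GrEven.instFinite (q : ℕ) : Module.Finite ℝ (GrEven q) :=
  inferInstanceAs (Module.Finite ℝ
    ↥(Subalgebra.toSubmodule (CliffordAlgebra.even (0 : QuadraticForm ℝ (Fin q → ℝ)))))

/-! Smoothness on finite-dimensional real vector spaces does not depend on the norm; the norm
below is the sup norm of the coordinates in some basis. -/

noncomputable instance GrEven.instNormedAddCommGroup (q : ℕ) : NormedAddCommGroup (GrEven q) :=
  NormedAddCommGroup.induced (GrEven q) (Fin (Module.finrank ℝ (GrEven q)) → ℝ)
    (Module.finBasis ℝ (GrEven q)).equivFun (Module.finBasis ℝ (GrEven q)).equivFun.injective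

noncomputable instance GrEven.instNormedSpace (q : ℕ) : NormedSpace ℝ (GrEven q) :=
  NormedSpace.induced ℝ (GrEven q) (Fin (Module.finrank ℝ (GrEven q)) → ℝ)
    (Module.finBasis ℝ (GrEven q)).equivFun

/-- A map between (normed) `A₀`-modules is `A₀`-smooth if it is smooth and its derivative at each
point is `A₀`-linear. -/
def A0Smooth (q : ℕ) {V W : Type*} [NormedAddCommGroup V] [NormedSpace ℝ V] [Module (GrEven q) V]
    [NormedAddCommGroup W] [NormedSpace ℝ W] [Module (GrEven q) W] (f : V → W) : Prop :=
  ContDiff ℝ ((⊤ : ℕ∞) : WithTop ℕ∞) f ∧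
    ∀ (x : V) (a : GrEven q) (v : V), fderiv ℝ f x (a • v) = a • fderiv ℝ f x v

/-! ## The Baker-Campbell-Hausdorff series -/

section BCH

variable {V : Type*} [AddCommGroup V] [Module ℝ V] (br : V → V → V)

/-- The nested bracket `[x₁, [x₂, … [xₙ₋₁, xₙ]]]`. -/
def nestedBracket : List V → V
  | [] => 0
  | [x] => x
  | x :: y :: l => br x (nestedBracket (y :: l))

/-- The homogeneous part of degree `n` of the Baker-Campbell-Hausdorff series, in Dynkin's form:
the sum over `k ≥ 1` and over `r₁, s₁, …, r_k, s_k` with `r_i + s_i > 0` and total `n` of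
`(-1)^(k-1)/k · [X^r₁ Y^s₁ ⋯ X^r_k Y^s_k] / (n · ∏ r_i! s_i!)`. -/
noncomputable def bchTerm (X Y : V) (n : ℕ) : V :=
  ∑ k ∈ Finset.Icc 1 n, ((-1 : ℝ) ^ (k + 1) / (k : ℝ)) •
    ∑ e : Fin k → Fin (n + 1) × Fin (n + 1) with
        (∀ i, 0 < ((e i).1 : ℕ) + ((e i).2 : ℕ)) ∧
          ∑ i, (((e i).1 : ℕ) + ((e i).2 : ℕ)) = n,
      ((n : ℝ) * ∏ i, ((((e i).1 : ℕ)! : ℝ) * (((e i).2 : ℕ)! : ℝ)))⁻¹ •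
        nestedBracket br (List.ofFn fun i =>
          List.replicate ((e i).1 : ℕ) X ++ List.replicate ((e i).2 : ℕ) Y).flatten

/-- The Baker-Campbell-Hausdorff series `X + Y + [X, Y] / 2 + ⋯`, for a bracket for which all long
enough nested brackets vanish (so that only finitely many terms are nonzero). -/
noncomputable def bch (X Y : V) : V := ∑ᶠ n, bchTerm br X Y n

end BCH

/-! ## Lie superalgebras and their cochains -/

/-- The sign `(-1)^(|x||y|)` picked up when elements of parities `i` and `j` are interchanged. -/
def koszul (i j : ZMod 2) : ℝ := (-1) ^ (i.val * j.val)

/-- The structure of a real Lie superalgebra on a vector space `𝔫`. -/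
structure LieSuperalgebra (𝔫 : Type*) [AddCommGroup 𝔫] [Module ℝ 𝔫] where
  part : ZMod 2 → Submodule ℝ 𝔫
  isCompl : IsCompl (part 0) (part 1)
  bracket : 𝔫 →ₗ[ℝ] 𝔫 →ₗ[ℝ] 𝔫
  bracket_mem : ∀ {i j : ZMod 2} {x y : 𝔫}, x ∈ part i → y ∈ part j → bracket x y ∈ part (i + j)
  bracket_skew : ∀ {i j : ZMod 2} {x y : 𝔫}, x ∈ part i → y ∈ part j →
    bracket x y = -(koszul i j • bracket y x)
  jacobi : ∀ {i j k : ZMod 2} {x y z : 𝔫}, x ∈ part i → y ∈ part j → z ∈ part k →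
    bracket x (bracket y z) = bracket (bracket x y) z + koszul i j • bracket y (bracket x z)

namespace LieSuperalgebra

variable {𝔫 : Type*} [AddCommGroup 𝔫] [Module ℝ 𝔫] (L : LieSuperalgebra 𝔫)

/-- `𝔫` is nilpotent: for some `k`, any `k` nested brackets vanish. -/
def IsNilpotent : Prop :=
  ∃ k : ℕ, ∀ l : List 𝔫, l.length = k → ∀ y : 𝔫, l.foldr (fun x z => L.bracket x z) y = 0

/-- The projection of `𝔫` to its part of parity `i`. -/
noncomputable def proj (i : ZMod 2) : 𝔫 →ₗ[ℝ] 𝔫 :=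
  if i = 0 then (L.part 0).projection (L.part 1) L.isCompl
  else (L.part 1).projection (L.part 0) L.isCompl.symm

theorem proj_of_mem {i j : ZMod 2} {x : 𝔫} (hx : x ∈ L.part j) :
    L.proj i x = if i = j then x else 0 := by
  have h2 : ∀ i : ZMod 2, i = 0 ∨ i = 1 := by decide
  rcases h2 i with rfl | rfl <;> rcases h2 j with rfl | rfl <;> simp only [proj]
  · simpa using (Submodule.projection_eq_self_iff L.isCompl x).2 hx
  · simpa using (Submodule.projection_apply_eq_zero_iff L.isCompl).2 hx
  · simpa using (Submodule.projection_apply_eq_zero_iff L.isCompl.symm).2 hx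
  · simpa using (Submodule.projection_eq_self_iff L.isCompl.symm x).2 hx

/-- The space `C₀^p(𝔫)` of even `p`-cochains: the graded-antisymmetric, parity-preserving
`p`-linear maps `𝔫^p → ℝ`. -/
def evenCochains (p : ℕ) : Submodule ℝ (MultilinearMap ℝ (fun _ : Fin p => 𝔫) ℝ) where
  carrier := {ω |
    (∀ (i j : Fin p), (j : ℕ) = i + 1 → ∀ (e : Fin p → ZMod 2) (X : Fin p → 𝔫),
      (∀ k, X k ∈ L.part (e k)) → ω (X ∘ Equiv.swap i j) = -(koszul (e i) (e j) * ω X)) ∧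
    (∀ (e : Fin p → ZMod 2) (X : Fin p → 𝔫),
      (∀ k, X k ∈ L.part (e k)) → ∑ k, e k ≠ 0 → ω X = 0)}
  zero_mem' := by simp
  add_mem' := by
    rintro ω η ⟨h1, h2⟩ ⟨h3, h4⟩
    refine ⟨fun i j hij e X hX => ?_, fun e X hX he => ?_⟩
    · simp only [add_apply, h1 i j hij e X hX, h3 i j hij e X hX]; ring
    · simp only [add_apply, h2 e X hX he, h4 e X hX he]; ring
  smul_mem' := by
    rintro c ω ⟨h1, h2⟩
    refine ⟨fun i j hij e X hX => ?_, fun e X hX he => ?_⟩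
    · simp only [smul_apply, smul_eq_mul, h1 i j hij e X hX]; ring
    · simp only [smul_apply, smul_eq_mul, h2 e X hX he]; ring

/-- The sign `(-1)^(i+j) (-1)^(|X_i||X_j|) ε_1^(i-1)(i) ε_1^(j-1)(j)` in the coboundary, for
arguments of parities `e`. -/
def cobdSign {m : ℕ} (e : Fin m → ZMod 2) (i j : Fin m) : ℝ :=
  (-1) ^ ((i : ℕ) + (j : ℕ)) * koszul (e i) (e j) *
    (∏ k ∈ Finset.Iio i, koszul (e i) (e k)) * ∏ k ∈ Finset.Iio j, koszul (e j) (e k)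

/-- For `i < j`, the multilinear map
`(X_0, …, X_{m+1}) ↦ ω ([X_i, X_j], X_0, …, X̂_i, …, X̂_j, …, X_{m+1})`. -/
noncomputable def insertBracket {m : ℕ} (ω : MultilinearMap ℝ (fun _ : Fin (m + 1) => 𝔫) ℝ)
    (i : Fin (m + 1)) (j : Fin (m + 2)) : MultilinearMap ℝ (fun _ : Fin (m + 2) => 𝔫) ℝ :=
  LinearMap.uncurryMid j
    { toFun := fun Y => LinearMap.uncurryMid i (ω.curryLeft ∘ₗ L.bracket.flip Y)
      map_add' := fun Y Y' => by ext v; simp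
      map_smul' := fun c Y => by ext v; simp }

theorem insertBracket_apply {m : ℕ} (ω : MultilinearMap ℝ (fun _ : Fin (m + 1) => 𝔫) ℝ)
    (i : Fin (m + 1)) (j : Fin (m + 2)) (X : Fin (m + 2) → 𝔫) :
    L.insertBracket ω i j X =
      ω (Fin.cons (L.bracket (X (j.succAbove i)) (X j)) fun k => X (j.succAbove (i.succAbove k))) :=
  rfl

/-- The Lie superalgebra coboundary of even cochains with trivial coefficients. It is given on
homogeneous arguments by the formula in `cobd_apply`, and extended multilinearly. -/
noncomputable def cobd : {p : ℕ} → MultilinearMap ℝ (fun _ : Fin p => 𝔫) ℝ →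
    MultilinearMap ℝ (fun _ : Fin (p + 1) => 𝔫) ℝ
  | 0, _ => 0
  | m + 1, ω => ∑ e : Fin (m + 2) → ZMod 2,
      (∑ j : Fin (m + 2), ∑ i : Fin (m + 1) with i.castSucc < j,
        cobdSign e i.castSucc j • L.insertBracket ω i j).compLinearMap fun k => L.proj (e k)

theorem cobd_apply {m : ℕ} (ω : MultilinearMap ℝ (fun _ : Fin (m + 1) => 𝔫) ℝ)
    (e : Fin (m + 2) → ZMod 2) (X : Fin (m + 2) → 𝔫) (hX : ∀ k, X k ∈ L.part (e k)) :
    L.cobd ω X = ∑ j : Fin (m + 2), ∑ i : Fin (m + 1) with i.castSucc < j,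
      cobdSign e i.castSucc j *
        ω (Fin.cons (L.bracket (X i.castSucc) (X j)) fun k => X (j.succAbove (i.succAbove k))) := by
  have key : ∀ e' : Fin (m + 2) → ZMod 2, e' ≠ e → ∀ T : MultilinearMap ℝ
      (fun _ : Fin (m + 2) => 𝔫) ℝ, T (fun k => L.proj (e' k) (X k)) = 0 := by
    intro e' he T
    obtain ⟨k, hk⟩ := Function.ne_iff.1 he
    exact T.map_coord_zero k (by rw [L.proj_of_mem (hX k), if_neg hk])
  have hself : (fun k => L.proj (e k) (X k)) = X := by
    funext k
    rw [L.proj_of_mem (hX k), if_pos rfl]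
  simp only [cobd, sum_apply, MultilinearMap.compLinearMap_apply]
  rw [Finset.sum_eq_single e (fun e' _ he => ?_) (fun h => absurd (Finset.mem_univ e) h), hself]
  · refine Finset.sum_congr rfl fun j _ => Finset.sum_congr rfl fun i hi => ?_
    have hij : j.succAbove i = i.castSucc :=
      Fin.succAbove_of_castSucc_lt j i (Finset.mem_filter.1 hi).2
    rw [smul_apply, insertBracket_apply, hij, smul_eq_mul]
  · exact Finset.sum_eq_zero fun j _ => Finset.sum_eq_zero fun i _ => key e' he _

/-! ## `A`-points -/

/-- The even part `(A ⊗ 𝔫)₀ = A₀ ⊗ 𝔫₀ ⊕ A₁ ⊗ 𝔫₁` of `A ⊗ 𝔫`, for `A = Λ ℝ^q`. -/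
def evenPart (q : ℕ) : Submodule ℝ (Gr q ⊗[ℝ] 𝔫) :=
  Submodule.span ℝ {x | ∃ i : ZMod 2, ∃ a ∈ grPart q i, ∃ v ∈ L.part i, x = a ⊗ₜ[ℝ] v}

/-- The `A`-points `𝔫_A = (A ⊗ 𝔫)₀`. As a manifold, the group `N_A` is also `𝔫_A`, and
`exp_A : 𝔫_A → N_A` is the identity map. -/
def Points (q : ℕ) : Type _ := ↥(L.evenPart q)

theorem smul_mem_evenPart {q : ℕ} (a : GrEven q) {x : Gr q ⊗[ℝ] 𝔫} (hx : x ∈ L.evenPart q) :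
    (a : Gr q) • x ∈ L.evenPart q := by
  induction hx using Submodule.span_induction with
  | mem x h =>
    obtain ⟨i, b, hb, v, hv, rfl⟩ := h
    refine Submodule.subset_span ⟨i, (a : Gr q) * b, ?_, v, hv, by simp [TensorProduct.smul_tmul']⟩
    simpa using grPart_mul (mem_even_iff.1 a.2) hb
  | zero => simp
  | add x y _ _ hx hy => rw [smul_add]; exact add_mem hx hy
  | smul c x _ hx => rw [smul_comm]; exact Submodule.smul_mem _ c hx

namespace Points

instance (q : ℕ) : AddCommGroup (L.Points q) := inferInstanceAs (AddCommGroup ↥(L.evenPart q))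

instance (q : ℕ) : Module ℝ (L.Points q) := inferInstanceAs (Module ℝ ↥(L.evenPart q))

instance (q : ℕ) : Module (GrEven q) (L.Points q) where
  smul a x := ⟨(a : Gr q) • x.1, L.smul_mem_evenPart a x.2⟩
  one_smul x := Subtype.ext (one_smul (Gr q) x.1)
  mul_smul a b x := Subtype.ext (mul_smul (a : Gr q) (b : Gr q) x.1)
  smul_zero a := Subtype.ext (smul_zero (a : Gr q))
  smul_add a x y := Subtype.ext (smul_add (a : Gr q) x.1 y.1)
  add_smul a b x := Subtype.ext (add_smul (a : Gr q) (b : Gr q) x.1)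
  zero_smul x := Subtype.ext (zero_smul (Gr q) x.1)

variable [FiniteDimensional ℝ 𝔫]

instance (q : ℕ) : Module.Finite ℝ (L.Points q) :=
  inferInstanceAs (Module.Finite ℝ ↥(L.evenPart q))

noncomputable instance (q : ℕ) : NormedAddCommGroup (L.Points q) :=
  NormedAddCommGroup.induced (L.Points q) (Fin (Module.finrank ℝ (L.Points q)) → ℝ)
    (Module.finBasis ℝ (L.Points q)).equivFun (Module.finBasis ℝ (L.Points q)).equivFun.injective

noncomputable instance (q : ℕ) : NormedSpace ℝ (L.Points q) :=
  NormedSpace.induced ℝ (L.Points q) (Fin (Module.finrank ℝ (L.Points q)) → ℝ)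
    (Module.finBasis ℝ (L.Points q)).equivFun

end Points

/-- The bilinear map on `A ⊗ 𝔫` with `[a ⊗ x, b ⊗ y] = (b * a) ⊗ [x, y]`. -/
noncomputable def tensorBracket (q : ℕ) :
    Gr q ⊗[ℝ] 𝔫 →ₗ[ℝ] Gr q ⊗[ℝ] 𝔫 →ₗ[ℝ] Gr q ⊗[ℝ] 𝔫 :=
  LinearMap.BilinMap.tmul (LinearMap.mul ℝ (Gr q)).flip L.bracket

theorem tensorBracket_tmul {q : ℕ} (a b : Gr q) (x y : 𝔫) :
    L.tensorBracket q (a ⊗ₜ x) (b ⊗ₜ y) = (b * a) ⊗ₜ L.bracket x y := rfl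

theorem tensorBracket_mem {q : ℕ} {x y : Gr q ⊗[ℝ] 𝔫} (hx : x ∈ L.evenPart q)
    (hy : y ∈ L.evenPart q) : L.tensorBracket q x y ∈ L.evenPart q := by
  induction hx using Submodule.span_induction with
  | mem x h =>
    obtain ⟨i, a, ha, v, hv, rfl⟩ := h
    induction hy using Submodule.span_induction with
    | mem y h =>
      obtain ⟨j, b, hb, w, hw, rfl⟩ := h
      rw [tensorBracket_tmul]
      exact Submodule.subset_span
        ⟨i + j, b * a, add_comm j i ▸ grPart_mul hb ha, _, L.bracket_mem hv hw, rfl⟩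
    | zero => simp
    | add x y _ _ hx hy => rw [map_add]; exact add_mem hx hy
    | smul c x _ hx => rw [map_smul]; exact Submodule.smul_mem _ c hx
  | zero => simp
  | add x y _ _ hx hy => rw [map_add, LinearMap.add_apply]; exact add_mem hx hy
  | smul c x _ hx => rw [map_smul, LinearMap.smul_apply]; exact Submodule.smul_mem _ c hx

/-- The bracket `[-, -]_A` of the Lie algebra `𝔫_A`. -/
noncomputable def pointsBracket {q : ℕ} (x y : L.Points q) : L.Points q :=
  ⟨L.tensorBracket q x.1 y.1, L.tensorBracket_mem x.2 y.2⟩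

/-- The multiplication of the group `N_A`, given by the Baker-Campbell-Hausdorff formula. The
identity is `0` and the inverse is negation. -/
noncomputable def mul {q : ℕ} (x y : L.Points q) : L.Points q := bch L.pointsBracket x y

theorem map_mem_evenPart {q r : ℕ} (f : GrHom q r) {x : Gr q ⊗[ℝ] 𝔫} (hx : x ∈ L.evenPart q) :
    LinearMap.rTensor 𝔫 f.toAlgHom.toLinearMap x ∈ L.evenPart r := by
  induction hx using Submodule.span_induction with
  | mem x h =>
    obtain ⟨i, a, ha, v, hv, rfl⟩ := h
    exact Submodule.subset_span ⟨i, f.toAlgHom a, f.map_mem i a ha, v, hv, by simp⟩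
  | zero => simp
  | add x y _ _ hx hy => rw [map_add]; exact add_mem hx hy
  | smul c x _ hx => rw [map_smul]; exact Submodule.smul_mem _ c hx

/-- The map `N_f : N_A → N_B` (which is also `𝔫_f`) induced by a homomorphism `f : A → B`. -/
noncomputable def mapPoints {q r : ℕ} (f : GrHom q r) (x : L.Points q) : L.Points r :=
  ⟨LinearMap.rTensor 𝔫 f.toAlgHom.toLinearMap x.1, L.map_mem_evenPart f x.2⟩

section Finite

variable [FiniteDimensional ℝ 𝔫]

/-! ## Supergroup cochains -/

/-- The space `C^p(N)` of supergroup `p`-cochains: families of maps `N_A^p → A₀` which are natural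
in `A` and `A₀`-smooth, that is, maps of supermanifolds `N^p → ℝ`. -/
def groupCochains (p : ℕ) : Submodule ℝ (∀ q : ℕ, (Fin p → L.Points q) → GrEven q) where
  carrier := {F |
    (∀ (q r : ℕ) (f : GrHom q r) (g : Fin p → L.Points q),
      f.mapEven (F q g) = F r (fun i => L.mapPoints f (g i))) ∧
    ∀ q : ℕ, A0Smooth q (F q)}
  zero_mem' := by
    refine ⟨fun q r f g => Subtype.ext (map_zero f.toAlgHom), fun q => ⟨contDiff_const, ?_⟩⟩
    intro x a v
    simp [Pi.zero_def]
  add_mem' := by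
    rintro F G ⟨h1, h2⟩ ⟨h3, h4⟩
    refine ⟨fun q r f g => ?_, fun q => ⟨(h2 q).1.add (h4 q).1, fun x a v => ?_⟩⟩
    · simp only [Pi.add_apply, ← h1 q r f g, ← h3 q r f g]
      exact Subtype.ext (map_add f.toAlgHom _ _)
    · have hF := (h2 q).1.differentiable (by simp) x
      have hG := (h4 q).1.differentiable (by simp) x
      simp only [Pi.add_apply, fderiv_add hF hG, add_apply, (h2 q).2, (h4 q).2,
        smul_add]
  smul_mem' := by
    rintro c F ⟨h1, h2⟩
    refine ⟨fun q r f g => ?_, fun q => ⟨(h2 q).1.const_smul c, fun x a v => ?_⟩⟩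
    · simp only [Pi.smul_apply, ← h1 q r f g]
      exact Subtype.ext (map_smul f.toAlgHom _ _)
    · have hF := (h2 q).1.differentiable (by simp) x
      simp only [Pi.smul_apply, fderiv_const_smul hF, smul_apply, (h2 q).2]
      exact smul_comm c a _

/-- The supergroup coboundary with trivial coefficients:
`df (g_0, …, g_p) = f (g_1, …, g_p) + ∑_{i=1}^p (-1)^i f (…, g_{i-1} g_i, …)
  + (-1)^(p+1) f (g_0, …, g_{p-1})`. -/
noncomputable def groupCobd {p : ℕ} (F : ∀ q : ℕ, (Fin p → L.Points q) → GrEven q) (q : ℕ)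
    (g : Fin (p + 1) → L.Points q) : GrEven q :=
  F q (fun k => g k.succ) +
    ∑ i : Fin p, (-1 : ℝ) ^ ((i : ℕ) + 1) • F q (Fin.contractNth i.castSucc L.mul g) +
    (-1 : ℝ) ^ (p + 1) • F q (fun k => g k.castSucc)

/-! ## Simplices and integration -/

/-- A left-invariant notion of simplices in `N`. For `x` in the standard `p`-simplex,
`toFun q p x (n₀, …, n_p)` is the point `[n₀, …, n_p](x)` of `N_A`, where `A = Λ ℝ^q`; the values
for `x` outside of the simplex play no role. The maps are smooth on `Δ^p × N_A^(p+1)`, `A₀`-smooth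
for fixed `x`, equivariant for left multiplication, natural in `A`, send the vertices of `Δ^p` to
the given points, and restrict to `(p-1)`-simplices on the faces of `Δ^p`. -/
structure LeftInvariantSimplices where
  toFun : ∀ q p : ℕ, (Fin (p + 1) → ℝ) → (Fin (p + 1) → L.Points q) → L.Points q
  smooth : ∀ q p : ℕ, ContDiffOn ℝ ((⊤ : ℕ∞) : WithTop ℕ∞)
    (fun z : (Fin (p + 1) → ℝ) × (Fin (p + 1) → L.Points q) => toFun q p z.1 z.2)
    (stdSimplex ℝ (Fin (p + 1)) ×ˢ univ)
  A0_smooth : ∀ q p : ℕ, ∀ x ∈ stdSimplex ℝ (Fin (p + 1)), A0Smooth q (toFun q p x)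
  vertex : ∀ (q p : ℕ) (n : Fin (p + 1) → L.Points q) (i : Fin (p + 1)),
    toFun q p (Pi.single i 1) n = n i
  left_invariant : ∀ q p : ℕ, ∀ x ∈ stdSimplex ℝ (Fin (p + 1)),
    ∀ (g : L.Points q) (n : Fin (p + 1) → L.Points q),
      L.mul g (toFun q p x n) = toFun q p x (fun i => L.mul g (n i))
  face : ∀ q p : ℕ, ∀ x ∈ stdSimplex ℝ (Fin (p + 1)),
    ∀ (i : Fin (p + 2)) (n : Fin (p + 2) → L.Points q),
      toFun q (p + 1) (i.insertNth 0 x) n = toFun q p x (fun k => n (i.succAbove k))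
  natural : ∀ (q r p : ℕ) (f : GrHom q r), ∀ x ∈ stdSimplex ℝ (Fin (p + 1)),
    ∀ n : Fin (p + 1) → L.Points q,
      L.mapPoints f (toFun q p x n) = toFun r p x (fun i => L.mapPoints f (n i))

/-- The vertices `1, n₁, n₁ n₂, …, n₁ n₂ ⋯ n_p`. -/
noncomputable def vertices {q p : ℕ} (n : Fin p → L.Points q) (k : Fin (p + 1)) : L.Points q :=
  Fin.induction (motive := fun _ => L.Points q) 0 (fun i x => L.mul x (n i)) k

/-- The multilinear map `(A ⊗ 𝔫)^p → A` with
`(a₁ ⊗ v₁, …, a_p ⊗ v_p) ↦ a_p ⋯ a₁ ω (v₁, …, v_p)`, written in a basis of `𝔫`; see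
`tensorExtend_tmul`. -/
noncomputable def tensorExtend {p : ℕ} (ω : MultilinearMap ℝ (fun _ : Fin p => 𝔫) ℝ) (q : ℕ) :
    MultilinearMap ℝ (fun _ : Fin p => Gr q ⊗[ℝ] 𝔫) (Gr q) :=
  ∑ c : Fin p → Fin (Module.finrank ℝ 𝔫), ω (fun k => Module.finBasis ℝ 𝔫 (c k)) •
    ((MultilinearMap.mkPiAlgebraFin ℝ p (Gr q)).domDomCongr Fin.revPerm).compLinearMap fun k =>
      (TensorProduct.rid ℝ (Gr q)).toLinearMap ∘ₗ
        LinearMap.lTensor (Gr q) ((Module.finBasis ℝ 𝔫).coord (c k))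

theorem tensorExtend_tmul {p : ℕ} (ω : MultilinearMap ℝ (fun _ : Fin p => 𝔫) ℝ) (q : ℕ)
    (a : Fin p → Gr q) (v : Fin p → 𝔫) :
    tensorExtend ω q (fun k => a k ⊗ₜ v k) = ω v • (List.ofFn a).reverse.prod := by
  have hv : v = fun k => ∑ c, (Module.finBasis ℝ 𝔫).coord c (v k) • Module.finBasis ℝ 𝔫 c := by
    funext k
    exact ((Module.finBasis ℝ 𝔫).sum_repr (v k)).symm
  conv_rhs => rw [hv, ω.map_sum, Finset.sum_smul]
  simp only [tensorExtend, sum_apply]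
  refine Finset.sum_congr rfl fun c _ => ?_
  simp only [smul_apply, MultilinearMap.compLinearMap_apply, LinearMap.comp_apply,
    LinearMap.lTensor_tmul, LinearEquiv.coe_coe, TensorProduct.rid_tmul]
  rw [MultilinearMap.map_smul_univ, MultilinearMap.map_smul_univ, smul_smul, smul_eq_mul, mul_comm]
  congr 1
  simp only [MultilinearMap.domDomCongr_apply, MultilinearMap.mkPiAlgebraFin_apply,
    Fin.revPerm_apply]
  congr 1
  refine List.ext_getElem (by simp) fun i h1 h2 => ?_
  simp only [List.getElem_ofFn, List.getElem_reverse, List.length_ofFn]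
  congr 1
  ext
  simp only [Fin.val_rev]
  omega

theorem multilinear_mem_of_span {M W : Type*} [AddCommGroup M] [Module ℝ M] [AddCommGroup W]
    [Module ℝ W] (S : Set M) (T : Submodule ℝ W) {p : ℕ}
    (F : MultilinearMap ℝ (fun _ : Fin p => M) W)
    (h : ∀ y : Fin p → M, (∀ k, y k ∈ S) → F y ∈ T) {x : Fin p → M}
    (hx : ∀ k, x k ∈ Submodule.span ℝ S) : F x ∈ T := by
  induction p with
  | zero => exact h x fun k => k.elim0
  | succ p ih =>
    have key : ∀ y ∈ Submodule.span ℝ S, F (Fin.cons y (Fin.tail x)) ∈ T := by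
      intro y hy
      induction hy using Submodule.span_induction with
      | mem y hy =>
        refine ih (F.curryLeft y) (fun z hz => h _ fun k => ?_) fun k => hx k.succ
        exact Fin.cases hy hz k
      | zero => rw [← F.curryLeft_apply, map_zero]; exact T.zero_mem
      | add y z _ _ hy hz =>
        rw [← F.curryLeft_apply, map_add]
        exact T.add_mem hy hz
      | smul c y _ hy =>
        rw [← F.curryLeft_apply, map_smul]
        exact T.smul_mem c hy
    simpa using key (x 0) (hx 0)

theorem list_prod_mem_grPart {q : ℕ} :
    ∀ {p : ℕ} (e : Fin p → ZMod 2) (a : Fin p → Gr q), (∀ k, a k ∈ grPart q (e k)) →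
      (List.ofFn a).reverse.prod ∈ grPart q (∑ k, e k)
  | 0, e, a, _ => by simpa using mem_even_iff.1 (Subalgebra.one_mem _)
  | p + 1, e, a, h => by
    rw [List.ofFn_succ, List.reverse_cons, List.prod_append, List.prod_singleton, Fin.sum_univ_succ,
      add_comm]
    exact grPart_mul (list_prod_mem_grPart _ _ fun k => h k.succ) (h 0)

theorem tensorExtend_mem {p : ℕ} {ω : MultilinearMap ℝ (fun _ : Fin p => 𝔫) ℝ}
    (hω : ω ∈ L.evenCochains p) (q : ℕ) {x : Fin p → Gr q ⊗[ℝ] 𝔫}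
    (hx : ∀ k, x k ∈ L.evenPart q) : tensorExtend ω q x ∈ grPart q 0 := by
  refine multilinear_mem_of_span _ _ _ (fun y hy => ?_) hx
  choose e a ha v hv hy using hy
  obtain rfl : y = fun k => a k ⊗ₜ[ℝ] v k := funext hy
  rw [tensorExtend_tmul]
  by_cases he : ∑ k, e k = 0
  · exact Submodule.smul_mem _ _ (he ▸ list_prod_mem_grPart e a ha)
  · rw [hω.2 e v hv he, zero_smul]
    exact Submodule.zero_mem _

/-- The cochain `ω_A : 𝔫_A^p → A₀` induced by an even cochain `ω`. -/
noncomputable def cochainOnPoints {p : ℕ} (ω : L.evenCochains p) (q : ℕ) (x : Fin p → L.Points q) :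
    GrEven q :=
  ⟨tensorExtend ω.1 q (fun k => (x k).1), L.tensorExtend_mem ω.2 q fun k => (x k).2⟩

/-- The left-invariant `A₀`-valued `p`-form on `N_A` which is `ω_A` at the identity, at the point
`g` and on the tangent vectors `v`: these are carried to the identity by the derivative of left
multiplication by `g⁻¹`, which is `-g`. -/
noncomputable def leftInvariantForm {p : ℕ} (ω : L.evenCochains p) (q : ℕ) (g : L.Points q)
    (v : Fin p → L.Points q) : GrEven q :=
  L.cochainOnPoints ω q fun k => fderiv ℝ (fun h : L.Points q => L.mul (-g) h) g (v k)

/-- The simplex `{t ∈ ℝ^p : t_i ≥ 0, ∑ t_i ≤ 1}`, which parametrizes the standard `p`-simplex by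
`t ↦ (1 - ∑ t_i, t_1, …, t_p)`. -/
def cornerSimplex (p : ℕ) : Set (Fin p → ℝ) := {t | (∀ i, 0 ≤ t i) ∧ ∑ i, t i ≤ 1}

/-- The parametrization of the standard `p`-simplex by `cornerSimplex p`. -/
def simplexChart {p : ℕ} (t : Fin p → ℝ) : Fin (p + 1) → ℝ := Fin.cons (1 - ∑ i, t i) t

/-- The integral `∫_σ ω_A` of the left-invariant form `ω_A` over a `p`-simplex `σ` in `N_A`. -/
noncomputable def integral {p : ℕ} (ω : L.evenCochains p) (q : ℕ)
    (σ : (Fin (p + 1) → ℝ) → L.Points q) : GrEven q :=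
  ∫ t in cornerSimplex p, L.leftInvariantForm ω q (σ (simplexChart t)) fun k =>
    fderivWithin ℝ (fun s => σ (simplexChart s)) (cornerSimplex p) t (Pi.single k 1)

end Finite

end LieSuperalgebra

/-! ## Exponential and logarithm of nilpotent elements -/

/-! Passing to `A`-points turns the super statement into an ordinary one. With the reversed product
`a_p ⋯ a_1` the Koszul signs of the Grassmann coefficients cancel those of the super objects: `𝔫_A`
is an ordinary nilpotent Lie algebra, `ω_A` is an ordinary alternating form, and `(dω)_A` is the
ordinary Chevalley-Eilenberg coboundary of `ω_A` (`tensorExtend_cobd`). On the group `N_A` the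
exterior derivative of the left-invariant form `ω_A` is then the left-invariant form of `(dω)_A`
(`extDeriv_invariantForm_eq`). Stokes' theorem on a simplex (`integral_cobd`) writes the integral of
`dω` as the alternating sum of the integrals over the faces. The face of `[1, n₁, n₁n₂, …]` that
omits the vertex `1` is a left translate by `n₁` of a simplex of the same kind, omitting an inner
vertex multiplies two neighbouring arguments, and omitting the last vertex drops the last argument.
These are the terms of the group coboundary.

The group law is given by Dynkin's explicit series, so its associativity has to be derived
(`bch_assoc`). Suppose `E` satisfies `[E, x] = x` and `[E, y] = y`. The operator `Z = log (exp ad x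
· exp ad y)` is a derivation, being the logarithm of an automorphism. Applied to `E`, the
associative words in `Z` become nested brackets, which is how Dynkin's formula arises: `Z` and `ad
(bch x y)` agree at `E`. Their difference is a derivation killing `E`, so it commutes with `ad E`;
its homogeneous components have positive weights for `ad E` and hence vanish. Such an `E` is
available after replacing `𝔤` by `𝔤[X] ⋊ ℝ X d/dX` and `x` by `X ⊗ x`; setting `X = 1` returns to
`𝔤`. In the extension an element of `𝔤[X]` without constant term is determined by its adjoint action
on `E`, so associativity of operator composition gives associativity of the series.

Two facts are obtained indirectly. Graded antisymmetry of `dω` follows from the alternation of the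
exterior derivative at the identity, tested on Grassmann algebras with enough generators
(`cobd_mem_of_pointsCobd_swap`). `A₀`-smoothness of the integral follows by differentiating under
the integral sign, the velocity of a simplex being `A₀`-smooth in its vertices because second
derivatives are symmetric (`A0Smooth.fderivWithin_fst`). -/

section NilpotentExp

variable {A : Type*} [Ring A] [Algebra ℝ A]

/-- The exponential `∑ aⁱ / i!` of a nilpotent element `a`. -/
noncomputable def nilExp (a : A) : A :=
  ∑ i ∈ Finset.range (nilpotencyClass a), ((i ! : ℝ)⁻¹) • a ^ i

/-- The truncated logarithm of `1 + a`. -/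
noncomputable def nilLog (N : ℕ) (a : A) : A :=
  ∑ k ∈ Finset.Icc 1 N, ((-1 : ℝ) ^ (k + 1) / (k : ℝ)) • a ^ k

/-- Makes the known facts about `IsNilpotent.exp`, which has rational coefficients, available for
real ones. -/
theorem nilExp_eq_isNilpotent_exp [Module ℚ A] (a : A) : nilExp a = IsNilpotent.exp a := by
  unfold nilExp IsNilpotent.exp
  refine Finset.sum_congr rfl fun i _ => ?_
  have h := map_rat_smul ((LinearMap.toSpanSingleton ℝ A (a ^ i)).toAddMonoidHom) ((i ! : ℚ)⁻¹) (1 : ℝ)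
  have h2 : ((i ! : ℚ)⁻¹ • (1 : ℝ)) = (i ! : ℝ)⁻¹ := by
    rw [Rat.smul_def]; simp
  rw [h2] at h
  simpa using h

theorem nilExp_eq_sum {a : A} {k : ℕ} (h : a ^ k = 0) :
    nilExp a = ∑ i ∈ Finset.range k, ((i ! : ℝ)⁻¹) • a ^ i := by
  have hk : nilpotencyClass a ≤ k := csInf_le' h
  have hz : ∀ i, i ∉ Finset.range (nilpotencyClass a) → ((i ! : ℝ)⁻¹) • a ^ i = 0 := by
    intro i hi
    rw [pow_eq_zero_of_le (by simpa using hi) (pow_nilpotencyClass ⟨k, h⟩), smul_zero]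
  exact Finset.sum_subset (Finset.range_mono hk) fun i _ hi => hz i hi

theorem nilExp_add_of_commute {a b : A} (h : Commute a b) (ha : IsNilpotent a)
    (hb : IsNilpotent b) : nilExp (a + b) = nilExp a * nilExp b := by
  let _ : Module ℚ A := Module.compHom A (algebraMap ℚ ℝ)
  simp only [nilExp_eq_isNilpotent_exp]
  exact IsNilpotent.exp_add_of_commute h ha hb

theorem map_nilExp {B : Type*} [Ring B] [Algebra ℝ B] {a : A} (ha : IsNilpotent a)
    (f : A →ₐ[ℝ] B) : f (nilExp a) = nilExp (f a) := by
  obtain ⟨k, hk⟩ := ha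
  have hk' : (f a) ^ k = 0 := by rw [← map_pow, hk, map_zero]
  simp [nilExp_eq_sum hk, nilExp_eq_sum hk']

theorem nilExp_zero : nilExp (0 : A) = 1 := by
  rw [nilExp_eq_sum (pow_one (0 : A))]; simp

theorem nilExp_mul_neg {a : A} (ha : IsNilpotent a) : nilExp a * nilExp (-a) = 1 := by
  rw [← nilExp_add_of_commute (Commute.neg_right rfl) ha ha.neg, add_neg_cancel, nilExp_zero]

/-- If `a ^ (k + 2) = 0`, multiplying `exp a = 1` by `a ^ k` leaves `a ^ (k + 1) = 0`, so the
nilpotency index can be lowered down to one. -/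
theorem eq_zero_of_nilExp_eq_one {a : A} (ha : IsNilpotent a) (h : nilExp a = 1) : a = 0 := by
  obtain ⟨k, hk⟩ := ha
  induction k with
  | zero => rw [pow_zero] at hk; rw [← mul_one a, hk, mul_zero]
  | succ k ih =>
    rcases k with _ | k
    · simpa using hk
    refine ih ?_
    have h1 : a ^ k * nilExp a = a ^ k := by rw [h, mul_one]
    rw [nilExp_eq_sum hk, Finset.mul_sum, Finset.sum_range_succ', Finset.sum_range_succ'] at h1
    have h2 : ∀ i ∈ Finset.range k, a ^ k * (((i + 1 + 1)! : ℝ)⁻¹ • a ^ (i + 1 + 1)) = 0 := by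
      intro i _
      rw [mul_smul_comm, ← pow_add, pow_eq_zero_of_le (by omega) hk, smul_zero]
    rw [Finset.sum_eq_zero h2] at h1
    simpa [pow_succ] using h1

theorem nilExp_injective_of_commute {a b : A} (hab : Commute a b) (ha : IsNilpotent a)
    (hb : IsNilpotent b) (h : nilExp a = nilExp b) : a = b := by
  have h1 : nilExp (a + -b) = 1 := by
    rw [nilExp_add_of_commute hab.neg_right ha hb.neg, h, nilExp_mul_neg hb]
  have h2 := eq_zero_of_nilExp_eq_one (hab.neg_right.isNilpotent_add ha hb.neg) h1
  rwa [← sub_eq_add_neg, sub_eq_zero] at h2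

theorem Commute.nilExp_right {a b : A} (h : Commute a b) : Commute a (nilExp b) :=
  Commute.sum_right _ _ _ fun i _ => (h.pow_right i).smul_right _

theorem Commute.nilLog_right {a b : A} (h : Commute a b) (N : ℕ) : Commute a (nilLog N b) :=
  Commute.sum_right _ _ _ fun i _ => (h.pow_right i).smul_right _

theorem map_nilLog {B : Type*} [Ring B] [Algebra ℝ B] (N : ℕ) (a : A)
    (f : A →ₐ[ℝ] B) : f (nilLog N a) = nilLog N (f a) := by
  simp [nilLog]

theorem nilLog_eq_mul (N : ℕ) (a : A) : ∃ b, nilLog N a = a * b ∧ Commute a b := by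
  refine ⟨∑ k ∈ Finset.Icc 1 N, ((-1 : ℝ) ^ (k + 1) / (k : ℝ)) • a ^ (k - 1), ?_, ?_⟩
  · rw [nilLog, Finset.mul_sum]
    refine Finset.sum_congr rfl fun k hk => ?_
    rw [mul_smul_comm, ← pow_succ', Nat.sub_add_cancel (Finset.mem_Icc.1 hk).1]
  · exact Commute.sum_right _ _ _ fun i _ => ((Commute.refl a).pow_right _).smul_right _

theorem isNilpotent_nilLog (N : ℕ) {a : A} (ha : IsNilpotent a) : IsNilpotent (nilLog N a) := by
  obtain ⟨b, hb, hab⟩ := nilLog_eq_mul N a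
  rw [hb]
  exact hab.isNilpotent_mul_right ha

theorem isNilpotent_nilExp_sub_one {a : A} (ha : IsNilpotent a) : IsNilpotent (nilExp a - 1) := by
  let _ : Module ℚ A := Module.compHom A (algebraMap ℚ ℝ)
  rw [nilExp_eq_isNilpotent_exp]
  let _ : Algebra ℚ A := Algebra.compHom A (algebraMap ℚ ℝ)
  exact IsNilpotent.isNilpotent_exp_sub_one ha

section Polynomial

open Polynomial

/-- The identity `exp (log (1 + X)) = 1 + X` with both series truncated. The composite `p` satisfies
the differential equation `(1 + X) p' = p` modulo `X ^ N` with `p(0) = 1`, and this determines its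
coefficients up to degree `N`. -/
theorem Polynomial.sum_pow_nilLog_X (N : ℕ) :
    (X : ℝ[X]) ^ (N + 1) ∣
      ∑ i ∈ Finset.range (N + 1), ((i ! : ℝ)⁻¹) • (nilLog N (X : ℝ[X])) ^ i - (1 + X) := by
  set l : ℝ[X] := nilLog N X with hl
  set p : ℝ[X] := ∑ i ∈ Finset.range (N + 1), ((i ! : ℝ)⁻¹) • l ^ i with hp
  obtain ⟨b, hb, -⟩ := nilLog_eq_mul N (X : ℝ[X])
  -- The derivative of the truncated logarithm is a finite geometric series, hence the error term
  -- `(-X) ^ N`.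
  have hdl : (1 + X) * derivative l = 1 - (-X) ^ N := by
    have h1 : derivative l = ∑ k ∈ Finset.range N, (-X : ℝ[X]) ^ k := by
      rw [hl]
      clear_value l p
      clear hb hl hp
      induction N with
      | zero => simp [nilLog]
      | succ M ih =>
        have h2 : nilLog (M + 1) (X : ℝ[X]) =
            nilLog M X + ((-1 : ℝ) ^ (M + 2) / ((M + 1 : ℕ) : ℝ)) • X ^ (M + 1) :=
          Finset.sum_Icc_succ_top (by omega) _
        rw [h2, derivative_add, ih, Finset.sum_range_succ, derivative_smul, derivative_X_pow,
          Nat.add_sub_cancel, ← smul_eq_C_mul, smul_smul, div_mul_cancel₀ _ (by positivity),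
          neg_pow (X : ℝ[X]) M, pow_add, neg_one_sq, mul_one, smul_eq_C_mul]
        simp
    rw [h1, ← mul_neg_geom_sum]
    ring
  have hdp : derivative p = derivative l * ∑ i ∈ Finset.range N, ((i ! : ℝ)⁻¹) • l ^ i := by
    rw [hp, derivative_sum, Finset.sum_range_succ', Finset.mul_sum]
    simp only [derivative_smul, derivative_pow, pow_zero, derivative_one, smul_zero, add_zero]
    refine Finset.sum_congr rfl fun i _ => ?_
    rw [Nat.factorial_succ]
    simp only [smul_eq_C_mul, Nat.cast_mul, Nat.add_sub_cancel]
    have : (C ((((i + 1 : ℕ) : ℝ) * (i ! : ℝ))⁻¹) * C ((i + 1 : ℕ) : ℝ) : ℝ[X]) = C ((i ! : ℝ)⁻¹) := by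
      rw [← C_mul]; congr 1; field_simp
    rw [← this]; ring
  have hode : (X : ℝ[X]) ^ N ∣ (1 + X) * derivative p - p := by
    have h1 : ∑ i ∈ Finset.range N, ((i ! : ℝ)⁻¹) • l ^ i = p - ((N ! : ℝ)⁻¹) • l ^ N := by
      rw [hp, Finset.sum_range_succ]; ring
    have h2 : (X : ℝ[X]) ^ N ∣ l ^ N := by rw [hl, hb, mul_pow]; exact dvd_mul_right _ _
    have h3 : (1 + X) * derivative p - p =
        -((1 - (-X) ^ N) * (((N ! : ℝ)⁻¹) • l ^ N)) - (-X) ^ N * p := by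
      rw [hdp, h1, ← mul_assoc, hdl]; ring
    rw [h3]
    refine dvd_sub (dvd_neg.2 (Dvd.dvd.mul_left (h2.trans ?_) _)) (Dvd.dvd.mul_right ?_ _)
    · rw [smul_eq_C_mul]; exact dvd_mul_left _ _
    · rw [neg_pow]; exact dvd_mul_left _ _
  have h0 : p.coeff 0 = 1 := by
    rw [hp, coeff_zero_eq_eval_zero, eval_finsetSum, Finset.sum_range_succ']
    rw [hl, hb]
    simp
  rw [X_pow_dvd_iff] at hode ⊢
  -- The factor `1 - n` vanishes at `n = 1`, so the recursion kills all coefficients from degree two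
  -- on.
  have hrec : ∀ n < N, (n + 1 : ℝ) * p.coeff (n + 1) = (1 - n) * p.coeff n := by
    intro n hn
    have := hode n hn
    rw [add_mul, one_mul, coeff_sub, coeff_add, coeff_derivative] at this
    rcases n with _ | n
    · simp at this ⊢; linarith
    · rw [coeff_X_mul, coeff_derivative] at this
      push_cast at this ⊢; linarith
  have key : ∀ n ≤ N, p.coeff n = (1 + X : ℝ[X]).coeff n := by
    intro n
    induction n with
    | zero => intro _; simp [h0]
    | succ n ih =>
      intro hn
      have h1 := hrec n hn
      rw [ih (by omega)] at h1
      rcases n with _ | _ | n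
      · simpa [coeff_one] using h1
      · simpa [coeff_one, coeff_X] using h1
      · simp [coeff_one, coeff_X] at h1 ⊢
        exact h1.resolve_left (by positivity)
  intro d hd
  rw [coeff_sub, key d (by omega), sub_self]

end Polynomial

theorem nilExp_nilLog {N : ℕ} {a : A} (h : a ^ (N + 1) = 0) : nilExp (nilLog N a) = 1 + a := by
  obtain ⟨b, hb, hab⟩ := nilLog_eq_mul N a
  have h1 : (nilLog N a) ^ (N + 1) = 0 := by rw [hb, hab.mul_pow, h, zero_mul]
  obtain ⟨c, hc⟩ := Polynomial.sum_pow_nilLog_X N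
  have h2 := congrArg (Polynomial.aeval a) hc
  rw [map_mul, map_pow, Polynomial.aeval_X, h, zero_mul, map_sub, sub_eq_zero] at h2
  rw [nilExp_eq_sum h1]
  simpa [map_nilLog] using h2

/-- Both sides are nilpotent, commute and have the same exponential by `nilExp_nilLog`; `exp` is
injective on commuting nilpotents. -/
theorem nilLog_nilExp {N : ℕ} {a : A} (ha : IsNilpotent a) (h : (nilExp a - 1) ^ (N + 1) = 0) :
    nilLog N (nilExp a - 1) = a := by
  have hc : Commute a (nilExp a - 1) := (Commute.refl a).nilExp_right.sub_right (Commute.one_right a)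
  refine nilExp_injective_of_commute (hc.nilLog_right N).symm (isNilpotent_nilLog N ⟨_, h⟩) ha ?_
  rw [nilExp_nilLog h, add_sub_cancel]

end NilpotentExp

/-! ### Exponentials and logarithms along intertwining maps -/

section Intertwine

variable {V W : Type*} [AddCommGroup V] [Module ℝ V] [AddCommGroup W] [Module ℝ W]

/-- Since `exp` and `log` of nilpotents are polynomials, this transports them along any linear map
intertwining two operators: below, the bracket on the tensor square, the embedding of `𝔤[X]` into
its extension, and evaluation of polynomials. -/
theorem LinearMap.intertwine_pow {f : V →ₗ[ℝ] W} {a : Module.End ℝ V} {b : Module.End ℝ W}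
    (h : f ∘ₗ a = b ∘ₗ f) (n : ℕ) : f ∘ₗ a ^ n = (b ^ n) ∘ₗ f := by
  induction n with
  | zero => rfl
  | succ n ih =>
    rw [pow_succ, pow_succ, Module.End.mul_eq_comp, Module.End.mul_eq_comp, ← LinearMap.comp_assoc,
      ih, LinearMap.comp_assoc, h, LinearMap.comp_assoc]

theorem LinearMap.intertwine_nilLog {f : V →ₗ[ℝ] W} {a : Module.End ℝ V} {b : Module.End ℝ W}
    (h : f ∘ₗ a = b ∘ₗ f) (N : ℕ) : f ∘ₗ nilLog N a = nilLog N b ∘ₗ f := by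
  ext v
  have h1 (n : ℕ) : f ((a ^ n) v) = (b ^ n) (f v) :=
    LinearMap.congr_fun (LinearMap.intertwine_pow h n) v
  simp [nilLog, h1]

theorem LinearMap.intertwine_nilExp {f : V →ₗ[ℝ] W} {a : Module.End ℝ V} {b : Module.End ℝ W}
    (h : f ∘ₗ a = b ∘ₗ f) (ha : IsNilpotent a) (hb : IsNilpotent b) :
    f ∘ₗ nilExp a = nilExp b ∘ₗ f := by
  obtain ⟨k, hk⟩ := ha
  obtain ⟨l, hl⟩ := hb
  ext v
  have h1 (n : ℕ) : f ((a ^ n) v) = (b ^ n) (f v) :=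
    LinearMap.congr_fun (LinearMap.intertwine_pow h n) v
  rw [nilExp_eq_sum (pow_eq_zero_of_le (le_max_left k l) hk),
    nilExp_eq_sum (pow_eq_zero_of_le (le_max_right k l) hl)]
  simp [h1]

theorem LinearMap.isNilpotent_of_injective {f : V →ₗ[ℝ] W} {a : Module.End ℝ V}
    {b : Module.End ℝ W} (h : f ∘ₗ a = b ∘ₗ f) (hf : Function.Injective f) (hb : IsNilpotent b) :
    IsNilpotent a := by
  obtain ⟨l, hl⟩ := hb
  refine ⟨l, LinearMap.ext fun v => hf ?_⟩
  have := LinearMap.congr_fun (LinearMap.intertwine_pow h l) v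
  simpa [hl] using this

theorem LinearMap.isNilpotent_of_surjective {f : V →ₗ[ℝ] W} {a : Module.End ℝ V}
    {b : Module.End ℝ W} (h : f ∘ₗ a = b ∘ₗ f) (hf : Function.Surjective f) (ha : IsNilpotent a) :
    IsNilpotent b := by
  obtain ⟨l, hl⟩ := ha
  refine ⟨l, LinearMap.ext fun w => ?_⟩
  obtain ⟨v, rfl⟩ := hf w
  have := LinearMap.congr_fun (LinearMap.intertwine_pow h l) v
  simpa [hl] using this.symm

end Intertwine

/-! ### Derivations and automorphisms of a Lie algebra -/

section Derivation

variable {𝔤 : Type*} [LieRing 𝔤] [LieAlgebra ℝ 𝔤]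

/-- The bracket of a Lie algebra as a linear map on the tensor square. -/
noncomputable def lieTensor (𝔤 : Type*) [LieRing 𝔤] [LieAlgebra ℝ 𝔤] : 𝔤 ⊗[ℝ] 𝔤 →ₗ[ℝ] 𝔤 :=
  TensorProduct.lift (LieAlgebra.ad ℝ 𝔤 : 𝔤 →ₗ[ℝ] Module.End ℝ 𝔤)

theorem lieTensor_tmul (a b : 𝔤) : lieTensor 𝔤 (a ⊗ₜ b) = ⁅a, b⁆ := rfl

/-- The operator `Z ⊗ 1 + 1 ⊗ Z` on the tensor square. -/
noncomputable def tensorSum {V : Type*} [AddCommGroup V] [Module ℝ V] (Z : Module.End ℝ V) :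
    Module.End ℝ (V ⊗[ℝ] V) :=
  Z.lTensor V + Z.rTensor V

theorem isNilpotent_tensorSum {V : Type*} [AddCommGroup V] [Module ℝ V] {Z : Module.End ℝ V}
    (hZ : IsNilpotent Z) : IsNilpotent (tensorSum Z) := by
  have h1 : IsNilpotent (Z.lTensor V) := hZ.map (Module.End.lTensorAlgHom ℝ V V)
  have h2 : IsNilpotent (Z.rTensor V) := hZ.map (Module.End.rTensorAlgHom ℝ V V)
  have hc : Commute (Z.lTensor V) (Z.rTensor V) := by ext; simp
  exact hc.isNilpotent_add h1 h2

theorem nilExp_tensorSum {V : Type*} [AddCommGroup V] [Module ℝ V] {Z : Module.End ℝ V}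
    (hZ : IsNilpotent Z) : nilExp (tensorSum Z) = TensorProduct.map (nilExp Z) (nilExp Z) := by
  have h1 : IsNilpotent (Z.lTensor V) := hZ.map (Module.End.lTensorAlgHom ℝ V V)
  have h2 : IsNilpotent (Z.rTensor V) := hZ.map (Module.End.rTensorAlgHom ℝ V V)
  have hc : Commute (Z.lTensor V) (Z.rTensor V) := by ext; simp
  have h3 : nilExp (Z.lTensor V) = (nilExp Z).lTensor V :=
    (map_nilExp hZ (Module.End.lTensorAlgHom ℝ V V)).symm
  have h4 : nilExp (Z.rTensor V) = (nilExp Z).rTensor V :=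
    (map_nilExp hZ (Module.End.rTensorAlgHom ℝ V V)).symm
  rw [tensorSum, nilExp_add_of_commute hc h1 h2, h3, h4]
  ext; simp

/-- The Jacobi identity says that the bracket intertwines `ad u ⊗ 1 + 1 ⊗ ad u` with `ad u`.
Exponentiating, it intertwines `exp (ad u) ⊗ exp (ad u)` with `exp (ad u)`. -/
theorem nilExp_ad_lie {u : 𝔤} (hu : IsNilpotent (LieAlgebra.ad ℝ 𝔤 u)) (a b : 𝔤) :
    nilExp (LieAlgebra.ad ℝ 𝔤 u) ⁅a, b⁆ =
      ⁅nilExp (LieAlgebra.ad ℝ 𝔤 u) a, nilExp (LieAlgebra.ad ℝ 𝔤 u) b⁆ := by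
  have h : lieTensor 𝔤 ∘ₗ tensorSum (LieAlgebra.ad ℝ 𝔤 u) =
      LieAlgebra.ad ℝ 𝔤 u ∘ₗ lieTensor 𝔤 := by
    ext x y
    simp [tensorSum, lieTensor_tmul]
  have h1 := LinearMap.congr_fun
    (LinearMap.intertwine_nilExp h (isNilpotent_tensorSum hu) hu) (a ⊗ₜ b)
  rw [nilExp_tensorSum hu] at h1
  exact h1.symm

/-- The converse passage: an automorphism `exp Z` is intertwined by the bracket with `exp Z ⊗ exp
Z`, and taking logarithms of both gives the Leibniz rule for `Z`. -/
theorem lie_of_nilExp_lie {Z : Module.End ℝ 𝔤} (hZ : IsNilpotent Z)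
    (h : ∀ a b, nilExp Z ⁅a, b⁆ = ⁅nilExp Z a, nilExp Z b⁆) (a b : 𝔤) :
    Z ⁅a, b⁆ = ⁅Z a, b⁆ + ⁅a, Z b⁆ := by
  have h1 : lieTensor 𝔤 ∘ₗ (nilExp (tensorSum Z) - 1) = (nilExp Z - 1) ∘ₗ lieTensor 𝔤 := by
    rw [nilExp_tensorSum hZ]
    ext x y
    simp [lieTensor_tmul, h]
  obtain ⟨k, hk⟩ := isNilpotent_nilExp_sub_one hZ
  obtain ⟨l, hl⟩ := isNilpotent_nilExp_sub_one (isNilpotent_tensorSum hZ)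
  -- One truncation order that is long enough for both logarithms.
  have h2 := LinearMap.intertwine_nilLog h1 (max k l)
  rw [nilLog_nilExp hZ (pow_eq_zero_of_le (by omega) hk),
    nilLog_nilExp (isNilpotent_tensorSum hZ) (pow_eq_zero_of_le (by omega) hl)] at h2
  have h3 := LinearMap.congr_fun h2 (a ⊗ₜ b)
  simp [tensorSum, lieTensor_tmul] at h3
  rw [← h3, add_comm]

end Derivation

/-- Applying `T - m` removes the `m`-th vector and multiplies each of the others by a nonzero
scalar. -/
theorem eq_zero_of_sum_eigenvectors {V : Type*} [AddCommGroup V] [Module ℝ V]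
    (T : Module.End ℝ V) (s : Finset ℕ) (w : ℕ → V) (hw : ∀ n ∈ s, T (w n) = (n : ℝ) • w n)
    (h : ∑ n ∈ s, w n = 0) : ∀ n ∈ s, w n = 0 := by
  induction s using Finset.induction_on generalizing w with
  | empty => simp
  | insert m s hm ih =>
    have h1 : ∀ n ∈ s, ((n : ℝ) - m) • w n = 0 := by
      refine ih (fun n => ((n : ℝ) - m) • w n) (fun n hn => ?_) ?_
      · rw [map_smul, hw n (Finset.mem_insert_of_mem hn), smul_comm]
      · have h2 := congrArg T h
        rw [map_sum, map_zero, Finset.sum_congr rfl hw, Finset.sum_insert hm] at h2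
        rw [Finset.sum_insert hm] at h
        simp only [sub_smul, Finset.sum_sub_distrib, ← Finset.smul_sum]
        rw [eq_neg_of_add_eq_zero_right h2, eq_neg_of_add_eq_zero_right h]
        simp
    have h3 : ∀ n ∈ s, w n = 0 := fun n hn =>
      (smul_eq_zero.1 (h1 n hn)).resolve_left (sub_ne_zero.2 (by
        rintro h; exact hm (by rwa [← Nat.cast_injective h])))
    intro n hn
    rcases Finset.mem_insert.1 hn with rfl | hn
    · rwa [Finset.sum_insert hm, Finset.sum_eq_zero h3, add_zero] at h
    · exact h3 n hn

/-! ### Dynkin words and the terms of the series -/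

section Dynkin

/-- The word `x^r₁ y^s₁ ⋯ x^r_k y^s_k`. -/
def dynkinWord {V : Type*} {k : ℕ} (e : Fin k → ℕ × ℕ) (x y : V) : List V :=
  (List.ofFn fun i => List.replicate (e i).1 x ++ List.replicate (e i).2 y).flatten

theorem length_dynkinWord {V : Type*} {k : ℕ} (e : Fin k → ℕ × ℕ) (x y : V) :
    (dynkinWord e x y).length = ∑ i, ((e i).1 + (e i).2) := by
  simp [dynkinWord, List.length_flatten, List.map_ofFn, List.sum_ofFn, Function.comp_def]

theorem mem_dynkinWord {V : Type*} {k : ℕ} {e : Fin k → ℕ × ℕ} {x y a : V}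
    (h : a ∈ dynkinWord e x y) : a = x ∨ a = y := by
  simp only [dynkinWord, List.mem_flatten, List.mem_ofFn] at h
  obtain ⟨l, ⟨i, rfl⟩, hl⟩ := h
  rcases List.mem_append.1 hl with h | h
  · exact Or.inl (List.eq_of_mem_replicate h)
  · exact Or.inr (List.eq_of_mem_replicate h)

theorem map_dynkinWord {V W : Type*} {k : ℕ} (e : Fin k → ℕ × ℕ) (x y : V) (f : V → W) :
    (dynkinWord e x y).map f = dynkinWord e (f x) (f y) := by
  simp [dynkinWord, List.map_flatten, List.map_ofFn, Function.comp_def]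

/-- The pairs of exponents, not both zero, which are at most `N`. -/
def dynkinPairs (N : ℕ) : Finset (ℕ × ℕ) :=
  (Finset.range (N + 1) ×ˢ Finset.range (N + 1)).erase (0, 0)

theorem mem_dynkinPairs {N : ℕ} {a : ℕ × ℕ} :
    a ∈ dynkinPairs N ↔ 0 < a.1 + a.2 ∧ a.1 ≤ N ∧ a.2 ≤ N := by
  rcases a with ⟨r, s⟩
  simp only [dynkinPairs, Finset.mem_erase, Finset.mem_product, Finset.mem_range, ne_eq,
    Prod.mk.injEq]
  omega

/-- The tuples of `k` pairs of exponents with total `n`. -/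
def dynkinTuples (N k n : ℕ) : Finset (Fin k → ℕ × ℕ) :=
  (Fintype.piFinset fun _ => dynkinPairs N).filter fun e => ∑ i, ((e i).1 + (e i).2) = n

theorem le_sum_of_mem_piFinset {N k : ℕ} {e : Fin k → ℕ × ℕ}
    (he : e ∈ Fintype.piFinset fun _ : Fin k => dynkinPairs N) :
    k ≤ ∑ i, ((e i).1 + (e i).2) := by
  calc k = ∑ _i : Fin k, 1 := by simp
    _ ≤ _ := Finset.sum_le_sum fun i _ => (mem_dynkinPairs.1 (Fintype.mem_piFinset.1 he i)).1

variable {V : Type*} [AddCommGroup V] [Module ℝ V]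

/-- Rewrites a term with one cut-off `N` for the exponents and for `k`, as needed for comparison
with a truncated logarithm. The cut-off is harmless: `k` nonempty blocks have total at least `k`,
and no exponent exceeds the total `n`. -/
theorem bchTerm_eq_sum_dynkinTuples (br : V → V → V) (x y : V) {n N : ℕ} (hn : n ≤ N) :
    bchTerm br x y n = (n : ℝ)⁻¹ • ∑ k ∈ Finset.Icc 1 N, ((-1 : ℝ) ^ (k + 1) / (k : ℝ)) •
      ∑ e ∈ dynkinTuples N k n, (∏ i, (((e i).1 ! : ℝ) * ((e i).2 ! : ℝ)))⁻¹ •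
        nestedBracket br (dynkinWord e x y) := by
  have h1 : ∀ k ∈ Finset.Icc 1 N, k ∉ Finset.Icc 1 n → ((-1 : ℝ) ^ (k + 1) / (k : ℝ)) •
      ∑ e ∈ dynkinTuples N k n, (∏ i, (((e i).1 ! : ℝ) * ((e i).2 ! : ℝ)))⁻¹ •
        nestedBracket br (dynkinWord e x y) = 0 := by
    intro k hk hk'
    rw [Finset.sum_eq_zero, smul_zero]
    intro e he
    have h2 := le_sum_of_mem_piFinset (Finset.mem_filter.1 he).1
    rw [(Finset.mem_filter.1 he).2] at h2
    simp only [Finset.mem_Icc] at hk hk'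
    omega
  rw [← Finset.sum_subset (Finset.Icc_subset_Icc_right hn) h1, bchTerm, Finset.smul_sum]
  refine Finset.sum_congr rfl fun k hk => ?_
  rw [smul_comm]
  congr 1
  rw [Finset.smul_sum]
  refine Finset.sum_bij (fun e _ i => (((e i).1 : ℕ), ((e i).2 : ℕ))) ?_ ?_ ?_ ?_
  · intro e he
    simp only [Finset.mem_filter, Finset.mem_univ, true_and] at he
    simp only [dynkinTuples, Finset.mem_filter, Fintype.mem_piFinset, mem_dynkinPairs]
    refine ⟨fun i => ⟨he.1 i, ?_, ?_⟩, he.2⟩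
    · have := (e i).1.2; omega
    · have := (e i).2.2; omega
  · intro e _ e' _ h
    funext i
    have := congrFun h i
    simp only [Prod.mk.injEq] at this
    exact Prod.ext (Fin.ext this.1) (Fin.ext this.2)
  · intro e he
    simp only [dynkinTuples, Finset.mem_filter, Fintype.mem_piFinset, mem_dynkinPairs] at he
    have hle : ∀ i, (e i).1 + (e i).2 ≤ n := fun i => by
      rw [← he.2]
      exact Finset.single_le_sum (f := fun i => (e i).1 + (e i).2) (fun _ _ => Nat.zero_le _)
        (Finset.mem_univ i)
    refine ⟨fun i => (⟨(e i).1, by have := hle i; omega⟩, ⟨(e i).2, by have := hle i; omega⟩), ?_, rfl⟩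
    simp only [Finset.mem_filter, Finset.mem_univ, true_and]
    exact ⟨fun i => (he.1 i).1, he.2⟩
  · intro e _
    rw [mul_inv, mul_smul]
    rfl

end Dynkin

/-! ### The logarithm of a product of two exponentials -/

section DynkinExp

attribute [local instance] LieRing.ofAssociativeRing

variable {A : Type*} [Ring A] [Algebra ℝ A]

theorem prod_dynkinWord {A : Type*} [Monoid A] {k : ℕ} (e : Fin k → ℕ × ℕ) (X Y : A) :
    (dynkinWord e X Y).prod = (List.ofFn fun i => X ^ (e i).1 * Y ^ (e i).2).prod := by
  simp [dynkinWord, List.prod_flatten, List.map_ofFn, Function.comp_def]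

/-- The part of degree `n` of `log (exp X * exp Y)`. -/
noncomputable def dynkinPart (N : ℕ) (X Y : A) (n : ℕ) : A :=
  ∑ k ∈ Finset.Icc 1 N, ((-1 : ℝ) ^ (k + 1) / (k : ℝ)) •
    ∑ e ∈ dynkinTuples N k n, (∏ i, (((e i).1 ! : ℝ) * ((e i).2 ! : ℝ)))⁻¹ •
      (dynkinWord e X Y).prod

variable {X Y : A} {N : ℕ}

/-- Subtracting `1` removes the pair of exponents `(0, 0)`, which is why only nonempty blocks occur.
-/
theorem nilExp_mul_sub_one_pow
    (h : ∀ l : List A, (∀ a ∈ l, a = X ∨ a = Y) → N < l.length → l.prod = 0) (k : ℕ) :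
    (nilExp X * nilExp Y - 1) ^ k = ∑ e ∈ Fintype.piFinset fun _ : Fin k => dynkinPairs N,
      (∏ i, (((e i).1 ! : ℝ) * ((e i).2 ! : ℝ)))⁻¹ • (dynkinWord e X Y).prod := by
  have hX : X ^ (N + 1) = 0 := by
    rw [← List.prod_replicate]
    exact h _ (fun a ha => Or.inl (List.eq_of_mem_replicate ha)) (by simp)
  have hY : Y ^ (N + 1) = 0 := by
    rw [← List.prod_replicate]
    exact h _ (fun a ha => Or.inr (List.eq_of_mem_replicate ha)) (by simp)
  have h1 : nilExp X * nilExp Y - 1 =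
      ∑ a ∈ dynkinPairs N, ((a.1 ! : ℝ) * (a.2 ! : ℝ))⁻¹ • (X ^ a.1 * Y ^ a.2) := by
    rw [nilExp_eq_sum hX, nilExp_eq_sum hY, Finset.sum_mul_sum, ← Finset.sum_product',
      dynkinPairs, Finset.sum_erase_eq_sub (by simp)]
    congr 1
    · refine Finset.sum_congr rfl fun a _ => ?_
      rw [smul_mul_smul_comm, mul_inv]
    · simp
  -- The power is viewed as a multilinear map at equal arguments, so that it expands over tuples of
  -- pairs without commutativity.
  have h2 : (nilExp X * nilExp Y - 1) ^ k = MultilinearMap.mkPiAlgebraFin ℝ k A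
      (fun _ => ∑ a ∈ dynkinPairs N, ((a.1 ! : ℝ) * (a.2 ! : ℝ))⁻¹ • (X ^ a.1 * Y ^ a.2)) := by
    rw [MultilinearMap.mkPiAlgebraFin_apply, ← h1]
    simp
  rw [h2, MultilinearMap.map_sum_finset]
  refine Finset.sum_congr rfl fun e _ => ?_
  rw [MultilinearMap.map_smul_univ, MultilinearMap.mkPiAlgebraFin_apply, prod_dynkinWord,
    Finset.prod_inv_distrib]

theorem nilExp_mul_sub_one_pow_eq_zero
    (h : ∀ l : List A, (∀ a ∈ l, a = X ∨ a = Y) → N < l.length → l.prod = 0) :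
    (nilExp X * nilExp Y - 1) ^ (N + 1) = 0 := by
  rw [nilExp_mul_sub_one_pow h]
  refine Finset.sum_eq_zero fun e he => ?_
  rw [h _ (fun a ha => mem_dynkinWord ha), smul_zero]
  rw [length_dynkinWord]
  exact le_sum_of_mem_piFinset he

/-- The expanded powers are regrouped by the total length of the words; words longer than `N` vanish
by hypothesis. -/
theorem nilLog_nilExp_mul
    (h : ∀ l : List A, (∀ a ∈ l, a = X ∨ a = Y) → N < l.length → l.prod = 0) :
    nilLog N (nilExp X * nilExp Y - 1) = ∑ n ∈ Finset.Icc 1 N, dynkinPart N X Y n := by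
  simp only [dynkinPart, nilLog]
  rw [Finset.sum_comm]
  refine Finset.sum_congr rfl fun k hk => ?_
  rw [← Finset.smul_sum, nilExp_mul_sub_one_pow h]
  congr 1
  rw [← Finset.sum_filter_of_ne (p := fun e => ∑ i, ((e i).1 + (e i).2) ∈ Finset.Icc 1 N),
    ← Finset.sum_fiberwise_of_maps_to (g := fun e : Fin k → ℕ × ℕ => ∑ i, ((e i).1 + (e i).2))
      (t := Finset.Icc 1 N) (fun e he => (Finset.mem_filter.1 he).2)]
  · refine Finset.sum_congr rfl fun n hn => Finset.sum_congr ?_ fun _ _ => rfl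
    ext e
    simp only [dynkinTuples, Finset.mem_filter]
    constructor
    · rintro ⟨⟨h1, -⟩, h2⟩; exact ⟨h1, h2⟩
    · rintro ⟨h1, h2⟩; exact ⟨⟨h1, h2 ▸ hn⟩, h2⟩
  · intro e he hne
    have h1 := le_sum_of_mem_piFinset he
    rw [Finset.mem_Icc] at hk ⊢
    refine ⟨by omega, ?_⟩
    by_contra hlt
    refine hne ?_
    rw [h _ (fun a ha => mem_dynkinWord ha), smul_zero]
    rw [length_dynkinWord]
    omega

/-- `⁅D, ·⁆` is a derivation of the associative product, so it counts the letters of a word. -/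
theorem lie_prod_of_lie_eq {D : A} {l : List A} (hl : ∀ a ∈ l, ⁅D, a⁆ = a) :
    ⁅D, l.prod⁆ = (l.length : ℝ) • l.prod := by
  induction l with
  | nil => simp [Ring.lie_def]
  | cons a l ih =>
    have h1 := hl a (by simp)
    have h2 := ih fun b hb => hl b (by simp [hb])
    rw [Ring.lie_def] at h1 h2 ⊢
    simp only [List.prod_cons, List.length_cons, Nat.cast_add, Nat.cast_one, add_smul, one_smul]
    rw [← mul_smul_comm, ← h2]
    have h3 : D * (a * l.prod) - a * l.prod * D =
        a * (D * l.prod - l.prod * D) + (D * a - a * D) * l.prod := by noncomm_ring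
    rw [h3, h1]

theorem lie_dynkinPart {D : A} (hX : ⁅D, X⁆ = X) (hY : ⁅D, Y⁆ = Y) (n : ℕ) :
    ⁅D, dynkinPart N X Y n⁆ = (n : ℝ) • dynkinPart N X Y n := by
  simp only [dynkinPart, lie_sum, Finset.smul_sum, lie_smul]
  refine Finset.sum_congr rfl fun k _ => Finset.sum_congr rfl fun e he => ?_
  rw [lie_prod_of_lie_eq, length_dynkinWord, (Finset.mem_filter.1 he).2]
  · simp only [smul_comm (n : ℝ)]
  · intro a ha
    rcases mem_dynkinWord ha with rfl | rfl <;> assumption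

end DynkinExp

/-! ### The adjoint Baker-Campbell-Hausdorff identity with an Euler element -/

section BCH

attribute [local instance] LieRing.ofAssociativeRing

variable {𝔤 : Type*} [LieRing 𝔤] [LieAlgebra ℝ 𝔤]

/-- All words in `ad x` and `ad y` of length more than `N` vanish. -/
def JointlyAdNilpotent (N : ℕ) (x y : 𝔤) : Prop :=
  ∀ l : List 𝔤, (∀ a ∈ l, a = x ∨ a = y) → N < l.length →
    ∀ g : 𝔤, l.foldr (fun a b => ⁅a, b⁆) g = 0

theorem prod_map_ad (l : List 𝔤) (g : 𝔤) :
    (l.map (LieAlgebra.ad ℝ 𝔤)).prod g = l.foldr (fun a b => ⁅a, b⁆) g := by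
  induction l with
  | nil => rfl
  | cons a l ih => simp [ih]

theorem JointlyAdNilpotent.prod_eq_zero {N : ℕ} {x y : 𝔤} (h : JointlyAdNilpotent N x y)
    (l : List (Module.End ℝ 𝔤))
    (hl : ∀ a ∈ l, a = LieAlgebra.ad ℝ 𝔤 x ∨ a = LieAlgebra.ad ℝ 𝔤 y) (hN : N < l.length) :
    l.prod = 0 := by
  have h1 : ∃ l' : List 𝔤, l'.map (LieAlgebra.ad ℝ 𝔤) = l ∧ ∀ a ∈ l', a = x ∨ a = y := by
    clear hN
    induction l with
    | nil => exact ⟨[], rfl, by simp⟩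
    | cons a l ih =>
      obtain ⟨l', rfl, hl'⟩ := ih fun b hb => hl b (by simp [hb])
      rcases hl a (by simp) with rfl | rfl
      · exact ⟨x :: l', rfl, by simpa using hl'⟩
      · exact ⟨y :: l', rfl, by simpa using hl'⟩
  obtain ⟨l', rfl, hl'⟩ := h1
  ext g
  rw [prod_map_ad, h l' hl' (by simpa using hN)]
  rfl

theorem JointlyAdNilpotent.isNilpotent_left {N : ℕ} {x y : 𝔤} (h : JointlyAdNilpotent N x y) :
    IsNilpotent (LieAlgebra.ad ℝ 𝔤 x) := by
  refine ⟨N + 1, ?_⟩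
  rw [← List.prod_replicate]
  exact h.prod_eq_zero _ (fun a ha => Or.inl (List.eq_of_mem_replicate ha)) (by simp)

theorem JointlyAdNilpotent.isNilpotent_right {N : ℕ} {x y : 𝔤} (h : JointlyAdNilpotent N x y) :
    IsNilpotent (LieAlgebra.ad ℝ 𝔤 y) := by
  refine ⟨N + 1, ?_⟩
  rw [← List.prod_replicate]
  exact h.prod_eq_zero _ (fun a ha => Or.inr (List.eq_of_mem_replicate ha)) (by simp)

/-- The last letter acts on `E` by `⁅a, E⁆ = -a`; the remaining letters then bracket into it one
after the other. This is the bridge from associative words to Dynkin's nested brackets. -/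
theorem prod_map_ad_euler {E : 𝔤} : ∀ {l : List 𝔤}, l ≠ [] → (∀ a ∈ l, ⁅E, a⁆ = a) →
    (l.map (LieAlgebra.ad ℝ 𝔤)).prod E = -nestedBracket (fun a b => ⁅a, b⁆) l
  | [], h, _ => absurd rfl h
  | [a], _, h => by
    simp only [List.map_cons, List.map_nil, List.prod_singleton, LieAlgebra.ad_apply, nestedBracket]
    rw [← lie_skew, h a (by simp)]
  | a :: b :: l, _, h => by
    rw [List.map_cons, List.prod_cons, Module.End.mul_apply,
      prod_map_ad_euler (by simp) fun c hc => h c (List.mem_cons_of_mem a hc),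
      LieAlgebra.ad_apply, lie_neg]
    rfl

theorem lie_nestedBracket_euler {E : 𝔤} : ∀ {l : List 𝔤}, (∀ a ∈ l, ⁅E, a⁆ = a) →
    ⁅E, nestedBracket (fun a b => ⁅a, b⁆) l⁆ = (l.length : ℝ) • nestedBracket (fun a b => ⁅a, b⁆) l
  | [], _ => by simp [nestedBracket]
  | [a], h => by simp [nestedBracket, h a (by simp)]
  | a :: b :: l, h => by
    have ih := lie_nestedBracket_euler fun c hc => h c (List.mem_cons_of_mem a hc)
    have : nestedBracket (fun a b : 𝔤 => ⁅a, b⁆) (a :: b :: l) =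
      ⁅a, nestedBracket (fun a b => ⁅a, b⁆) (b :: l)⁆ := rfl
    rw [this, leibniz_lie, ih, h a (by simp), lie_smul, List.length_cons (as := b :: l)]
    push_cast
    rw [add_smul, one_smul, add_comm]

/-- The Baker-Campbell-Hausdorff theorem in the adjoint representation, for elements of degree one
with respect to an Euler element. -/
theorem nilExp_ad_mul_of_euler {E x y : 𝔤} (hx : ⁅E, x⁆ = x) (hy : ⁅E, y⁆ = y) {N : ℕ}
    (h : JointlyAdNilpotent N x y) :
    (∀ n, N < n → bchTerm (fun a b : 𝔤 => ⁅a, b⁆) x y n = 0) ∧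
    IsNilpotent (LieAlgebra.ad ℝ 𝔤 (bch (fun a b => ⁅a, b⁆) x y)) ∧
    nilExp (LieAlgebra.ad ℝ 𝔤 x) * nilExp (LieAlgebra.ad ℝ 𝔤 y) =
      nilExp (LieAlgebra.ad ℝ 𝔤 (bch (fun a b => ⁅a, b⁆) x y)) := by
  set br : 𝔤 → 𝔤 → 𝔤 := fun a b => ⁅a, b⁆ with hbr
  set X := LieAlgebra.ad ℝ 𝔤 x with hX
  set Y := LieAlgebra.ad ℝ 𝔤 y with hY
  set D := LieAlgebra.ad ℝ 𝔤 E with hD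
  have hE : ∀ l : List 𝔤, (∀ a ∈ l, a = x ∨ a = y) → ∀ a ∈ l, ⁅E, a⁆ = a := by
    intro l hl a ha
    rcases hl a ha with rfl | rfl <;> assumption
  -- Evaluation at `E` of the degree `n` part of the logarithm. The factor `n` is the one by which
  -- Dynkin's formula divides.
  have hpart : ∀ n, 0 < n → ∀ M, n ≤ M →
      dynkinPart M X Y n E = -((n : ℝ) • bchTerm br x y n) := by
    intro n hn M hM
    rw [bchTerm_eq_sum_dynkinTuples br x y hM, smul_smul, mul_inv_cancel₀ (by positivity), one_smul]
    simp only [dynkinPart, LinearMap.sum_apply, LinearMap.smul_apply, ← Finset.sum_neg_distrib,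
      ← smul_neg]
    refine Finset.sum_congr rfl fun k _ => congrArg _ (Finset.sum_congr rfl fun e he => ?_)
    rw [hX, hY, ← map_dynkinWord, prod_map_ad_euler]
    · rintro h0
      have h1 := length_dynkinWord e x y
      rw [h0, (Finset.mem_filter.1 he).2] at h1
      simp at h1; omega
    · exact hE _ fun a ha => mem_dynkinWord ha
  have hbch : ∀ n, ⁅E, bchTerm br x y n⁆ = (n : ℝ) • bchTerm br x y n := by
    intro n
    rw [bchTerm_eq_sum_dynkinTuples br x y le_rfl]
    simp only [lie_sum, Finset.smul_sum, lie_smul]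
    refine Finset.sum_congr rfl fun k _ => Finset.sum_congr rfl fun e he => ?_
    rw [lie_nestedBracket_euler, length_dynkinWord, (Finset.mem_filter.1 he).2]
    · simp only [smul_comm (n : ℝ), hbr]
    · exact hE _ fun a ha => mem_dynkinWord ha
  -- For such `n` every word in the part of degree `n` vanishes as an operator, in particular at
  -- `E`.
  have hterm : ∀ n, N < n → bchTerm br x y n = 0 := by
    intro n hn
    have h1 := hpart n (by omega) n le_rfl
    have h2 : dynkinPart n X Y n = 0 := by
      refine Finset.sum_eq_zero fun k _ => ?_
      rw [Finset.sum_eq_zero, smul_zero]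
      intro e he
      rw [h.prod_eq_zero _ (fun a ha => mem_dynkinWord ha), smul_zero]
      rw [length_dynkinWord, (Finset.mem_filter.1 he).2]
      exact hn
    rw [h2, LinearMap.zero_apply, eq_comm, neg_eq_zero, smul_eq_zero] at h1
    exact h1.resolve_left (by norm_cast; omega)
  have hsum : bch br x y = ∑ n ∈ Finset.Icc 1 N, bchTerm br x y n := by
    refine finsum_eq_finsetSum_of_support_subset _ fun n hn => ?_
    rw [Finset.coe_Icc, Set.mem_Icc]
    by_contra hlt
    refine hn ?_
    rcases Nat.eq_zero_or_pos n with rfl | hpos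
    · simp [bchTerm]
    · exact hterm n (by omega)
  set Z := nilLog N (nilExp X * nilExp Y - 1) with hZ
  have hM0 := nilExp_mul_sub_one_pow_eq_zero h.prod_eq_zero
  have hZnil : IsNilpotent Z := isNilpotent_nilLog N ⟨_, hM0⟩
  have hZexp : nilExp Z = nilExp X * nilExp Y := by rw [hZ, nilExp_nilLog hM0]; abel
  -- `exp Z` is a product of two automorphisms, so its logarithm is a derivation.
  have hZlie : ∀ a b, Z ⁅a, b⁆ = ⁅Z a, b⁆ + ⁅a, Z b⁆ := by
    refine lie_of_nilExp_lie hZnil fun a b => ?_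
    rw [hZexp]
    simp only [Module.End.mul_apply]
    rw [hY, nilExp_ad_lie h.isNilpotent_right, hX, nilExp_ad_lie h.isNilpotent_left]
  have hZsum : Z = ∑ n ∈ Finset.Icc 1 N, dynkinPart N X Y n := nilLog_nilExp_mul h.prod_eq_zero
  set W : ℕ → Module.End ℝ 𝔤 := fun n => dynkinPart N X Y n - LieAlgebra.ad ℝ 𝔤 (bchTerm br x y n)
    with hW
  have hWsum : ∑ n ∈ Finset.Icc 1 N, W n = Z - LieAlgebra.ad ℝ 𝔤 (bch br x y) := by
    rw [hW, Finset.sum_sub_distrib, ← hZsum, hsum, map_sum]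
  have hWE : (Z - LieAlgebra.ad ℝ 𝔤 (bch br x y)) E = 0 := by
    rw [← hWsum, LinearMap.sum_apply]
    refine Finset.sum_eq_zero fun n hn => ?_
    rw [hW, LinearMap.sub_apply, hpart n (Finset.mem_Icc.1 hn).1 N (Finset.mem_Icc.1 hn).2,
      LieAlgebra.ad_apply, ← lie_skew, hbch, sub_self]
  -- A derivation that kills `E` commutes with `ad E`.
  have hWD : ⁅D, Z - LieAlgebra.ad ℝ 𝔤 (bch br x y)⁆ = 0 := by
    rw [LinearMap.sub_apply, sub_eq_zero] at hWE
    ext g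
    simp only [Ring.lie_def, LinearMap.sub_apply, Module.End.mul_apply, hD, LieAlgebra.ad_apply,
      lie_sub, hZlie, hWE, LinearMap.zero_apply]
    rw [leibniz_lie (bch br x y) E g]
    abel
  have hlie : ∀ n, ⁅D, W n⁆ = (n : ℝ) • W n := by
    intro n
    have h1 : ⁅D, X⁆ = X := by rw [hD, hX, ← LieHom.map_lie, hx]
    have h2 : ⁅D, Y⁆ = Y := by rw [hD, hY, ← LieHom.map_lie, hy]
    rw [hW]
    simp only [lie_sub, lie_dynkinPart h1 h2, smul_sub]
    rw [hD, ← LieHom.map_lie, hbch, map_smul]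
  -- `W n` has weight `n` under `⁅D, ·⁆`, so the vanishing of `⁅D, ∑ W n⁆` says that the
  -- eigenvectors `n • W n` sum to zero. All weights here are at least one, so no `W n` survives.
  have hzero : ∀ n ∈ Finset.Icc 1 N, (n : ℝ) • W n = 0 := by
    refine eq_zero_of_sum_eigenvectors
      (LieAlgebra.ad ℝ (Module.End ℝ 𝔤) D) _ (fun n => (n : ℝ) • W n) (fun n _ => ?_) ?_
    · rw [map_smul, LieAlgebra.ad_apply, hlie]
    · rw [← hWD, ← hWsum, lie_sum]
      exact Finset.sum_congr rfl fun n _ => (hlie n).symm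
  have hZad : Z = LieAlgebra.ad ℝ 𝔤 (bch br x y) := by
    rw [← sub_eq_zero, ← hWsum]
    refine Finset.sum_eq_zero fun n hn => ?_
    exact (smul_eq_zero.1 (hzero n hn)).resolve_left (by
      have := (Finset.mem_Icc.1 hn).1
      norm_cast; omega)
  exact ⟨hterm, hZad ▸ hZnil, by rw [← hZad, hZexp]⟩

end BCH

/-! ### Nilpotency after tensoring -/

section TensorNilpotent

variable {V : Type*} [AddCommGroup V] [Module ℝ V]

/-- The vectors which are killed by all `j` nested brackets. -/
def foldrKernel (br : V →ₗ[ℝ] V →ₗ[ℝ] V) (j : ℕ) : Submodule ℝ V where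
  carrier := {z | ∀ l : List V, l.length = j → l.foldr (fun x w => br x w) z = 0}
  zero_mem' := by
    intro l _
    induction l generalizing j with
    | nil => rfl
    | cons a l ih => rw [List.foldr_cons, ih l.length rfl, map_zero]
  add_mem' := by
    intro a b ha hb l hl
    have h : ∀ l : List V, l.foldr (fun x w => br x w) (a + b) =
        l.foldr (fun x w => br x w) a + l.foldr (fun x w => br x w) b := by
      intro l
      induction l with
      | nil => rfl
      | cons c l ih => simp [ih]
    rw [h, ha l hl, hb l hl, add_zero]
  smul_mem' := by
    intro c a ha l hl
    have h : ∀ l : List V, l.foldr (fun x w => br x w) (c • a) =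
        c • l.foldr (fun x w => br x w) a := by
      intro l
      induction l with
      | nil => rfl
      | cons c l ih => simp [ih]
    rw [h, ha l hl, smul_zero]

/-- A nested bracket of sums of pure tensors cannot be expanded letter by letter without
bookkeeping; the filtration `T j = A ⊗ foldrKernel br j` replaces this. It is everything at `j = k`,
zero at `j = 0`, and bracketing with any element lowers `j` by one. -/
theorem foldr_tensor_eq_zero {A : Type*} [AddCommGroup A] [Module ℝ A]
    (br : V →ₗ[ℝ] V →ₗ[ℝ] V) (β : A ⊗[ℝ] V →ₗ[ℝ] A ⊗[ℝ] V →ₗ[ℝ] A ⊗[ℝ] V) (m : A → A → A)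
    (hβ : ∀ a b v w, β (a ⊗ₜ v) (b ⊗ₜ w) = m a b ⊗ₜ br v w) {k : ℕ}
    (h : ∀ l : List V, l.length = k → ∀ y : V, l.foldr (fun x z => br x z) y = 0)
    (l : List (A ⊗[ℝ] V)) (hl : l.length = k) (y : A ⊗[ℝ] V) :
    l.foldr (fun x z => β x z) y = 0 := by
  set T : ℕ → Submodule ℝ (A ⊗[ℝ] V) := fun j =>
    Submodule.span ℝ {x | ∃ a : A, ∃ v ∈ foldrKernel br j, x = a ⊗ₜ v} with hT
  have h0 : ∀ x ∈ T 0, x = 0 := by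
    intro x hx
    refine (Submodule.mem_bot ℝ).1 (Submodule.span_le.2 ?_ hx)
    rintro _ ⟨a, v, hv, rfl⟩
    have : v = 0 := hv [] rfl
    simp [this]
  have hk : ∀ x, x ∈ T k := by
    intro x
    induction x with
    | zero => exact zero_mem _
    | tmul a v => exact Submodule.subset_span ⟨a, v, fun l hl => h l hl v, rfl⟩
    | add x y hx hy => exact add_mem hx hy
  have hstep : ∀ j x y, y ∈ T (j + 1) → β x y ∈ T j := by
    intro j x y hy
    induction hy using Submodule.span_induction with
    | mem y hy =>
      obtain ⟨b, w, hw, rfl⟩ := hy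
      induction x with
      | zero => simp
      | tmul a v =>
        rw [hβ]
        refine Submodule.subset_span ⟨_, _, fun l hl => ?_, rfl⟩
        have := hw (l ++ [v]) (by simp [hl])
        simpa using this
      | add x y hx hy => rw [map_add, LinearMap.add_apply]; exact add_mem hx hy
    | zero => simp
    | add y z _ _ hy hz => rw [map_add]; exact add_mem hy hz
    | smul c y _ hy => rw [map_smul]; exact Submodule.smul_mem _ c hy
  have key : ∀ j, ∀ l : List (A ⊗[ℝ] V), l.length + j = k →
      l.foldr (fun x z => β x z) y ∈ T j := by
    intro j l
    induction l generalizing j with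
    | nil =>
      intro h
      rw [List.foldr_nil, show j = k by simpa using h]
      exact hk y
    | cons a l ih =>
      intro h
      exact hstep _ _ _ (ih (j + 1) (by simp at h; omega))
  exact h0 _ (key 0 l (by simpa using hl))

end TensorNilpotent

/-! ### Naturality of the series -/

section BCHMap

theorem map_nestedBracket {V W : Type*} [AddCommGroup V] [AddCommGroup W]
    {br : V → V → V} {br' : W → W → W} (f : V →+ W)
    (hf : ∀ a b, f (br a b) = br' (f a) (f b)) :
    ∀ l : List V, f (nestedBracket br l) = nestedBracket br' (l.map f)
  | [] => map_zero f
  | [_] => rfl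
  | x :: y :: l => by
    have ih := map_nestedBracket f hf (y :: l)
    change f (br x (nestedBracket br (y :: l))) = br' (f x) (nestedBracket br' ((y :: l).map f))
    rw [hf, ih]

variable {V W : Type*} [AddCommGroup V] [Module ℝ V] [AddCommGroup W] [Module ℝ W]

theorem map_bchTerm {br : V → V → V} {br' : W → W → W} (f : V →ₗ[ℝ] W)
    (hf : ∀ a b, f (br a b) = br' (f a) (f b)) (x y : V) (n : ℕ) :
    f (bchTerm br x y n) = bchTerm br' (f x) (f y) n := by
  simp only [bchTerm_eq_sum_dynkinTuples _ _ _ le_rfl, map_smul, map_sum]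
  simp only [← map_dynkinWord]
  congr! 7 with k _ e _
  exact map_nestedBracket f.toAddMonoidHom hf _

/-- Vanishing of the high terms is needed in the source only, since `f` carries it to the images; so
both infinite sums are finite. -/
theorem map_bch {br : V → V → V} {br' : W → W → W} (f : V →ₗ[ℝ] W)
    (hf : ∀ a b, f (br a b) = br' (f a) (f b)) {x y : V} {N : ℕ}
    (h : ∀ n, N < n → bchTerm br x y n = 0) : f (bch br x y) = bch br' (f x) (f y) := by
  have hs : (Function.support fun n => bchTerm br x y n) ⊆ (Finset.range (N + 1) : Finset ℕ) := by
    intro n hn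
    by_contra hlt
    exact hn (h n (by simpa using hlt))
  have hs' : (Function.support fun n => bchTerm br' (f x) (f y) n) ⊆
      (Finset.range (N + 1) : Finset ℕ) := by
    intro n hn
    by_contra hlt
    refine hn ?_
    simp only [← map_bchTerm f hf, h n (by simpa using hlt), map_zero]
  rw [bch, bch, finsum_eq_finsetSum_of_support_subset _ hs,
    finsum_eq_finsetSum_of_support_subset _ hs', map_sum]
  exact Finset.sum_congr rfl fun n _ => map_bchTerm f hf x y n

end BCHMap

/-! ### Adjoining an Euler element to the polynomial Lie algebra -/

section Euler

open Polynomial LieAlgebra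

attribute [local instance] LieRing.ofAssociativeRing

variable (𝔤 : Type*) [LieRing 𝔤] [LieAlgebra ℝ 𝔤]

/-- The derivation `X d/dX` of `𝔤[X]`. -/
noncomputable def eulerDerivation : LieDerivation ℝ (ℝ[X] ⊗[ℝ] 𝔤) (ℝ[X] ⊗[ℝ] 𝔤) where
  toLinearMap := LinearMap.rTensor 𝔤 (LinearMap.mulLeft ℝ (X : ℝ[X]) ∘ₗ Polynomial.derivative)
  leibniz' a b := by
    induction a with
    | zero => simp
    | add a a' h h' => rw [add_lie, map_add, h, h', map_add, add_lie, lie_add]; abel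
    | tmul p x =>
      induction b with
      | zero => simp
      | add b b' h h' => rw [lie_add, map_add, h, h', map_add, add_lie, lie_add]; abel
      | tmul r y =>
        simp only [ExtendScalars.bracket_tmul, LinearMap.rTensor_tmul, LinearMap.comp_apply,
          LinearMap.mulLeft_apply, derivative_mul]
        rw [← lie_skew x y]
        simp only [TensorProduct.tmul_neg]
        rw [← neg_add', neg_inj, ← TensorProduct.add_tmul]
        congr 1
        ring

/-- The action of `ℝ` on `𝔤[X]` by multiples of `X d/dX`. -/
noncomputable def eulerAction : ℝ →ₗ⁅ℝ⁆ LieDerivation ℝ (ℝ[X] ⊗[ℝ] 𝔤) (ℝ[X] ⊗[ℝ] 𝔤) where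
  toLinearMap := LinearMap.toSpanSingleton ℝ _ (eulerDerivation 𝔤)
  map_lie' := by
    intro s t
    simp [Ring.lie_def, mul_comm]

/-- The Lie algebra `𝔤[X] ⋊ ℝ E` with `E = X d/dX`. -/
abbrev EulerExt : Type _ := (ℝ[X] ⊗[ℝ] 𝔤) ⋊⁅eulerAction 𝔤⁆ ℝ

/-- The Euler element. -/
noncomputable def eulerElement : EulerExt 𝔤 := ⟨0, 1⟩

variable {𝔤}

theorem eulerElement_lie_inl (k : ℝ[X] ⊗[ℝ] 𝔤) :
    ⁅eulerElement 𝔤, SemiDirectSum.inl (eulerAction 𝔤) k⁆ =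
      SemiDirectSum.inl (eulerAction 𝔤) (eulerDerivation 𝔤 k) := by
  have h : eulerAction 𝔤 1 = eulerDerivation 𝔤 := one_smul ℝ _
  simp [eulerElement, h]

theorem eulerDerivation_tmul (p : ℝ[X]) (x : 𝔤) :
    eulerDerivation 𝔤 (p ⊗ₜ x) = (X * derivative p) ⊗ₜ x := rfl

theorem eulerElement_lie_X (x : 𝔤) :
    ⁅eulerElement 𝔤, SemiDirectSum.inl (eulerAction 𝔤) ((X : ℝ[X]) ⊗ₜ x)⁆ =
      SemiDirectSum.inl (eulerAction 𝔤) ((X : ℝ[X]) ⊗ₜ x) := by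
  rw [eulerElement_lie_inl, eulerDerivation_tmul, derivative_X, mul_one]

/-- `𝔤[X]` is an ideal: after one bracket with its elements every vector of the extension lies in
it. -/
theorem lie_inl_eq (k : ℝ[X] ⊗[ℝ] 𝔤) (g : EulerExt 𝔤) :
    ∃ k', ⁅SemiDirectSum.inl (eulerAction 𝔤) k, g⁆ = SemiDirectSum.inl (eulerAction 𝔤) k' :=
  ⟨⁅k, g.left⁆ - eulerAction 𝔤 g.right k, by simp⟩

theorem foldr_inl (l : List (ℝ[X] ⊗[ℝ] 𝔤)) (k : ℝ[X] ⊗[ℝ] 𝔤) :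
    (l.map (SemiDirectSum.inl (eulerAction 𝔤))).foldr (fun a b => ⁅a, b⁆)
      (SemiDirectSum.inl (eulerAction 𝔤) k) =
    SemiDirectSum.inl (eulerAction 𝔤) (l.foldr (fun a b => ⁅a, b⁆) k) := by
  induction l with
  | nil => rfl
  | cons a l ih => rw [List.map_cons, List.foldr_cons, ih, List.foldr_cons, LieHom.map_lie]

theorem foldr_map_inl_eq_zero {l : List (ℝ[X] ⊗[ℝ] 𝔤)} {a : ℝ[X] ⊗[ℝ] 𝔤}
    (h : ∀ k : ℝ[X] ⊗[ℝ] 𝔤, l.foldr (fun a b => ⁅a, b⁆) k = 0) (g : EulerExt 𝔤) :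
    ((l ++ [a]).map (SemiDirectSum.inl (eulerAction 𝔤))).foldr (fun a b => ⁅a, b⁆) g = 0 := by
  obtain ⟨k', hk'⟩ := lie_inl_eq a g
  rw [List.map_append, List.foldr_append]
  change (l.map _).foldr _ ⁅SemiDirectSum.inl (eulerAction 𝔤) a, g⁆ = 0
  rw [hk', foldr_inl, h, map_zero]

/-- The extra letter in `N + 1` is the rightmost one, which acts first and brings an arbitrary
vector of the extension into `𝔤[X]`; there the remaining letters act through `𝔤`. -/
theorem JointlyAdNilpotent.inl {N : ℕ} {x y : 𝔤} (h : JointlyAdNilpotent N x y) :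
    JointlyAdNilpotent (N + 1) (SemiDirectSum.inl (eulerAction 𝔤) ((X : ℝ[X]) ⊗ₜ x))
      (SemiDirectSum.inl (eulerAction 𝔤) ((X : ℝ[X]) ⊗ₜ y)) := by
  intro l hl hN g
  have h1 : ∃ l' : List 𝔤, l'.map (fun v => SemiDirectSum.inl (eulerAction 𝔤) ((X : ℝ[X]) ⊗ₜ v)) = l ∧
      ∀ a ∈ l', a = x ∨ a = y := by
    clear hN
    induction l with
    | nil => exact ⟨[], rfl, by simp⟩
    | cons a l ih =>
      obtain ⟨l', rfl, hl'⟩ := ih fun b hb => hl b (by simp [hb])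
      rcases hl a (by simp) with rfl | rfl
      · exact ⟨x :: l', rfl, by simpa using hl'⟩
      · exact ⟨y :: l', rfl, by simpa using hl'⟩
  obtain ⟨l', rfl, hl'⟩ := h1
  rw [List.length_map] at hN
  obtain ⟨l', a, rfl⟩ : ∃ l₀ a, l' = l₀ ++ [a] :=
    ⟨l'.dropLast, l'.getLast (by rintro rfl; simp at hN), (List.dropLast_append_getLast _).symm⟩
  have h2 := foldr_map_inl_eq_zero (l := l'.map fun v => (X : ℝ[X]) ⊗ₜ[ℝ] v) (a := X ⊗ₜ a)
    (fun k => ?_) g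
  · simpa [Function.comp_def] using h2
  · have h3 : ∀ l : List 𝔤, ∀ (p : ℝ[X]) (v : 𝔤),
        (l.map fun v => (X : ℝ[X]) ⊗ₜ[ℝ] v).foldr (fun a b => ⁅a, b⁆) (p ⊗ₜ v) =
          (X ^ l.length * p) ⊗ₜ[ℝ] l.foldr (fun a b => ⁅a, b⁆) v := by
      intro l p v
      induction l with
      | nil => simp
      | cons b l ih =>
        simp only [List.map_cons, List.foldr_cons, List.length_cons, ih,
          ExtendScalars.bracket_tmul, pow_succ']
        rw [mul_assoc]
    rw [← prod_map_ad]
    induction k with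
    | zero => simp
    | add k k' hk hk' => rw [map_add, hk, hk', add_zero]
    | tmul p v =>
      rw [prod_map_ad, h3, h l' (fun a ha => hl' a (by simp [ha])) (by simpa using hN) v,
        TensorProduct.tmul_zero]

/-- The evaluation `𝔤[X] → 𝔤` at a point. -/
noncomputable def evalLie (t : ℝ) : ℝ[X] ⊗[ℝ] 𝔤 →ₗ[ℝ] 𝔤 :=
  (TensorProduct.lid ℝ 𝔤).toLinearMap ∘ₗ LinearMap.rTensor 𝔤 (Polynomial.aeval t).toLinearMap

theorem evalLie_tmul (t : ℝ) (p : ℝ[X]) (x : 𝔤) : evalLie t (p ⊗ₜ x) = p.eval t • x := by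
  simp [evalLie, Polynomial.aeval_def, Polynomial.eval₂_eq_eval_map]

theorem evalLie_lie (t : ℝ) (a b : ℝ[X] ⊗[ℝ] 𝔤) :
    evalLie t ⁅a, b⁆ = ⁅evalLie t a, evalLie t b⁆ := by
  have h1 : ∀ a b c : ℝ[X] ⊗[ℝ] 𝔤, ⁅a + b, c⁆ = ⁅a, c⁆ + ⁅b, c⁆ :=
    add_lie (L := ℝ[X] ⊗[ℝ] 𝔤) (M := ℝ[X] ⊗[ℝ] 𝔤)
  have h2 : ∀ a b c : ℝ[X] ⊗[ℝ] 𝔤, ⁅a, b + c⁆ = ⁅a, b⁆ + ⁅a, c⁆ :=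
    lie_add (L := ℝ[X] ⊗[ℝ] 𝔤) (M := ℝ[X] ⊗[ℝ] 𝔤)
  have h3 : ∀ a : ℝ[X] ⊗[ℝ] 𝔤, ⁅(0 : ℝ[X] ⊗[ℝ] 𝔤), a⁆ = 0 :=
    zero_lie (L := ℝ[X] ⊗[ℝ] 𝔤) (M := ℝ[X] ⊗[ℝ] 𝔤)
  have h4 : ∀ a : ℝ[X] ⊗[ℝ] 𝔤, ⁅a, (0 : ℝ[X] ⊗[ℝ] 𝔤)⁆ = 0 :=
    lie_zero (L := ℝ[X] ⊗[ℝ] 𝔤) (M := ℝ[X] ⊗[ℝ] 𝔤)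
  induction a with
  | zero => rw [h3, map_zero, zero_lie]
  | add a a' h h' => rw [h1, map_add, h, h', map_add, add_lie]
  | tmul p x =>
    induction b with
    | zero => rw [h4, map_zero, lie_zero]
    | add b b' h h' => rw [h2, map_add, h, h', map_add, lie_add]
    | tmul r y =>
      simp only [ExtendScalars.bracket_tmul, evalLie_tmul, eval_mul, smul_lie, lie_smul, mul_smul]
      rw [smul_comm]

/-- The Baker-Campbell-Hausdorff theorem in the adjoint representation. -/
theorem nilExp_ad_mul {x y : 𝔤} {N : ℕ} (h : JointlyAdNilpotent N x y) :
    (∀ n, N + 1 < n → bchTerm (fun a b : 𝔤 => ⁅a, b⁆) x y n = 0) ∧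
    IsNilpotent (LieAlgebra.ad ℝ 𝔤 (bch (fun a b => ⁅a, b⁆) x y)) ∧
    nilExp (LieAlgebra.ad ℝ 𝔤 x) * nilExp (LieAlgebra.ad ℝ 𝔤 y) =
      nilExp (LieAlgebra.ad ℝ 𝔤 (bch (fun a b => ⁅a, b⁆) x y)) := by
  set ι : ℝ[X] ⊗[ℝ] 𝔤 →ₗ⁅ℝ⁆ EulerExt 𝔤 := SemiDirectSum.inl (eulerAction 𝔤) with hι
  have hιinj : Function.Injective ι := SemiDirectSum.inl_injective _
  -- The elements `X ⊗ x` and `X ⊗ y` have degree one, so the identity holds in the extension. It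
  -- descends to `𝔤[X]` along the injection `ι`, and from there to `𝔤` along the surjective
  -- evaluation at `X = 1`.
  obtain ⟨h1, h2, h3⟩ := nilExp_ad_mul_of_euler (eulerElement_lie_X x) (eulerElement_lie_X y) h.inl
  have hterm : ∀ n, N + 1 < n →
      bchTerm (fun a b : ℝ[X] ⊗[ℝ] 𝔤 => ⁅a, b⁆) ((X : ℝ[X]) ⊗ₜ x) ((X : ℝ[X]) ⊗ₜ y) n = 0 := by
    intro n hn
    refine hιinj ?_
    have := map_bchTerm (br' := fun a b => ⁅a, b⁆) (ι : ℝ[X] ⊗[ℝ] 𝔤 →ₗ[ℝ] EulerExt 𝔤)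
      (fun a b => LieHom.map_lie ι a b) ((X : ℝ[X]) ⊗ₜ x) ((X : ℝ[X]) ⊗ₜ y) n
    rw [map_zero]
    exact this.trans (h1 n hn)
  set z := bch (fun a b : ℝ[X] ⊗[ℝ] 𝔤 => ⁅a, b⁆) ((X : ℝ[X]) ⊗ₜ x) ((X : ℝ[X]) ⊗ₜ y) with hz
  have hιz : bch (fun a b : EulerExt 𝔤 => ⁅a, b⁆) (ι ((X : ℝ[X]) ⊗ₜ x)) (ι ((X : ℝ[X]) ⊗ₜ y)) = ι z :=
    (map_bch (br' := fun a b => ⁅a, b⁆) (ι : ℝ[X] ⊗[ℝ] 𝔤 →ₗ[ℝ] EulerExt 𝔤)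
      (fun a b => LieHom.map_lie ι a b) hterm).symm
  have hev : ∀ v : 𝔤, evalLie 1 ((X : ℝ[X]) ⊗ₜ[ℝ] v) = v := fun v => by simp [evalLie_tmul]
  have hπz : evalLie 1 z = bch (fun a b : 𝔤 => ⁅a, b⁆) x y := by
    rw [hz, map_bch (br' := fun a b => ⁅a, b⁆) (evalLie (𝔤 := 𝔤) 1) (evalLie_lie 1) hterm, hev, hev]
  have hι' : ∀ k, (ι : ℝ[X] ⊗[ℝ] 𝔤 →ₗ[ℝ] EulerExt 𝔤) ∘ₗ LieAlgebra.ad ℝ _ k =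
      LieAlgebra.ad ℝ (EulerExt 𝔤) (ι k) ∘ₗ (ι : ℝ[X] ⊗[ℝ] 𝔤 →ₗ[ℝ] EulerExt 𝔤) := by
    intro k
    refine LinearMap.ext fun v => ?_
    exact LieHom.map_lie ι k v
  have hπ' : ∀ k : ℝ[X] ⊗[ℝ] 𝔤, evalLie 1 ∘ₗ LieAlgebra.ad ℝ _ k =
      LieAlgebra.ad ℝ 𝔤 (evalLie 1 k) ∘ₗ evalLie 1 := by
    intro k
    refine LinearMap.ext fun v => ?_
    exact evalLie_lie 1 k v
  have hπsurj : Function.Surjective (evalLie (𝔤 := 𝔤) 1) := fun v => ⟨_, hev v⟩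
  rw [hιz] at h2 h3
  have nK : ∀ k, IsNilpotent (LieAlgebra.ad ℝ (EulerExt 𝔤) (ι k)) →
      IsNilpotent (LieAlgebra.ad ℝ (ℝ[X] ⊗[ℝ] 𝔤) k) := fun k hk =>
    LinearMap.isNilpotent_of_injective (hι' k) hιinj hk
  have nG : ∀ k, IsNilpotent (LieAlgebra.ad ℝ (ℝ[X] ⊗[ℝ] 𝔤) k) →
      IsNilpotent (LieAlgebra.ad ℝ 𝔤 (evalLie 1 k)) := fun k hk =>
    LinearMap.isNilpotent_of_surjective (hπ' k) hπsurj hk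
  have eK : ∀ k, IsNilpotent (LieAlgebra.ad ℝ (EulerExt 𝔤) (ι k)) → ∀ v,
      ι (nilExp (LieAlgebra.ad ℝ _ k) v) = nilExp (LieAlgebra.ad ℝ _ (ι k)) (ι v) := fun k hk v =>
    LinearMap.congr_fun (LinearMap.intertwine_nilExp (hι' k) (nK k hk) hk) v
  have eG : ∀ k, IsNilpotent (LieAlgebra.ad ℝ (EulerExt 𝔤) (ι k)) → ∀ v,
      evalLie 1 (nilExp (LieAlgebra.ad ℝ _ k) v) =
        nilExp (LieAlgebra.ad ℝ _ (evalLie 1 k)) (evalLie 1 v) := fun k hk v =>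
    LinearMap.congr_fun (LinearMap.intertwine_nilExp (hπ' k) (nK k hk) (nG k (nK k hk))) v
  have nx := h.inl.isNilpotent_left
  have ny := h.inl.isNilpotent_right
  refine ⟨fun n hn => ?_, ?_, ?_⟩
  · have := map_bchTerm (br' := fun a b => ⁅a, b⁆) (evalLie (𝔤 := 𝔤) 1) (evalLie_lie 1)
      ((X : ℝ[X]) ⊗ₜ x) ((X : ℝ[X]) ⊗ₜ y) n
    rw [hterm n hn, map_zero, hev, hev] at this
    exact this.symm
  · rw [← hπz]; exact nG z (nK z h2)
  · ext v
    -- It suffices to test the operators on constant polynomials, as `1 ⊗ v` evaluates to `v`.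
    have h4 : nilExp (LieAlgebra.ad ℝ _ ((X : ℝ[X]) ⊗ₜ[ℝ] x))
        (nilExp (LieAlgebra.ad ℝ _ ((X : ℝ[X]) ⊗ₜ[ℝ] y)) ((1 : ℝ[X]) ⊗ₜ[ℝ] v)) =
          nilExp (LieAlgebra.ad ℝ _ z) ((1 : ℝ[X]) ⊗ₜ[ℝ] v) := by
      refine hιinj ?_
      rw [eK _ nx, eK _ ny, eK _ h2, ← h3]
      rfl
    have h5 := congrArg (evalLie 1) h4
    rw [eG _ nx, eG _ ny, eG _ h2, hπz, hev, hev, evalLie_tmul] at h5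
    simpa using h5

end Euler

/-! ### Associativity of the Baker-Campbell-Hausdorff product -/

section Assoc

open Polynomial LieAlgebra

attribute [local instance] LieRing.ofAssociativeRing

theorem jointlyAdNilpotent_of_foldr {𝔤 : Type*} [LieRing 𝔤] {k : ℕ}
    (h : ∀ l : List 𝔤, l.length = k → ∀ y : 𝔤, l.foldr (fun a b => ⁅a, b⁆) y = 0) (x y : 𝔤) :
    JointlyAdNilpotent k x y := by
  intro l _ hl g
  rw [← List.take_append_drop k l, List.foldr_append]
  exact h _ (by simp; omega) _

variable {𝔤 : Type*} [LieRing 𝔤] [LieAlgebra ℝ 𝔤]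

theorem bchTerm_eq_zero_of_foldr {k : ℕ}
    (h : ∀ l : List 𝔤, l.length = k → ∀ y : 𝔤, l.foldr (fun a b => ⁅a, b⁆) y = 0) (x y : 𝔤) (n : ℕ)
    (hn : k + 1 < n) : bchTerm (fun a b : 𝔤 => ⁅a, b⁆) x y n = 0 :=
  (nilExp_ad_mul (jointlyAdNilpotent_of_foldr h x y)).1 n hn

/-- The kernel of `X d/dX` consists of the constants, and these are seen by evaluation at `0`. -/
theorem eq_of_eulerDerivation_eq {a b : ℝ[X] ⊗[ℝ] 𝔤} (h : eulerDerivation 𝔤 a = eulerDerivation 𝔤 b)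
    (h0 : evalLie 0 a = evalLie 0 b) : a = b := by
  -- `J` divides the coefficient of degree `n` by `n`, which inverts `X d/dX` in positive degrees.
  -- Its value in degree zero plays no role, as `X d/dX` has no constant term in its image.
  set J : ℝ[X] →ₗ[ℝ] ℝ[X] := (Polynomial.basisMonomials ℝ).constr ℝ
    fun n => monomial n ((n : ℝ)⁻¹) with hJ
  have h1 : J ∘ₗ (LinearMap.mulLeft ℝ (X : ℝ[X]) ∘ₗ Polynomial.derivative) +
      (Algebra.linearMap ℝ ℝ[X]) ∘ₗ (Polynomial.aeval (0 : ℝ)).toLinearMap = LinearMap.id := by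
    refine Polynomial.lhom_ext' fun n => LinearMap.ext_ring ?_
    have h2 : ∀ n (c : ℝ), J (monomial n c) = monomial n (c * (n : ℝ)⁻¹) := by
      intro n c
      have h3 := (Polynomial.basisMonomials ℝ).constr_basis ℝ
        (fun n => (monomial n ((n : ℝ)⁻¹) : ℝ[X])) n
      rw [Polynomial.coe_basisMonomials, ← hJ] at h3
      have h4 : (monomial n c : ℝ[X]) = c • monomial n 1 := by simp [smul_monomial]
      rw [h4, map_smul, h3, smul_monomial, smul_eq_mul]
    rcases n with _ | n
    · simp
    · simp only [LinearMap.comp_apply, LinearMap.add_apply, LinearMap.mulLeft_apply,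
        derivative_monomial, X_mul_monomial, LinearMap.id_apply, Nat.add_sub_cancel]
      rw [h2]
      have : ((n : ℝ) + 1) ≠ 0 := by positivity
      simp [this]
  have h5 : ∀ c : ℝ[X] ⊗[ℝ] 𝔤, c = LinearMap.rTensor 𝔤 J (eulerDerivation 𝔤 c) +
      (1 : ℝ[X]) ⊗ₜ evalLie 0 c := by
    intro c
    induction c with
    | zero => simp
    | add c d hc hd =>
      simp only [map_add, TensorProduct.tmul_add]
      nth_rw 1 [hc, hd]
      abel
    | tmul p x =>
      have h6 := LinearMap.congr_fun h1 p
      simp only [LinearMap.add_apply, LinearMap.comp_apply, LinearMap.mulLeft_apply,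
        LinearMap.id_apply] at h6
      rw [eulerDerivation_tmul, LinearMap.rTensor_tmul, evalLie_tmul, ← TensorProduct.smul_tmul,
        ← TensorProduct.add_tmul]
      nth_rw 1 [← h6]
      congr 2
      simp [Algebra.smul_def, Polynomial.aeval_def, Polynomial.eval₂_eq_eval_map]
  rw [h5 a, h5 b, h, h0]

/-- For the two ways of bracketing `X ⊗ x`, `X ⊗ y`, `X ⊗ z`, the exponentials of `ad` agree because
composition of operators is associative; logarithms give equality of the `ad`'s themselves. In `𝔤`
this would lose the centre, but in the extension the action on `E` recovers everything except the
constant term. -/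
theorem bch_assoc {k : ℕ}
    (h : ∀ l : List 𝔤, l.length = k → ∀ y : 𝔤, l.foldr (fun a b => ⁅a, b⁆) y = 0) (x y z : 𝔤) :
    bch (fun a b => ⁅a, b⁆) (bch (fun a b => ⁅a, b⁆) x y) z =
      bch (fun a b => ⁅a, b⁆) x (bch (fun a b => ⁅a, b⁆) y z) := by
  set ι : ℝ[X] ⊗[ℝ] 𝔤 →ₗ⁅ℝ⁆ EulerExt 𝔤 := SemiDirectSum.inl (eulerAction 𝔤) with hι
  have hιinj : Function.Injective ι := SemiDirectSum.inl_injective _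
  have hK : ∀ l : List (ℝ[X] ⊗[ℝ] 𝔤), l.length = k →
      ∀ y : ℝ[X] ⊗[ℝ] 𝔤, l.foldr (fun a b => ⁅a, b⁆) y = 0 :=
    fun l hl y => foldr_tensor_eq_zero (LieModule.toEnd ℝ 𝔤 𝔤 : 𝔤 →ₗ[ℝ] Module.End ℝ 𝔤)
      (LieModule.toEnd ℝ (ℝ[X] ⊗[ℝ] 𝔤) (ℝ[X] ⊗[ℝ] 𝔤) : _ →ₗ[ℝ] Module.End ℝ (ℝ[X] ⊗[ℝ] 𝔤))
      (fun a b => a * b) (fun _ _ _ _ => rfl) h l hl y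
  have hE : ∀ a b, JointlyAdNilpotent (k + 1) (ι a) (ι b) := by
    intro a b l hl hN g
    have h1 : ∃ l' : List (ℝ[X] ⊗[ℝ] 𝔤), l'.map ι = l := by
      clear hN
      induction l with
      | nil => exact ⟨[], rfl⟩
      | cons c l ih =>
        obtain ⟨l', rfl⟩ := ih fun b hb => hl b (by simp [hb])
        rcases hl c (by simp) with rfl | rfl
        · exact ⟨a :: l', rfl⟩
        · exact ⟨b :: l', rfl⟩
    obtain ⟨l', rfl⟩ := h1
    rw [List.length_map] at hN
    obtain ⟨l', c, rfl⟩ : ∃ l₀ a, l' = l₀ ++ [a] :=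
      ⟨l'.dropLast, l'.getLast (by rintro rfl; simp at hN), (List.dropLast_append_getLast _).symm⟩
    refine foldr_map_inl_eq_zero (fun v => ?_) g
    rw [← List.take_append_drop k l', List.foldr_append]
    exact hK _ (by simp at hN ⊢; omega) _
  have hmapι : ∀ a b, ι (bch (fun a b => ⁅a, b⁆) a b) = bch (fun a b => ⁅a, b⁆) (ι a) (ι b) :=
    fun a b => map_bch (br' := fun a b => ⁅a, b⁆) (ι : ℝ[X] ⊗[ℝ] 𝔤 →ₗ[ℝ] EulerExt 𝔤)
      (fun a b => LieHom.map_lie ι a b) (bchTerm_eq_zero_of_foldr hK a b)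
  have hmapev : ∀ t a b, evalLie (𝔤 := 𝔤) t (bch (fun a b => ⁅a, b⁆) a b) =
      bch (fun a b => ⁅a, b⁆) (evalLie t a) (evalLie t b) :=
    fun t a b => map_bch (br' := fun a b => ⁅a, b⁆) (evalLie (𝔤 := 𝔤) t) (evalLie_lie t)
      (bchTerm_eq_zero_of_foldr hK a b)
  have hexp : ∀ a b, nilExp (LieAlgebra.ad ℝ (EulerExt 𝔤) (ι a)) *
      nilExp (LieAlgebra.ad ℝ (EulerExt 𝔤) (ι b)) =
        nilExp (LieAlgebra.ad ℝ (EulerExt 𝔤) (ι (bch (fun a b => ⁅a, b⁆) a b))) := by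
    intro a b
    rw [hmapι]
    exact (nilExp_ad_mul (hE a b)).2.2
  set a := bch (fun a b : ℝ[X] ⊗[ℝ] 𝔤 => ⁅a, b⁆) (bch (fun a b => ⁅a, b⁆) (X ⊗ₜ x) (X ⊗ₜ y)) (X ⊗ₜ z)
    with ha
  set b := bch (fun a b : ℝ[X] ⊗[ℝ] 𝔤 => ⁅a, b⁆) (X ⊗ₜ x) (bch (fun a b => ⁅a, b⁆) (X ⊗ₜ y) (X ⊗ₜ z))
    with hb
  have hab : nilExp (LieAlgebra.ad ℝ (EulerExt 𝔤) (ι a)) =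
      nilExp (LieAlgebra.ad ℝ (EulerExt 𝔤) (ι b)) := by
    rw [ha, hb, ← hexp, ← hexp, ← hexp, ← hexp, mul_assoc]
  have hlog : ∀ c, ∃ M, ∀ n, M ≤ n → nilLog n (nilExp (LieAlgebra.ad ℝ (EulerExt 𝔤) (ι c)) - 1) =
      LieAlgebra.ad ℝ (EulerExt 𝔤) (ι c) := by
    intro c
    have hc := (hE c c).isNilpotent_left
    obtain ⟨M, hM⟩ := isNilpotent_nilExp_sub_one hc
    exact ⟨M, fun n hn => nilLog_nilExp hc (pow_eq_zero_of_le (by omega) hM)⟩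
  obtain ⟨M, hM⟩ := hlog a
  obtain ⟨M', hM'⟩ := hlog b
  have had : LieAlgebra.ad ℝ (EulerExt 𝔤) (ι a) = LieAlgebra.ad ℝ (EulerExt 𝔤) (ι b) := by
    rw [← hM (max M M') (le_max_left _ _), ← hM' (max M M') (le_max_right _ _), hab]
  -- Both adjoint operators are applied to `E`, where `ad a` gives minus the Euler derivative of
  -- `a`.
  have hD : eulerDerivation 𝔤 a = eulerDerivation 𝔤 b := by
    refine hιinj ?_
    rw [hι, ← eulerElement_lie_inl, ← eulerElement_lie_inl, ← lie_skew, ← lie_skew _ (ι b)]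
    exact congrArg Neg.neg (LinearMap.congr_fun had (eulerElement 𝔤))
  -- The constant terms agree because at `X = 0` both products become the product of zeros.
  have hab' : a = b := by
    refine eq_of_eulerDerivation_eq hD ?_
    rw [ha, hb]
    simp only [hmapev, evalLie_tmul, eval_X, zero_smul]
    have h00 : bch (fun a b : 𝔤 => ⁅a, b⁆) 0 0 = 0 := by
      rw [bch, finsum_eq_zero_of_forall_eq_zero]
      intro n
      have := map_bchTerm (br := fun a b : 𝔤 => ⁅a, b⁆) (br' := fun a b : 𝔤 => ⁅a, b⁆)
        (0 : 𝔤 →ₗ[ℝ] 𝔤) (by simp) 0 0 n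
      simpa using this.symm
    rw [h00]
  have h1 := congrArg (evalLie 1) hab'
  rw [ha, hb] at h1
  simpa only [hmapev, evalLie_tmul, eval_X, one_smul] using h1

end Assoc

/-! ### Terms of low degree and homogeneity -/

section BCHLow

theorem nestedBracket_eq_zero {V : Type*} [AddCommGroup V] {br : V → V → V}
    (h0 : ∀ a, br a 0 = 0) : ∀ l : List V, (∀ a ∈ l, ∀ b ∈ l, br a b = 0) → 2 ≤ l.length →
    nestedBracket br l = 0
  | [], _, h => by simp at h
  | [_], _, h => by simp at h
  | [a, b], h, _ => h a (by simp) b (by simp)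
  | a :: b :: c :: l, h, _ => by
    have ih := nestedBracket_eq_zero h0 (b :: c :: l)
      (fun x hx y hy => h x (List.mem_cons_of_mem a hx) y (List.mem_cons_of_mem a hy)) (by simp)
    change br a (nestedBracket br (b :: c :: l)) = 0
    rw [ih, h0]

variable {V : Type*} [AddCommGroup V] [Module ℝ V]

theorem bchTerm_zero (br : V → V → V) (x y : V) : bchTerm br x y 0 = 0 := by simp [bchTerm]

theorem bchTerm_one (br : V → V → V) (x y : V) : bchTerm br x y 1 = x + y := by
  simp only [bchTerm, Finset.Icc_self, Finset.sum_singleton, Finset.sum_filter]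
  rw [← (Equiv.funUnique (Fin 1) (Fin 2 × Fin 2)).symm.sum_comp]
  simp [Fintype.sum_prod_type, Fin.sum_univ_succ, nestedBracket]
  abel

theorem bchTerm_eq_zero_of_commute {br : V → V → V} (h0 : ∀ a, br a 0 = 0) {x y : V}
    (hxx : br x x = 0) (hxy : br x y = 0) (hyx : br y x = 0) (hyy : br y y = 0) {n : ℕ}
    (hn : 2 ≤ n) : bchTerm br x y n = 0 := by
  rw [bchTerm_eq_sum_dynkinTuples _ _ _ le_rfl, Finset.sum_eq_zero, smul_zero]
  intro k _
  rw [Finset.sum_eq_zero, smul_zero]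
  intro e he
  rw [nestedBracket_eq_zero h0, smul_zero]
  · intro a ha b hb
    rcases mem_dynkinWord ha with rfl | rfl <;> rcases mem_dynkinWord hb with rfl | rfl <;> assumption
  · rw [length_dynkinWord, (Finset.mem_filter.1 he).2]
    exact hn

/-- Source of the unit and inverse laws of `N_A`, whose factors are `0` or opposite to each other.
-/
theorem bch_of_commute {br : V → V → V} (h0 : ∀ a, br a 0 = 0) {x y : V}
    (hxx : br x x = 0) (hxy : br x y = 0) (hyx : br y x = 0) (hyy : br y y = 0) :
    bch br x y = x + y := by
  rw [bch, finsum_eq_single _ 1, bchTerm_one]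
  intro n hn
  rcases n with _ | _ | n
  · exact bchTerm_zero _ _ _
  · exact absurd rfl hn
  · exact bchTerm_eq_zero_of_commute h0 hxx hxy hyx hyy (by omega)

/-- The summand `k = 1` gives `⁅x, y⁆ / 2`; in the summand `k = 2` the words `xy` and `yx` occur
with equal weight and cancel. -/
theorem bchTerm_two {𝔤 : Type*} [LieRing 𝔤] [LieAlgebra ℝ 𝔤] (x y : 𝔤) :
    bchTerm (fun a b : 𝔤 => ⁅a, b⁆) x y 2 = (2 : ℝ)⁻¹ • ⁅x, y⁆ := by
  have h : Finset.Icc 1 2 = {1, 2} := by decide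
  simp only [bchTerm, h, Finset.sum_filter]
  rw [Finset.sum_pair (by decide), ← (Equiv.funUnique (Fin 1) (Fin 3 × Fin 3)).symm.sum_comp,
    ← (finTwoArrowEquiv (Fin 3 × Fin 3)).symm.sum_comp]
  simp [Fintype.sum_prod_type, Fin.sum_univ_succ, nestedBracket, List.ofFn_succ, Fin.forall_fin_two,
    finTwoArrowEquiv]
  rw [← lie_skew x y, smul_neg, smul_neg, add_neg_cancel]

theorem bchTerm_smul (br : V → V → V) (c : ℝ) (hl : ∀ a b, br (c • a) b = c • br a b)
    (hr : ∀ (d : ℝ) a b, br a (d • b) = d • br a b) (x y : V) (n : ℕ) :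
    bchTerm br (c • x) (c • y) n = c ^ n • bchTerm br x y n := by
  have h1 : ∀ l : List V, nestedBracket br (l.map (c • ·)) = c ^ l.length • nestedBracket br l := by
    intro l
    induction l with
    | nil => simp [nestedBracket]
    | cons a l ih =>
      rcases l with _ | ⟨b, l⟩
      · simp [nestedBracket]
      · change br (c • a) (nestedBracket br ((b :: l).map (c • ·))) = _ • br a (nestedBracket br (b :: l))
        rw [ih, hl, hr, smul_smul, ← pow_succ']
        rfl
  simp only [bchTerm_eq_sum_dynkinTuples _ _ _ le_rfl, Finset.smul_sum]
  refine Finset.sum_congr rfl fun k _ => Finset.sum_congr rfl fun e he => ?_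
  rw [← map_dynkinWord e x y (c • ·), h1, length_dynkinWord, (Finset.mem_filter.1 he).2]
  simp only [smul_comm (c ^ n)]

end BCHLow

/-! ## Signs in Grassmann algebras -/

/-- Even and odd elements are built up by multiplying with pairs of generators, and moving `ι v`
past a pair changes no sign. -/
theorem grPart_mul_ι {q : ℕ} {i : ZMod 2} {a : Gr q} (ha : a ∈ grPart q i)
    (v : Fin q → ℝ) :
    a * ExteriorAlgebra.ι ℝ v = koszul i 1 • (ExteriorAlgebra.ι ℝ v * a) := by
  have hsw : ∀ m w : Fin q → ℝ, ExteriorAlgebra.ι ℝ m * ExteriorAlgebra.ι ℝ w =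
      -(ExteriorAlgebra.ι ℝ w * ExteriorAlgebra.ι ℝ m) := fun m w =>
    eq_neg_of_add_eq_zero_left (ExteriorAlgebra.ι_add_mul_swap m w)
  have hstep : ∀ (m₁ m₂ : Fin q → ℝ) (x : Gr q) (c : ℝ),
      x * ExteriorAlgebra.ι ℝ v = c • (ExteriorAlgebra.ι ℝ v * x) →
      ExteriorAlgebra.ι ℝ m₁ * ExteriorAlgebra.ι ℝ m₂ * x * ExteriorAlgebra.ι ℝ v =
        c • (ExteriorAlgebra.ι ℝ v * (ExteriorAlgebra.ι ℝ m₁ * ExteriorAlgebra.ι ℝ m₂ * x)) := by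
    intro m₁ m₂ x c h
    rw [mul_assoc, h, mul_smul_comm, ← mul_assoc, mul_assoc (ExteriorAlgebra.ι ℝ m₁), hsw m₂ v,
      mul_neg, ← mul_assoc, hsw m₁ v]
    simp only [neg_mul, neg_neg, mul_assoc]
  have h2 : ∀ i : ZMod 2, i = 0 ∨ i = 1 := by decide
  rcases h2 i with rfl | rfl
  · refine CliffordAlgebra.even_induction (Q := (0 : QuadraticForm ℝ (Fin q → ℝ)))
      (motive := fun a _ => a * ExteriorAlgebra.ι ℝ v = koszul 0 1 • (ExteriorAlgebra.ι ℝ v * a))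
      (fun r => ?_) (fun x y _ _ hx hy => ?_) (fun m₁ m₂ x _ hx => hstep m₁ m₂ x _ hx) a ha
    · rw [Algebra.commutes]; simp [koszul]
    · rw [add_mul, hx, hy, mul_add, smul_add]
  · refine CliffordAlgebra.odd_induction (Q := (0 : QuadraticForm ℝ (Fin q → ℝ)))
      (P := fun a _ => a * ExteriorAlgebra.ι ℝ v = koszul 1 1 • (ExteriorAlgebra.ι ℝ v * a))
      (fun r => ?_) (fun x y _ _ hx hy => ?_) (fun m₁ m₂ x _ hx => hstep m₁ m₂ x _ hx) a ha
    · refine (hsw r v).trans ?_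
      have : koszul 1 1 = -1 := by simp [koszul, ZMod.val_one]
      rw [this, neg_one_smul]
    · rw [add_mul, hx, hy, mul_add, smul_add]

theorem koszul_comm (i j : ZMod 2) : koszul i j = koszul j i := by
  rw [koszul, koszul, mul_comm]

theorem koszul_one_mul (i : ZMod 2) : koszul i 1 * koszul i 1 = 1 := by
  rw [koszul, ← mul_pow]; simp

theorem grPart_commute {q : ℕ} {i j : ZMod 2} {a b : Gr q} (ha : a ∈ grPart q i)
    (hb : b ∈ grPart q j) : a * b = koszul i j • (b * a) := by
  have hstep : ∀ (m₁ m₂ : Fin q → ℝ) (x : Gr q) (c : ℝ), a * x = c • (x * a) →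
      a * (ExteriorAlgebra.ι ℝ m₁ * ExteriorAlgebra.ι ℝ m₂ * x) =
        c • (ExteriorAlgebra.ι ℝ m₁ * ExteriorAlgebra.ι ℝ m₂ * x * a) := by
    intro m₁ m₂ x c h
    rw [← mul_assoc, ← mul_assoc, grPart_mul_ι ha, smul_mul_assoc, mul_assoc _ a,
      grPart_mul_ι ha, mul_smul_comm, smul_smul, koszul_one_mul, one_smul]
    simp only [mul_assoc]
    rw [h]
    simp only [mul_smul_comm]
  have h2 : ∀ i : ZMod 2, i = 0 ∨ i = 1 := by decide
  rcases h2 j with rfl | rfl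
  · refine CliffordAlgebra.even_induction (Q := (0 : QuadraticForm ℝ (Fin q → ℝ)))
      (motive := fun b _ => a * b = koszul i 0 • (b * a))
      (fun r => ?_) (fun x y _ _ hx hy => ?_) (fun m₁ m₂ x _ hx => hstep m₁ m₂ x _ hx) b hb
    · rw [Algebra.commutes]; simp [koszul]
    · rw [mul_add, hx, hy, add_mul, smul_add]
  · refine CliffordAlgebra.odd_induction (Q := (0 : QuadraticForm ℝ (Fin q → ℝ)))
      (P := fun b _ => a * b = koszul i 1 • (b * a))
      (fun r => grPart_mul_ι ha r) (fun x y _ _ hx hy => ?_)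
      (fun m₁ m₂ x _ hx => hstep m₁ m₂ x _ hx) b hb
    rw [mul_add, hx, hy, add_mul, smul_add]

theorem koszul_mul_self (i j : ZMod 2) : koszul i j * koszul i j = 1 := by
  rw [koszul, ← mul_pow]; simp

namespace LieSuperalgebra

variable {𝔫 : Type*} [AddCommGroup 𝔫] [Module ℝ 𝔫] (L : LieSuperalgebra 𝔫)

/-! ## The Lie algebra of `A`-points -/

/-- The Koszul sign of `bracket_skew` is cancelled by the sign from interchanging the Grassmann
coefficients. The same cancellation in `tensorBracket_jacobi` makes `𝔫_A` an ordinary Lie algebra.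
-/
theorem tensorBracket_skew {q : ℕ} {x y : Gr q ⊗[ℝ] 𝔫} (hx : x ∈ L.evenPart q)
    (hy : y ∈ L.evenPart q) : L.tensorBracket q x y = -L.tensorBracket q y x := by
  induction hx using Submodule.span_induction with
  | mem x h =>
    obtain ⟨i, a, ha, v, hv, rfl⟩ := h
    induction hy using Submodule.span_induction with
    | mem y h =>
      obtain ⟨j, b, hb, w, hw, rfl⟩ := h
      rw [tensorBracket_tmul, tensorBracket_tmul, L.bracket_skew hv hw, grPart_commute hb ha,
        TensorProduct.tmul_neg, TensorProduct.smul_tmul_smul, koszul_comm j i, koszul_mul_self,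
        one_smul]
    | zero => simp
    | add x y _ _ hx hy => rw [map_add, hx, hy, map_add, LinearMap.add_apply, neg_add]
    | smul c x _ hx => rw [map_smul, hx, map_smul, LinearMap.smul_apply, smul_neg]
  | zero => simp
  | add x y _ _ hx hy => rw [map_add, LinearMap.add_apply, hx, hy, map_add, neg_add]
  | smul c x _ hx => rw [map_smul, LinearMap.smul_apply, hx, map_smul, smul_neg]

theorem tensorBracket_jacobi {q : ℕ} {x y z : Gr q ⊗[ℝ] 𝔫} (hx : x ∈ L.evenPart q)
    (hy : y ∈ L.evenPart q) (hz : z ∈ L.evenPart q) :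
    L.tensorBracket q x (L.tensorBracket q y z) =
      L.tensorBracket q (L.tensorBracket q x y) z + L.tensorBracket q y (L.tensorBracket q x z) := by
  induction hx using Submodule.span_induction with
  | mem x h =>
    obtain ⟨i, a, ha, u, hu, rfl⟩ := h
    induction hy using Submodule.span_induction with
    | mem y h =>
      obtain ⟨j, b, hb, v, hv, rfl⟩ := h
      induction hz using Submodule.span_induction with
      | mem z h =>
        obtain ⟨k, c, hc, w, hw, rfl⟩ := h
        simp only [tensorBracket_tmul]
        rw [L.jacobi hu hv hw, TensorProduct.tmul_add, mul_assoc c b a, mul_assoc c a b,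
          grPart_commute ha hb, mul_smul_comm, TensorProduct.smul_tmul]
      | zero => simp
      | add x y _ _ hx hy => simp only [map_add, hx, hy]; abel
      | smul c x _ hx => simp only [map_smul, hx, smul_add]
    | zero => simp
    | add x y _ _ hx hy => simp only [map_add, LinearMap.add_apply, hx, hy]; abel
    | smul c x _ hx => simp only [map_smul, LinearMap.smul_apply, hx, smul_add]
  | zero => simp
  | add x y _ _ hx hy => simp only [map_add, LinearMap.add_apply, hx, hy]; abel
  | smul c x _ hx => simp only [map_smul, LinearMap.smul_apply, hx, smul_add]

/-- The Lie algebra structure on the `A`-points. -/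
noncomputable instance Points.instLieRing (q : ℕ) : LieRing (L.Points q) where
  bracket x y := L.pointsBracket x y
  add_lie x y z := Subtype.ext (by
    change L.tensorBracket q (x.1 + y.1) z.1 = _
    rw [map_add]; rfl)
  lie_add x y z := Subtype.ext (by
    change L.tensorBracket q x.1 (y.1 + z.1) = _
    rw [map_add]; rfl)
  lie_self x := Subtype.ext (by
    have h := L.tensorBracket_skew x.2 x.2
    rw [eq_neg_iff_add_eq_zero, ← two_smul ℝ] at h
    exact (smul_eq_zero.1 h).resolve_left two_ne_zero)
  leibniz_lie x y z := Subtype.ext (L.tensorBracket_jacobi x.2 y.2 z.2)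

noncomputable instance Points.instLieAlgebra (q : ℕ) : LieAlgebra ℝ (L.Points q) where
  lie_smul c x y := Subtype.ext (by
    change L.tensorBracket q x.1 (c • y.1) = _
    rw [map_smul]; rfl)

/-- The inclusion of the `A`-points in `A ⊗ 𝔫`. -/
noncomputable def pointsVal (q : ℕ) : L.Points q →ₗ[ℝ] Gr q ⊗[ℝ] 𝔫 := (L.evenPart q).subtype

theorem pointsVal_injective (q : ℕ) : Function.Injective (L.pointsVal q) := Subtype.val_injective

theorem pointsVal_lie {q : ℕ} (x y : L.Points q) :
    L.pointsVal q ⁅x, y⁆ = L.tensorBracket q (L.pointsVal q x) (L.pointsVal q y) := rfl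

theorem mul_eq_bch {q : ℕ} (x y : L.Points q) : L.mul x y = bch (fun a b => ⁅a, b⁆) x y := rfl

variable {L}

theorem IsNilpotent.foldr_points (hL : L.IsNilpotent) : ∃ k : ℕ, ∀ q : ℕ, ∀ l : List (L.Points q),
    l.length = k → ∀ y : L.Points q, l.foldr (fun a b => ⁅a, b⁆) y = 0 := by
  obtain ⟨k, hk⟩ := hL
  refine ⟨k, fun q l hl y => L.pointsVal_injective q ?_⟩
  have h2 : ∀ l : List (L.Points q), L.pointsVal q (l.foldr (fun a b => ⁅a, b⁆) y) =
      (l.map (L.pointsVal q)).foldr (fun x z => L.tensorBracket q x z) (L.pointsVal q y) := by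
    intro l
    induction l with
    | nil => rfl
    | cons a l ih => rw [List.foldr_cons, List.map_cons, List.foldr_cons, ← ih, pointsVal_lie]
  rw [h2, map_zero]
  exact foldr_tensor_eq_zero L.bracket (L.tensorBracket q) (fun a b => b * a)
    (fun a b v w => L.tensorBracket_tmul a b v w) hk (l.map (L.pointsVal q)) (by simpa using hl) _

/-- The bound is uniform in the Grassmann algebra, so that the products in `N_A` and `N_B` can be
compared term by term. -/
theorem IsNilpotent.bchTerm_eq_zero (hL : L.IsNilpotent) : ∃ N : ℕ, ∀ q : ℕ, ∀ x y : L.Points q,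
    ∀ n, N < n → bchTerm L.pointsBracket x y n = 0 := by
  obtain ⟨k, hk⟩ := hL.foldr_points
  exact ⟨k + 1, fun q x y n hn => bchTerm_eq_zero_of_foldr (hk q) x y n hn⟩

theorem IsNilpotent.mul_assoc (hL : L.IsNilpotent) {q : ℕ} (x y z : L.Points q) :
    L.mul (L.mul x y) z = L.mul x (L.mul y z) := by
  obtain ⟨k, hk⟩ := hL.foldr_points
  exact bch_assoc (hk q) x y z

variable (L)

theorem mul_zero_right {q : ℕ} (x : L.Points q) : L.mul x 0 = x := by
  rw [mul_eq_bch, bch_of_commute] <;> simp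

theorem zero_mul_left {q : ℕ} (x : L.Points q) : L.mul 0 x = x := by
  rw [mul_eq_bch, bch_of_commute] <;> simp

theorem neg_mul_self {q : ℕ} (x : L.Points q) : L.mul (-x) x = 0 := by
  rw [mul_eq_bch, bch_of_commute] <;> simp

theorem mul_neg_self {q : ℕ} (x : L.Points q) : L.mul x (-x) = 0 := by
  rw [mul_eq_bch, bch_of_commute] <;> simp

variable {L}

theorem IsNilpotent.neg_mul_cancel (hL : L.IsNilpotent) {q : ℕ} (x y : L.Points q) :
    L.mul (-x) (L.mul x y) = y := by
  rw [← hL.mul_assoc, neg_mul_self, zero_mul_left]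

theorem IsNilpotent.mul_neg_cancel (hL : L.IsNilpotent) {q : ℕ} (x y : L.Points q) :
    L.mul x (L.mul (-x) y) = y := by
  rw [← hL.mul_assoc, mul_neg_self, zero_mul_left]

theorem IsNilpotent.neg_mul (hL : L.IsNilpotent) {q : ℕ} (x y : L.Points q) :
    -L.mul x y = L.mul (-y) (-x) := by
  have h : L.mul (L.mul x y) (L.mul (-y) (-x)) = 0 := by
    rw [hL.mul_assoc, hL.mul_neg_cancel, mul_neg_self]
  rw [← hL.neg_mul_cancel (L.mul x y) (L.mul (-y) (-x)), h, mul_zero_right]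

end LieSuperalgebra

/-! ### Koszul signs of reversed products -/

theorem Fin.prod_Iio_succ' {M : Type*} [CommMonoid M] {n : ℕ} (f : Fin (n + 1) → M) (j : Fin n) :
    ∏ k ∈ Finset.Iio j.succ, f k = f 0 * ∏ k ∈ Finset.Iio j, f k.succ := by
  have h : ∀ {n : ℕ} (j : Fin n), Finset.Iio j = Finset.univ.filter (· < j) := fun j => by ext; simp
  simp only [h, Finset.prod_filter]
  rw [Fin.prod_univ_succ]
  simp

theorem Fin.prod_Iio_castSucc' {M : Type*} [CommMonoid M] {n : ℕ} (f : Fin (n + 1) → M)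
    (j : Fin n) : ∏ k ∈ Finset.Iio j.castSucc, f k = ∏ k ∈ Finset.Iio j, f k.castSucc := by
  have h : ∀ {n : ℕ} (j : Fin n), Finset.Iio j = Finset.univ.filter (· < j) := fun j => by ext; simp
  simp only [h, Finset.prod_filter]
  rw [Fin.prod_univ_castSucc]
  simp [not_lt_of_ge (Fin.le_last _)]

/-- The product `a_{p-1} ⋯ a_0`. -/
def revProd {A : Type*} [Monoid A] {p : ℕ} (a : Fin p → A) : A := (List.ofFn a).reverse.prod

theorem revProd_succ {A : Type*} [Monoid A] {p : ℕ} (a : Fin (p + 1) → A) :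
    revProd a = revProd (Fin.tail a) * a 0 := by
  rw [revProd, List.ofFn_succ, List.reverse_cons, List.prod_append, List.prod_singleton]
  rfl

theorem revProd_cons {A : Type*} [Monoid A] {p : ℕ} (b : A) (a : Fin p → A) :
    revProd (Fin.cons b a : Fin (p + 1) → A) = revProd a * b := by
  rw [revProd_succ, Fin.tail_cons, Fin.cons_zero]

theorem revProd_eq_removeNth_zero {q p : ℕ} (e : Fin (p + 1) → ZMod 2) (a : Fin (p + 1) → Gr q) :
    revProd a = (∏ k ∈ Finset.Iio 0, koszul (e 0) (e k)) • (revProd (Fin.removeNth 0 a) * a 0) := by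
  have h : Finset.Iio (0 : Fin (p + 1)) = ∅ := by ext; simp
  rw [h, Finset.prod_empty, one_smul, revProd_succ, Fin.removeNth_zero]

/-- Moving the factor `a j` to the right end carries it past `a k` for all `k < j`. This is the
origin of the signs `ε_1^(j-1)(j)` in the coboundary. -/
theorem revProd_eq_removeNth {q : ℕ} : ∀ {p : ℕ} (e : Fin (p + 1) → ZMod 2) (a : Fin (p + 1) → Gr q),
    (∀ k, a k ∈ grPart q (e k)) → ∀ j, revProd a =
      (∏ k ∈ Finset.Iio j, koszul (e j) (e k)) • (revProd (j.removeNth a) * a j)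
  | 0, e, a, ha, j => by
    obtain rfl : j = 0 := Fin.fin_one_eq_zero j
    exact revProd_eq_removeNth_zero e a
  | p + 1, e, a, ha, j => by
    induction j using Fin.cases with
    | zero => exact revProd_eq_removeNth_zero e a
    | succ j =>
      rw [revProd_succ, revProd_eq_removeNth (Fin.tail e) (Fin.tail a) (fun k => ha k.succ) j,
        revProd_succ (j.succ.removeNth a), Fin.prod_Iio_succ']
      have h1 : Fin.tail (j.succ.removeNth a) = j.removeNth (Fin.tail a) := by
        funext k
        simp [Fin.tail, Fin.removeNth]
      have h2 : (j.succ.removeNth a : Fin (p + 1) → Gr q) 0 = a 0 := by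
        simp [Fin.removeNth]
      have h3 : Fin.tail a j * a 0 = koszul (e j.succ) (e 0) • (a 0 * Fin.tail a j) :=
        grPart_commute (ha j.succ) (ha 0)
      rw [h1, h2, smul_mul_assoc, mul_assoc, h3, mul_smul_comm, smul_smul, mul_assoc]
      congr 1
      rw [mul_comm]
      rfl

theorem revProd_comp_swap {q : ℕ} : ∀ {p : ℕ} (e : Fin p → ZMod 2) (a : Fin p → Gr q),
    (∀ k, a k ∈ grPart q (e k)) → ∀ i j : Fin p, (j : ℕ) = i + 1 →
      revProd (a ∘ Equiv.swap i j) = koszul (e i) (e j) • revProd a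
  | 0, _, _, _, i, _, _ => i.elim0
  | p + 1, e, a, ha, i, j, hij => by
    have hj : j ≠ 0 := by rintro rfl; simp at hij
    obtain ⟨j, rfl⟩ := Fin.exists_succ_eq.2 hj
    induction i using Fin.cases with
    | zero =>
      rcases p with _ | p
      · exact j.elim0
      obtain rfl : j = 0 := by ext; simpa using hij
      have h1 : Fin.tail (Fin.tail (a ∘ Equiv.swap 0 (Fin.succ 0))) = Fin.tail (Fin.tail a) := by
        funext k
        simp only [Fin.tail, Function.comp_apply]
        rw [Equiv.swap_apply_of_ne_of_ne]
        · exact Fin.succ_ne_zero _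
        · simp [Fin.ext_iff]
      have h2 : ∀ b : Fin (p + 2) → Gr q,
          revProd b = revProd (Fin.tail (Fin.tail b)) * Fin.tail b 0 * b 0 := fun b => by
        rw [revProd_succ, revProd_succ (p := p)]
      rw [h2, h2 a, h1]
      simp only [Fin.tail, Function.comp_apply, Equiv.swap_apply_left, Equiv.swap_apply_right]
      rw [mul_assoc, grPart_commute (ha 0) (ha (Fin.succ 0)), mul_smul_comm, mul_assoc]
    | succ i =>
      have h1 : Fin.tail (a ∘ Equiv.swap i.succ j.succ) = Fin.tail a ∘ Equiv.swap i j := by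
        funext k
        simp only [Fin.tail, Function.comp_apply]
        rw [← (Fin.succ_injective p).map_swap]
      rw [revProd_succ, h1, revProd_comp_swap (Fin.tail e) (Fin.tail a) (fun k => ha k.succ) i j
        (by simpa using hij), revProd_succ a, smul_mul_assoc, Function.comp_apply,
        Equiv.swap_apply_of_ne_of_ne (Fin.succ_ne_zero _).symm (Fin.succ_ne_zero _).symm]
      rfl

/-! ### Alternation from adjacent transpositions -/

section Alternating

variable {M W : Type*} [AddCommGroup M] [Module ℝ M] [AddCommGroup W] [Module ℝ W]

/-- Adjacent transpositions generate the symmetric group, so `f` changes by the sign of any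
permutation. Transposing two equal arguments then gives `f x = -f x`. -/
theorem MultilinearMap.map_eq_zero_of_adjacent {p : ℕ} (f : MultilinearMap ℝ (fun _ : Fin p => M) W)
    (h : ∀ i j : Fin p, (j : ℕ) = i + 1 → ∀ x, f (x ∘ Equiv.swap i j) = -f x) (x : Fin p → M)
    (i j : Fin p) (hx : x i = x j) (hij : i ≠ j) : f x = 0 := by
  rcases p with _ | p
  · exact i.elim0
  have key : ∀ σ : Equiv.Perm (Fin (p + 1)), ∀ x, f (x ∘ σ) = (Equiv.Perm.sign σ : ℤ) • f x := by
    intro σ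
    have hσ : σ ∈ Submonoid.closure
        (Set.range fun i : Fin p => Equiv.swap i.castSucc i.succ) := by
      rw [Equiv.Perm.mclosure_swap_castSucc_succ]; trivial
    induction hσ using Submonoid.closure_induction with
    | mem σ hσ =>
      obtain ⟨i, rfl⟩ := hσ
      intro x
      rw [h _ _ (by simp), Equiv.Perm.sign_swap (Fin.castSucc_lt_succ).ne]
      simp
    | one => intro x; simp
    | mul σ τ _ _ hσ hτ =>
      intro x
      rw [Equiv.Perm.coe_mul, ← Function.comp_assoc, hτ, hσ, smul_smul, map_mul, mul_comm]
      rfl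
  have h1 := key (Equiv.swap i j) x
  have h2 : x ∘ Equiv.swap i j = x := by
    funext k
    rw [Function.comp_apply, Equiv.swap_apply_def]
    split_ifs with h1 h2
    · rw [h1, hx]
    · rw [h2, hx]
    · rfl
  rw [h2, Equiv.Perm.sign_swap hij] at h1
  simp only [Units.val_neg, Units.val_one, neg_smul, one_smul] at h1
  rw [eq_neg_iff_add_eq_zero, ← two_smul ℝ] at h1
  exact (smul_eq_zero.1 h1).resolve_left two_ne_zero

/-- The multilinear map
`(X_0, …, X_{m+1}) ↦ ω (β (X_i, X_j), X_0, …, X̂_i, …, X̂_j, …, X_{m+1})`. -/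
noncomputable def MultilinearMap.insertBilin (β : M →ₗ[ℝ] M →ₗ[ℝ] M) {m : ℕ}
    (ω : MultilinearMap ℝ (fun _ : Fin (m + 1) => M) W)
    (i : Fin (m + 1)) (j : Fin (m + 2)) : MultilinearMap ℝ (fun _ : Fin (m + 2) => M) W :=
  LinearMap.uncurryMid j
    { toFun := fun Y => LinearMap.uncurryMid i (ω.curryLeft ∘ₗ β.flip Y)
      map_add' := fun Y Y' => by ext v; simp
      map_smul' := fun c Y => by ext v; simp }

theorem MultilinearMap.insertBilin_apply (β : M →ₗ[ℝ] M →ₗ[ℝ] M) {m : ℕ}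
    (ω : MultilinearMap ℝ (fun _ : Fin (m + 1) => M) W)
    (i : Fin (m + 1)) (j : Fin (m + 2)) (X : Fin (m + 2) → M) :
    ω.insertBilin β i j X =
      ω (Fin.cons (β (X (j.succAbove i)) (X j)) fun k => X (j.succAbove (i.succAbove k))) :=
  rfl

end Alternating

/-! ### Super cochains as ordinary cochains on the points -/

namespace LieSuperalgebra

variable {𝔫 : Type*} [AddCommGroup 𝔫] [Module ℝ 𝔫] (L : LieSuperalgebra 𝔫)

theorem cobd_parity {m : ℕ} {ω : MultilinearMap ℝ (fun _ : Fin (m + 1) => 𝔫) ℝ}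
    (hω : ω ∈ L.evenCochains (m + 1)) (e : Fin (m + 2) → ZMod 2) (X : Fin (m + 2) → 𝔫)
    (hX : ∀ k, X k ∈ L.part (e k)) (he : ∑ k, e k ≠ 0) : L.cobd ω X = 0 := by
  rw [L.cobd_apply ω e X hX]
  refine Finset.sum_eq_zero fun j _ => Finset.sum_eq_zero fun i hi => ?_
  have hij : j.succAbove i = i.castSucc :=
    Fin.succAbove_of_castSucc_lt j i (Finset.mem_filter.1 hi).2
  rw [hω.2 (Fin.cons (e i.castSucc + e j) fun k => e (j.succAbove (i.succAbove k))), mul_zero]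
  · intro k
    induction k using Fin.cases with
    | zero => exact L.bracket_mem (hX _) (hX _)
    | succ k => exact hX _
  · rw [Fin.sum_univ_succ]
    simp only [Fin.cons_zero, Fin.cons_succ]
    rw [Fin.sum_univ_succAbove _ j, Fin.sum_univ_succAbove _ i, hij] at he
    rw [add_comm (e i.castSucc), add_assoc]
    exact he

variable [FiniteDimensional ℝ 𝔫]

/-- By multilinearity only homogeneous pure tensors matter. There the Koszul sign of `ω` and that of
the reversed product cancel, and only the minus sign remains. -/
theorem tensorExtend_swap {p : ℕ} {ω : MultilinearMap ℝ (fun _ : Fin p => 𝔫) ℝ}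
    (hω : ω ∈ L.evenCochains p) (q : ℕ) (i j : Fin p) (hij : (j : ℕ) = i + 1)
    {x : Fin p → Gr q ⊗[ℝ] 𝔫} (hx : ∀ k, x k ∈ L.evenPart q) :
    tensorExtend ω q (x ∘ Equiv.swap i j) = -tensorExtend ω q x := by
  have h := multilinear_mem_of_span _ (⊥ : Submodule ℝ (Gr q))
    ((tensorExtend ω q).domDomCongr (Equiv.swap i j) + tensorExtend ω q) (fun y hy => ?_) hx
  · rw [Submodule.mem_bot, add_apply, MultilinearMap.domDomCongr_apply] at h
    exact eq_neg_of_add_eq_zero_left h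
  · choose e a ha v hv hy using hy
    obtain rfl : y = fun k => a k ⊗ₜ[ℝ] v k := funext hy
    rw [Submodule.mem_bot, add_apply, MultilinearMap.domDomCongr_apply]
    have h1 := tensorExtend_tmul ω q (a ∘ Equiv.swap i j) (v ∘ Equiv.swap i j)
    have h2 := revProd_comp_swap e a ha i j hij
    rw [revProd, revProd] at h2
    simp only [Function.comp_apply] at h1
    rw [h1, tensorExtend_tmul, hω.1 i j hij e v hv]
    rw [h2, smul_smul, neg_mul, mul_right_comm, koszul_mul_self, one_mul, neg_smul,
      neg_add_cancel]

/-- After extension to `A`-points all Koszul signs of the super coboundary disappear and the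
ordinary Chevalley-Eilenberg formula remains. It is checked on homogeneous pure tensors. -/
theorem tensorExtend_cobd {m : ℕ} (ω : MultilinearMap ℝ (fun _ : Fin (m + 1) => 𝔫) ℝ)
    (q : ℕ) {x : Fin (m + 2) → Gr q ⊗[ℝ] 𝔫} (hx : ∀ k, x k ∈ L.evenPart q) :
    tensorExtend (L.cobd ω) q x = ∑ j : Fin (m + 2), ∑ i : Fin (m + 1) with i.castSucc < j,
      (-1 : ℝ) ^ ((i : ℕ) + (j : ℕ)) • tensorExtend ω q
        (Fin.cons (L.tensorBracket q (x i.castSucc) (x j))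
          fun k => x (j.succAbove (i.succAbove k))) := by
  set G : MultilinearMap ℝ (fun _ : Fin (m + 2) => Gr q ⊗[ℝ] 𝔫) (Gr q) :=
    ∑ j : Fin (m + 2), ∑ i : Fin (m + 1) with i.castSucc < j,
      (-1 : ℝ) ^ ((i : ℕ) + (j : ℕ)) • (tensorExtend ω q).insertBilin (L.tensorBracket q) i j with hG
  have hGx : ∀ x, G x = ∑ j : Fin (m + 2), ∑ i : Fin (m + 1) with i.castSucc < j,
      (-1 : ℝ) ^ ((i : ℕ) + (j : ℕ)) • tensorExtend ω q
        (Fin.cons (L.tensorBracket q (x i.castSucc) (x j))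
          fun k => x (j.succAbove (i.succAbove k))) := by
    intro x
    simp only [hG, sum_apply, smul_apply,
      MultilinearMap.insertBilin_apply]
    refine Finset.sum_congr rfl fun j _ => Finset.sum_congr rfl fun i hi => ?_
    rw [Fin.succAbove_of_castSucc_lt j i (Finset.mem_filter.1 hi).2]
  rw [← hGx]
  have h := multilinear_mem_of_span _ (⊥ : Submodule ℝ (Gr q))
    (tensorExtend (L.cobd ω) q - G) (fun y hy => ?_) hx
  · rw [Submodule.mem_bot, sub_apply] at h
    exact sub_eq_zero.1 h
  choose e a ha v hv hy using hy
  obtain rfl : y = fun k => a k ⊗ₜ[ℝ] v k := funext hy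
  rw [Submodule.mem_bot, sub_apply, sub_eq_zero, hGx, tensorExtend_tmul,
    L.cobd_apply ω e v hv, Finset.sum_smul]
  refine Finset.sum_congr rfl fun j _ => ?_
  rw [Finset.sum_smul]
  refine Finset.sum_congr rfl fun i hi => ?_
  have hij := (Finset.mem_filter.1 hi).2
  have hsa : j.succAbove i = i.castSucc := Fin.succAbove_of_castSucc_lt j i hij
  have hcons : (Fin.cons (L.tensorBracket q (a i.castSucc ⊗ₜ[ℝ] v i.castSucc) (a j ⊗ₜ[ℝ] v j))
      fun k => a (j.succAbove (i.succAbove k)) ⊗ₜ[ℝ] v (j.succAbove (i.succAbove k)) :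
      Fin (m + 1) → Gr q ⊗[ℝ] 𝔫) = fun k =>
      (Fin.cons (a j * a i.castSucc) (fun k => a (j.succAbove (i.succAbove k))) :
        Fin (m + 1) → Gr q) k ⊗ₜ[ℝ]
      (Fin.cons (L.bracket (v i.castSucc) (v j)) (fun k => v (j.succAbove (i.succAbove k))) :
        Fin (m + 1) → 𝔫) k := by
    funext k
    induction k using Fin.cases with
    | zero => rfl
    | succ k => rfl
  rw [hcons, tensorExtend_tmul]
  change _ • revProd a = _ • _ • revProd _
  -- First `a j` and then `a i` is moved to the right end. Interchanging these two then produces the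
  -- coefficient `a j * a i` of the bracket of the two arguments.
  have hR1 := revProd_eq_removeNth e a ha j
  have hR2 := revProd_eq_removeNth (j.removeNth e) (j.removeNth a) (fun k => ha _) i
  have hprod : ∏ k ∈ Finset.Iio i, koszul (j.removeNth e i) (j.removeNth e k) =
      ∏ k ∈ Finset.Iio i.castSucc, koszul (e i.castSucc) (e k) := by
    rw [Fin.prod_Iio_castSucc']
    refine Finset.prod_congr rfl fun k hk => ?_
    have hk' : j.succAbove k = k.castSucc :=
      Fin.succAbove_of_castSucc_lt j k ((Fin.castSucc_lt_castSucc_iff.2 (Finset.mem_Iio.1 hk)).trans hij)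
    simp only [Fin.removeNth, hsa, hk']
  have hai : j.removeNth a i = a i.castSucc := by simp only [Fin.removeNth, hsa]
  rw [hprod, hai] at hR2
  rw [hR1, hR2, revProd_cons, smul_mul_assoc, mul_assoc, grPart_commute (ha i.castSucc) (ha j),
    mul_smul_comm]
  simp only [smul_smul]
  -- Each sign occurs twice, once in `cobdSign` and once from reordering the coefficients.
  have hsq : ∀ s : Finset (Fin (m + 2)), ∀ c, (∏ k ∈ s, koszul c (e k)) * ∏ k ∈ s, koszul c (e k) = 1 := by
    intro s c
    rw [← Finset.prod_mul_distrib]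
    exact Finset.prod_eq_one fun k _ => koszul_mul_self _ _
  congr 1
  rw [cobdSign]
  have h1 := hsq (Finset.Iio i.castSucc) (e i.castSucc)
  have h2 := hsq (Finset.Iio j) (e j)
  have h3 := koszul_mul_self (e i.castSucc) (e j)
  set A := ∏ k ∈ Finset.Iio i.castSucc, koszul (e i.castSucc) (e k)
  set B := ∏ k ∈ Finset.Iio j, koszul (e j) (e k)
  set K := koszul (e i.castSucc) (e j)
  set w := ω (Fin.cons (L.bracket (v i.castSucc) (v j)) fun k => v (j.succAbove (i.succAbove k)))
  simp only [Fin.val_castSucc]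
  calc _ = (-1 : ℝ) ^ ((i : ℕ) + (j : ℕ)) * w * ((A * A) * (B * B) * (K * K)) := by ring
    _ = _ := by rw [h1, h2, h3]; ring

/-- The cochain `ω_A` as an alternating map. -/
noncomputable def cochainAlt {p : ℕ} (ω : L.evenCochains p) (q : ℕ) :
    (L.Points q) [⋀^Fin p]→ₗ[ℝ] (GrEven q) where
  toFun := L.cochainOnPoints ω q
  map_update_add' {_} x i a b := by
    refine Subtype.ext ?_
    have h : ∀ y : Fin p → L.Points q, (L.cochainOnPoints ω q y).1 =
      (tensorExtend ω.1 q).compLinearMap (fun _ => L.pointsVal q) y := fun _ => rfl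
    exact (by rw [h, MultilinearMap.map_update_add]; rfl)
  map_update_smul' {_} x i c a := by
    refine Subtype.ext ?_
    have h : ∀ y : Fin p → L.Points q, (L.cochainOnPoints ω q y).1 =
      (tensorExtend ω.1 q).compLinearMap (fun _ => L.pointsVal q) y := fun _ => rfl
    exact (by rw [h, MultilinearMap.map_update_smul]; rfl)
  map_eq_zero_of_eq' x i j hx hij := by
    refine Subtype.ext ?_
    refine MultilinearMap.map_eq_zero_of_adjacent
      ((tensorExtend ω.1 q).compLinearMap fun _ => L.pointsVal q) ?_ x i j hx hij
    intro i j hij x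
    exact L.tensorExtend_swap ω.2 q i j hij fun k => (x k).2

/-- The Chevalley-Eilenberg coboundary of `ω_A`. -/
noncomputable def pointsCobd {m : ℕ} (ω : L.evenCochains (m + 1)) (q : ℕ)
    (x : Fin (m + 2) → L.Points q) : GrEven q :=
  ∑ j : Fin (m + 2), ∑ i : Fin (m + 1) with i.castSucc < j,
    (-1 : ℝ) ^ ((i : ℕ) + (j : ℕ)) • L.cochainOnPoints ω q
      (Fin.cons ⁅x i.castSucc, x j⁆ fun k => x (j.succAbove (i.succAbove k)))

theorem coe_pointsCobd {m : ℕ} (ω : L.evenCochains (m + 1)) (q : ℕ)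
    (x : Fin (m + 2) → L.Points q) :
    (L.pointsCobd ω q x : Gr q) = tensorExtend (L.cobd ω.1) q fun k => L.pointsVal q (x k) := by
  rw [L.tensorExtend_cobd ω.1 q (x := fun k => L.pointsVal q (x k)) fun k => (x k).2]
  have h : ∀ a : GrEven q, (a : Gr q) = (CliffordAlgebra.even _).val a := fun _ => rfl
  rw [pointsCobd, h, map_sum]
  refine Finset.sum_congr rfl fun j _ => ?_
  rw [map_sum]
  refine Finset.sum_congr rfl fun i _ => ?_
  rw [map_smul]
  congr 1
  change tensorExtend ω.1 q _ = _
  congr 1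
  funext k
  induction k using Fin.cases with
  | zero => rfl
  | succ k => rfl

end LieSuperalgebra

/-! ### Detecting cochain identities on Grassmann generators -/

theorem list_prod_ι_ne_zero {q : ℕ} (l : List (Fin q)) (hl : l.Nodup) :
    (l.map fun i => (ExteriorAlgebra.ι ℝ (Pi.single i 1 : Fin q → ℝ) : Gr q)).prod ≠ 0 := by
  intro h
  have h1 : ExteriorAlgebra.ιMulti ℝ l.length (fun k => (Pi.single (l.get k) 1 : Fin q → ℝ)) = 0 := by
    rw [ExteriorAlgebra.ιMulti_apply, ← h]
    congr 1
    conv_rhs => rw [← List.ofFn_get l, List.map_ofFn]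
    rfl
  -- The minor at the coordinates in `l` defines a functional on the exterior algebra which takes
  -- the value `1` on the product of these generators.
  set D : (Fin q → ℝ) [⋀^Fin l.length]→ₗ[ℝ] ℝ :=
    (Matrix.detRowAlternating (n := Fin l.length) (R := ℝ)).compLinearMap
      (LinearMap.funLeft ℝ ℝ l.get) with hD
  set F : ∀ i, (Fin q → ℝ) [⋀^Fin i]→ₗ[ℝ] ℝ := Function.update (fun _ => 0) l.length D with hF
  have h2 := congrArg (ExteriorAlgebra.liftAlternating F) h1
  rw [ExteriorAlgebra.liftAlternating_apply_ιMulti, map_zero, hF, Function.update_self, hD] at h2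
  have h3 : (Matrix.of fun k : Fin l.length =>
      LinearMap.funLeft ℝ ℝ l.get (Pi.single (l.get k) 1 : Fin q → ℝ)) = 1 := by
    ext k m
    simp only [Matrix.of_apply, LinearMap.funLeft_apply, Matrix.one_apply, Pi.single_apply]
    refine if_congr ?_ rfl rfl
    rw [hl.injective_get.eq_iff, eq_comm]
  have h4 : Matrix.det (Matrix.of fun k : Fin l.length =>
      LinearMap.funLeft ℝ ℝ l.get (Pi.single (l.get k) 1 : Fin q → ℝ)) = 0 := h2
  rw [h3, Matrix.det_one] at h4
  exact one_ne_zero h4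

theorem revProd_generators_ne_zero {q : ℕ} (e : Fin q → ZMod 2) :
    revProd (fun k => if e k = 0 then (1 : Gr q) else ExteriorAlgebra.ι ℝ (Pi.single k 1)) ≠ 0 := by
  have h : ∀ l : List (Fin q),
      (l.map fun k => if e k = 0 then (1 : Gr q) else ExteriorAlgebra.ι ℝ (Pi.single k 1)).prod =
        ((l.filter fun k => e k ≠ 0).map fun i =>
          (ExteriorAlgebra.ι ℝ (Pi.single i 1 : Fin q → ℝ) : Gr q)).prod := by
    intro l
    induction l with
    | nil => rfl
    | cons a l ih =>
      rw [List.map_cons, List.prod_cons, ih, List.filter_cons]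
      by_cases ha : e a = 0 <;> simp [ha]
  rw [revProd, List.ofFn_eq_map, ← List.map_reverse, h]
  exact list_prod_ι_ne_zero _ ((List.nodup_reverse.2 (List.nodup_finRange q)).filter _)

namespace LieSuperalgebra

variable {𝔫 : Type*} [AddCommGroup 𝔫] [Module ℝ 𝔫] (L : LieSuperalgebra 𝔫)
  [FiniteDimensional ℝ 𝔫]

/-- A single Grassmann algebra suffices to recover a super identity from its version on points: each
odd argument gets its own generator as coefficient, and the product of these is nonzero, so real
coefficients can be compared. -/
theorem cobd_mem_of_pointsCobd_swap {m : ℕ} (ω : L.evenCochains (m + 1))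
    (h : ∀ (q : ℕ) (i j : Fin (m + 2)), i ≠ j → ∀ x : Fin (m + 2) → L.Points q,
      L.pointsCobd ω q (x ∘ Equiv.swap i j) = -L.pointsCobd ω q x) :
    L.cobd ω.1 ∈ L.evenCochains (m + 2) := by
  refine ⟨fun i j hij e X hX => ?_, fun e X hX he => L.cobd_parity ω.2 e X hX he⟩
  set a : Fin (m + 2) → Gr (m + 2) :=
    fun k => if e k = 0 then 1 else ExteriorAlgebra.ι ℝ (Pi.single k 1) with ha
  have hmem : ∀ k, a k ∈ grPart (m + 2) (e k) := by
    intro k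
    have h2 : ∀ i : ZMod 2, i ≠ 0 → i = 1 := by decide
    by_cases hk : e k = 0
    · simp only [ha, hk, if_true]
      exact mem_even_iff.1 (Subalgebra.one_mem _)
    · simp only [ha, hk, if_false]
      rw [h2 _ hk]
      exact CliffordAlgebra.ι_mem_evenOdd_one _ _
  set x : Fin (m + 2) → L.Points (m + 2) := fun k =>
    ⟨a k ⊗ₜ X k, Submodule.subset_span ⟨e k, a k, hmem k, X k, hX k, rfl⟩⟩ with hx
  have h1 := congrArg Subtype.val (h (m + 2) i j (by rintro rfl; omega) x)
  have h2 : ((-L.pointsCobd ω (m + 2) x : GrEven (m + 2)) : Gr (m + 2)) =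
    -(L.pointsCobd ω (m + 2) x : Gr (m + 2)) := rfl
  rw [h2, coe_pointsCobd, coe_pointsCobd] at h1
  have h3 : ∀ σ : Equiv.Perm (Fin (m + 2)),
      tensorExtend (L.cobd ω.1) (m + 2) (fun k => L.pointsVal _ ((x ∘ σ) k)) =
        L.cobd ω.1 (X ∘ σ) • revProd (a ∘ σ) := fun σ =>
    tensorExtend_tmul (L.cobd ω.1) (m + 2) (a ∘ σ) (X ∘ σ)
  have h4 := h3 1
  simp only [Equiv.Perm.coe_one, Function.comp_id] at h4
  rw [h3, h4, revProd_comp_swap e a hmem i j hij, smul_smul, ← neg_smul] at h1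
  have h5 := smul_left_injective ℝ (revProd_generators_ne_zero e) h1
  have h6 := koszul_mul_self (e i) (e j)
  have h7 : L.cobd ω.1 (X ∘ Equiv.swap i j) * (koszul (e i) (e j) * koszul (e i) (e j)) =
      -L.cobd ω.1 X * koszul (e i) (e j) := by
    rw [← h5]; ring
  rw [h6] at h7
  linarith

end LieSuperalgebra

/-! ## `A₀`-smooth maps -/

theorem MultilinearMap.continuous_of_finiteDimensional' {ι V W : Type*} [Fintype ι]
    [NormedAddCommGroup V] [NormedSpace ℝ V] [FiniteDimensional ℝ V]
    [NormedAddCommGroup W] [NormedSpace ℝ W] (f : MultilinearMap ℝ (fun _ : ι => V) W) :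
    Continuous f := by
  classical
  set b := Module.finBasis ℝ V
  have h : ∀ v, f v = ∑ c : ι → Fin (Module.finrank ℝ V),
      (∏ i, b.coord (c i) (v i)) • f fun i => b (c i) := by
    intro v
    have hv : v = fun k => ∑ c, b.coord c (v k) • b c := by
      funext k
      exact (b.sum_repr (v k)).symm
    conv_lhs => rw [hv, f.map_sum]
    exact Finset.sum_congr rfl fun c _ => f.map_smul_univ _ _
  rw [funext h]
  refine continuous_finsetSum _ fun c _ => Continuous.smul ?_ continuous_const
  exact continuous_finsetProd _ fun i _ =>
    (LinearMap.continuous_of_finiteDimensional (b.coord (c i))).comp (continuous_apply i)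

namespace A0Smooth

section

variable {q : ℕ} {V W U : Type*} [NormedAddCommGroup V] [NormedSpace ℝ V] [Module (GrEven q) V]
    [NormedAddCommGroup W] [NormedSpace ℝ W] [Module (GrEven q) W]
    [NormedAddCommGroup U] [NormedSpace ℝ U] [Module (GrEven q) U]

theorem differentiable {f : V → W} (hf : A0Smooth q f) : Differentiable ℝ f :=
  hf.1.differentiable (by simp)

protected theorem const (c : W) : A0Smooth q fun _ : V => c :=
  ⟨contDiff_const, fun x a v => by simp⟩

protected theorem clm (f : V →L[ℝ] W) (h : ∀ (a : GrEven q) v, f (a • v) = a • f v) :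
    A0Smooth q f :=
  ⟨f.contDiff, fun x a v => by simp [h]⟩

protected theorem id : A0Smooth q fun x : V => x :=
  A0Smooth.clm (ContinuousLinearMap.id ℝ V) fun _ _ => rfl

theorem comp {g : W → U} {f : V → W} (hg : A0Smooth q g) (hf : A0Smooth q f) :
    A0Smooth q fun x => g (f x) := by
  refine ⟨hg.1.comp hf.1, fun x a v => ?_⟩
  have h : fderiv ℝ (fun x => g (f x)) x = (fderiv ℝ g (f x)).comp (fderiv ℝ f x) :=
    fderiv_comp x (hg.differentiable _) (hf.differentiable _)
  simp [h, hf.2, hg.2]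

theorem prodMk {f : V → W} {g : V → U} (hf : A0Smooth q f) (hg : A0Smooth q g) :
    A0Smooth q fun x => (f x, g x) := by
  refine ⟨hf.1.prodMk hg.1, fun x a v => ?_⟩
  rw [(hf.differentiable x).fderiv_prodMk (hg.differentiable x)]
  simp [hf.2, hg.2]

protected theorem fst {f : V → W × U} (hf : A0Smooth q f) : A0Smooth q fun x => (f x).1 :=
  (A0Smooth.clm (ContinuousLinearMap.fst ℝ W U) fun _ _ => rfl).comp hf

protected theorem snd {f : V → W × U} (hf : A0Smooth q f) : A0Smooth q fun x => (f x).2 :=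
  (A0Smooth.clm (ContinuousLinearMap.snd ℝ W U) fun _ _ => rfl).comp hf

protected theorem pi {ι : Type*} [Fintype ι] {f : V → ι → W}
    (hf : ∀ i, A0Smooth q fun x => f x i) : A0Smooth q f := by
  refine ⟨contDiff_pi.2 fun i => (hf i).1, fun x a v => ?_⟩
  have h : fderiv ℝ f x = ContinuousLinearMap.pi fun i => fderiv ℝ (fun x => f x i) x :=
    fderiv_pi fun i => (hf i).differentiable x
  funext i
  simp [h, (hf i).2]

protected theorem eval {ι : Type*} [Fintype ι] (i : ι) : A0Smooth q fun x : ι → W => x i :=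
  A0Smooth.clm (ContinuousLinearMap.proj i : (ι → W) →L[ℝ] W) fun _ _ => rfl

protected theorem add {f g : V → W} (hf : A0Smooth q f) (hg : A0Smooth q g) :
    A0Smooth q fun x => f x + g x := by
  refine ⟨hf.1.add hg.1, fun x a v => ?_⟩
  rw [fderiv_fun_add (hf.differentiable x) (hg.differentiable x)]
  simp [hf.2, hg.2]

protected theorem neg {f : V → W} (hf : A0Smooth q f) : A0Smooth q fun x => -f x := by
  refine ⟨hf.1.neg, fun x a v => ?_⟩
  rw [fderiv_fun_neg]
  simp [hf.2]

protected theorem sum {ι : Type*} {s : Finset ι} {f : ι → V → W}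
    (hf : ∀ i ∈ s, A0Smooth q (f i)) : A0Smooth q fun x => ∑ i ∈ s, f i x := by
  classical
  induction s using Finset.induction_on with
  | empty => simpa using A0Smooth.const 0
  | insert i s hi ih =>
    simp only [Finset.sum_insert hi]
    exact (hf i (Finset.mem_insert_self i s)).add
      (ih fun j hj => hf j (Finset.mem_insert_of_mem hj))

theorem const_smul [SMulCommClass ℝ (GrEven q) W] {f : V → W} (hf : A0Smooth q f) (c : ℝ) :
    A0Smooth q fun x => c • f x := by
  refine ⟨hf.1.const_smul c, fun x a v => ?_⟩
  rw [fderiv_fun_const_smul (hf.differentiable x)]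
  simp [hf.2, smul_comm c a]

theorem bilin {u : Type*} [NormedAddCommGroup u] [NormedSpace ℝ u] [Module (GrEven q) u]
    (B : W →L[ℝ] U →L[ℝ] u) (hl : ∀ (a : GrEven q) x y, B (a • x) y = a • B x y)
    (hr : ∀ (a : GrEven q) x y, B x (a • y) = a • B x y) {f : V → W} {g : V → U}
    (hf : A0Smooth q f) (hg : A0Smooth q g) : A0Smooth q fun x => B (f x) (g x) := by
  refine ⟨(B.contDiff.comp hf.1).clm_apply hg.1, fun x a v => ?_⟩
  have h := (B.hasFDerivAt_of_bilinear (hf.differentiable x).hasFDerivAt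
    (hg.differentiable x).hasFDerivAt).fderiv
  rw [h]
  change B (f x) (fderiv ℝ g x (a • v)) + B (fderiv ℝ f x (a • v)) (g x) =
    a • (B (f x) (fderiv ℝ g x v) + B (fderiv ℝ f x v) (g x))
  rw [hf.2, hg.2, hl, hr, smul_add]

theorem multilinear {ι : Type*} [Fintype ι] [DecidableEq ι]
    (f : ContinuousMultilinearMap ℝ (fun _ : ι => W) U)
    (h : ∀ (a : GrEven q) x i, f (Function.update x i (a • x i)) = a • f x) :
    A0Smooth q f := by
  refine ⟨f.contDiff, fun x a v => ?_⟩
  rw [(f.hasFDerivAt x).fderiv, ContinuousMultilinearMap.linearDeriv_apply,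
    ContinuousMultilinearMap.linearDeriv_apply, Finset.smul_sum]
  refine Finset.sum_congr rfl fun i _ => ?_
  have := h a (Function.update x i (v i)) i
  simpa using this

/-- The tangent map of an `A₀`-smooth map is `A₀`-smooth. -/
theorem tangent [FiniteDimensional ℝ W] [SMulCommClass ℝ (GrEven q) W] {f : V → W} (hf : A0Smooth q f) :
    A0Smooth q fun z : V × V => fderiv ℝ f z.1 z.2 := by
  have hf' : ContDiff ℝ ((⊤ : ℕ∞) : WithTop ℕ∞) (fderiv ℝ f) :=
    hf.1.fderiv_right (by simp)
  have hd : Differentiable ℝ (fderiv ℝ f) := hf'.differentiable (by simp)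
  refine ⟨(hf'.comp contDiff_fst).clm_apply contDiff_snd, ?_⟩
  have key : ∀ (z : V × V) (v : V × V), fderiv ℝ (fun z : V × V => fderiv ℝ f z.1 z.2) z v =
      fderiv ℝ f z.1 v.2 + fderiv ℝ (fderiv ℝ f) z.1 v.1 z.2 := by
    intro z v
    have h1 : HasFDerivAt (fun z : V × V => fderiv ℝ f z.1)
        ((fderiv ℝ (fderiv ℝ f) z.1).comp (ContinuousLinearMap.fst ℝ V V)) z :=
      (hd z.1).hasFDerivAt.comp z hasFDerivAt_fst
    rw [(h1.clm_apply hasFDerivAt_snd).fderiv]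
    simp
  have hsymm : ∀ x v w : V, fderiv ℝ (fderiv ℝ f) x v w = fderiv ℝ (fderiv ℝ f) x w v := by
    intro x
    exact hf.1.contDiffAt.isSymmSndFDerivAt (by
      rw [minSmoothness_of_isRCLikeNormedField]
      exact WithTop.coe_le_coe.2 le_top)
  -- Differentiating the `A₀`-linearity of the first derivative in the base point gives linearity of
  -- the second derivative in its second slot. Symmetry transfers it to the first slot.
  have hlin : ∀ (a : GrEven q) (x v w : V),
      fderiv ℝ (fderiv ℝ f) x w (a • v) = a • fderiv ℝ (fderiv ℝ f) x w v := by
    intro a x v w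
    have h1 : ∀ v, fderiv ℝ (fun y => fderiv ℝ f y v) x w = fderiv ℝ (fderiv ℝ f) x w v := by
      intro v
      rw [((hd x).hasFDerivAt.clm_apply (hasFDerivAt_const v x)).fderiv]
      simp
    rw [← h1, ← h1]
    have := SMulCommClass.symm ℝ (GrEven q) W
    let T : W →L[ℝ] W := (DistribSMul.toLinearMap ℝ W a).toContinuousLinearMap
    have hT : (fun y => fderiv ℝ f y (a • v)) = T ∘ fun y => fderiv ℝ f y v := by
      funext y
      exact hf.2 y a v
    rw [hT, (T.hasFDerivAt.comp x
      ((hd x).clm_apply (differentiableAt_const v)).hasFDerivAt).fderiv]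
    rfl
  intro z a v
  rw [key, key]
  change fderiv ℝ f z.1 (a • v.2) + fderiv ℝ (fderiv ℝ f) z.1 (a • v.1) z.2 = _
  rw [hf.2, smul_add, hsymm _ (a • v.1), hlin, hsymm _ z.2]

end

end A0Smooth

/-- Even elements are central, which is what makes the bracket and the forms `A₀`-multilinear. -/
theorem grEven_commute {q : ℕ} (a : GrEven q) (b : Gr q) : (a : Gr q) * b = b * (a : Gr q) := by
  induction b using ExteriorAlgebra.induction with
  | algebraMap r => exact (Algebra.commutes r _).symm
  | ι v => simpa [koszul] using grPart_mul_ι (mem_even_iff.1 a.2) v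
  | mul x y hx hy => rw [← mul_assoc, hx, mul_assoc, hy, mul_assoc]
  | add x y hx hy => rw [mul_add, hx, hy, add_mul]

namespace LieSuperalgebra

variable {𝔫 : Type*} [AddCommGroup 𝔫] [Module ℝ 𝔫] (L : LieSuperalgebra 𝔫)

instance Points.instSMulCommClass (q : ℕ) : SMulCommClass ℝ (GrEven q) (L.Points q) where
  smul_comm c a x := Subtype.ext (smul_comm c (a : Gr q) x.1)

theorem smul_lie_points {q : ℕ} (a : GrEven q) (x y : L.Points q) : ⁅a • x, y⁆ = a • ⁅x, y⁆ := by
  have h : ∀ x y : Gr q ⊗[ℝ] 𝔫,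
      L.tensorBracket q ((a : Gr q) • x) y = (a : Gr q) • L.tensorBracket q x y := by
    intro x y
    induction x using TensorProduct.induction_on with
    | zero => simp
    | add x x' hx hx' => simp only [smul_add, map_add, LinearMap.add_apply, hx, hx']
    | tmul b v =>
      induction y using TensorProduct.induction_on with
      | zero => simp
      | add y y' hy hy' => simp only [smul_add, map_add, hy, hy']
      | tmul c w =>
        rw [TensorProduct.smul_tmul', tensorBracket_tmul, tensorBracket_tmul,
          TensorProduct.smul_tmul', smul_eq_mul, smul_eq_mul]
        rw [← mul_assoc, ← grEven_commute a c, mul_assoc]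
  exact Subtype.ext (h x.1 y.1)

theorem lie_smul_points {q : ℕ} (a : GrEven q) (x y : L.Points q) : ⁅x, a • y⁆ = a • ⁅x, y⁆ := by
  rw [← lie_skew, smul_lie_points, ← smul_neg, lie_skew]

/-- The range `N + 3` ensures that the terms of degree `0`, `1` and `2` can always be split off. -/
theorem IsNilpotent.mul_eq_sum {L : LieSuperalgebra 𝔫} (hL : L.IsNilpotent) : ∃ N : ℕ, ∀ (q : ℕ) (x y : L.Points q),
    L.mul x y = ∑ n ∈ Finset.range (N + 3), bchTerm (fun a b : L.Points q => ⁅a, b⁆) x y n := by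
  obtain ⟨N, hN⟩ := hL.bchTerm_eq_zero
  refine ⟨N, fun q x y => finsum_eq_sum_of_support_subset _ fun n hn => ?_⟩
  rw [Finset.coe_range, Set.mem_Iio]
  by_contra h
  exact hn (hN q x y n (by omega))

variable [FiniteDimensional ℝ 𝔫]

section Smooth

variable {L} {q : ℕ} {V : Type*} [NormedAddCommGroup V] [NormedSpace ℝ V] [Module (GrEven q) V]

theorem A0Smooth_lie {f g : V → L.Points q} (hf : A0Smooth q f) (hg : A0Smooth q g) :
    A0Smooth q fun x => ⁅f x, g x⁆ :=
  A0Smooth.bilin (LinearMap.toContinuousBilinearMap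
    (LinearMap.mk₂ ℝ (fun x y : L.Points q => ⁅x, y⁆) add_lie smul_lie lie_add
      fun c x y => lie_smul c x y)) (fun a x y => L.smul_lie_points a x y)
      (fun a x y => L.lie_smul_points a x y) hf hg

theorem A0Smooth_nestedBracket : ∀ l : List (V → L.Points q), (∀ f ∈ l, A0Smooth q f) →
    A0Smooth q fun z => nestedBracket (fun a b : L.Points q => ⁅a, b⁆) (l.map fun f => f z)
  | [], _ => A0Smooth.const 0
  | [f], h => h f (by simp)
  | f :: g :: l, h => A0Smooth_lie (h f (by simp))
      (A0Smooth_nestedBracket (g :: l) fun f' hf => h f' (List.mem_cons_of_mem f hf))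

theorem A0Smooth_bchTerm {f g : V → L.Points q} (hf : A0Smooth q f) (hg : A0Smooth q g) (n : ℕ) :
    A0Smooth q fun z => bchTerm (fun a b : L.Points q => ⁅a, b⁆) (f z) (g z) n := by
  simp only [bchTerm_eq_sum_dynkinTuples _ _ _ (le_refl n)]
  refine A0Smooth.const_smul (A0Smooth.sum fun k _ => A0Smooth.const_smul
    (A0Smooth.sum fun e _ => A0Smooth.const_smul ?_ _) _) _
  have h : ∀ z, dynkinWord e (f z) (g z) = (dynkinWord e f g).map fun f => f z := fun z =>
    (map_dynkinWord e f g fun f => f z).symm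
  simp only [h]
  refine A0Smooth_nestedBracket _ fun f' hf' => ?_
  rcases mem_dynkinWord hf' with rfl | rfl <;> assumption

end Smooth

variable {L}

theorem IsNilpotent.A0Smooth_mul (hL : L.IsNilpotent) {q : ℕ} {V : Type*} [NormedAddCommGroup V]
    [NormedSpace ℝ V] [Module (GrEven q) V] {f g : V → L.Points q} (hf : A0Smooth q f)
    (hg : A0Smooth q g) : A0Smooth q fun z => L.mul (f z) (g z) := by
  obtain ⟨N, hN⟩ := hL.mul_eq_sum
  simp only [hN]
  exact A0Smooth.sum fun n _ => A0Smooth_bchTerm hf hg n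

theorem IsNilpotent.A0Smooth_mul_uncurry (hL : L.IsNilpotent) (q : ℕ) :
    A0Smooth q fun z : L.Points q × L.Points q => L.mul z.1 z.2 :=
  hL.A0Smooth_mul (A0Smooth.fst A0Smooth.id) (A0Smooth.snd A0Smooth.id)

end LieSuperalgebra

namespace LieSuperalgebra

variable {𝔫 : Type*} [AddCommGroup 𝔫] [Module ℝ 𝔫] (L : LieSuperalgebra 𝔫)
  [FiniteDimensional ℝ 𝔫]

/-! ## The Maurer-Cartan form -/

/-- The left Maurer-Cartan form of the group `N_A`. -/
noncomputable def maurerCartan (q : ℕ) (g : L.Points q) : L.Points q →L[ℝ] L.Points q :=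
  fderiv ℝ (fun h : L.Points q => L.mul (-g) h) g

/-- The left-invariant vector field on `N_A` with value `x` at the identity. -/
noncomputable def leftInvField {q : ℕ} (x g : L.Points q) : L.Points q :=
  fderiv ℝ (fun h : L.Points q => L.mul g h) 0 x

variable {L}

theorem IsNilpotent.contDiff_mul (hL : L.IsNilpotent) (q : ℕ) :
    ContDiff ℝ ((⊤ : ℕ∞) : WithTop ℕ∞) fun z : L.Points q × L.Points q => L.mul z.1 z.2 :=
  (hL.A0Smooth_mul_uncurry q).1

theorem IsNilpotent.contDiff_mul_left (hL : L.IsNilpotent) {q : ℕ} (g : L.Points q) :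
    ContDiff ℝ ((⊤ : ℕ∞) : WithTop ℕ∞) fun h : L.Points q => L.mul g h :=
  (hL.A0Smooth_mul (A0Smooth.const g) A0Smooth.id).1

theorem IsNilpotent.differentiable_mul_left (hL : L.IsNilpotent) {q : ℕ} (g : L.Points q) :
    Differentiable ℝ fun h : L.Points q => L.mul g h :=
  (hL.contDiff_mul_left g).differentiable (by simp)

/-- Expressed through the tangent map of the joint multiplication, the derivative of a left
translation is visibly smooth in the translating element as well. -/
theorem IsNilpotent.fderiv_mul_left (hL : L.IsNilpotent) {q : ℕ} (g h v : L.Points q) :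
    fderiv ℝ (fun h : L.Points q => L.mul g h) h v =
      fderiv ℝ (fun z : L.Points q × L.Points q => L.mul z.1 z.2) (g, h) (0, v) := by
  have h1 : HasFDerivAt (fun h : L.Points q => (g, h))
      (ContinuousLinearMap.inr ℝ (L.Points q) (L.Points q)) h := hasFDerivAt_prodMk_right g h
  have h2 := ((hL.contDiff_mul q).differentiable (by simp) (g, h)).hasFDerivAt.comp h h1
  exact (congrArg (fun T => T v) h2.fderiv).trans rfl

theorem IsNilpotent.A0Smooth_fderiv_mul (hL : L.IsNilpotent) {q : ℕ} {V : Type*}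
    [NormedAddCommGroup V] [NormedSpace ℝ V] [Module (GrEven q) V] {f g u : V → L.Points q}
    (hf : A0Smooth q f) (hg : A0Smooth q g) (hu : A0Smooth q u) :
    A0Smooth q fun x => fderiv ℝ (fun h : L.Points q => L.mul (f x) h) (g x) (u x) := by
  simp only [hL.fderiv_mul_left]
  exact (hL.A0Smooth_mul_uncurry q).tangent.comp
    ((hf.prodMk hg).prodMk ((A0Smooth.const 0).prodMk hu))

theorem IsNilpotent.A0Smooth_maurerCartan (hL : L.IsNilpotent) {q : ℕ} {V : Type*}
    [NormedAddCommGroup V] [NormedSpace ℝ V] [Module (GrEven q) V] {g u : V → L.Points q}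
    (hg : A0Smooth q g) (hu : A0Smooth q u) :
    A0Smooth q fun x => L.maurerCartan q (g x) (u x) :=
  hL.A0Smooth_fderiv_mul hg.neg hg hu

/-- Left invariance of the Maurer-Cartan form: translation by the inverse of `h` is translation by
`g` followed by translation by the inverse of `g h`. -/
theorem IsNilpotent.maurerCartan_mul (hL : L.IsNilpotent) {q : ℕ} (g h : L.Points q) :
    L.maurerCartan q h = (L.maurerCartan q (L.mul g h)).comp
      (fderiv ℝ (fun k : L.Points q => L.mul g k) h) := by
  have h1 : (fun k : L.Points q => L.mul (-h) k) =
      (fun k : L.Points q => L.mul (-L.mul g h) k) ∘ fun k => L.mul g k := by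
    funext k
    simp only [Function.comp_apply]
    rw [hL.neg_mul, hL.mul_assoc, hL.neg_mul_cancel]
  rw [maurerCartan, h1, fderiv_comp h (hL.differentiable_mul_left _ _)
    (hL.differentiable_mul_left _ _), maurerCartan]

theorem maurerCartan_zero (q : ℕ) : L.maurerCartan q 0 = ContinuousLinearMap.id ℝ _ := by
  have h : (fun h : L.Points q => L.mul (-0) h) = id := by
    funext h
    rw [neg_zero, zero_mul_left, id]
  rw [maurerCartan, h, fderiv_id]

theorem IsNilpotent.maurerCartan_leftInvField (hL : L.IsNilpotent) {q : ℕ} (x g : L.Points q) :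
    L.maurerCartan q g (L.leftInvField x g) = x := by
  have h := congrArg (fun T => T x) (hL.maurerCartan_mul g (0 : L.Points q))
  rw [mul_zero_right] at h
  exact h.symm.trans (by rw [maurerCartan_zero]; rfl)

theorem leftInvField_zero {q : ℕ} (x : L.Points q) : L.leftInvField x 0 = x := by
  have h : (fun h : L.Points q => L.mul 0 h) = id := by
    funext h
    rw [zero_mul_left, id]
  rw [leftInvField, h, fderiv_id]
  rfl

theorem IsNilpotent.differentiable_leftInvField (hL : L.IsNilpotent) {q : ℕ} (x : L.Points q) :
    Differentiable ℝ (L.leftInvField x) :=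
  (hL.A0Smooth_fderiv_mul A0Smooth.id (A0Smooth.const 0) (A0Smooth.const x)).differentiable

/-- Along each line through the origin `G` is a constant times `c ^ m` with `m ≥ 2`. -/
theorem hasFDerivAt_of_homogeneous {V W : Type*} [NormedAddCommGroup V] [NormedSpace ℝ V]
    [NormedAddCommGroup W] [NormedSpace ℝ W] {G : V → W} (hG : DifferentiableAt ℝ G 0) {m : ℕ}
    (hm : 2 ≤ m) (h : ∀ (c : ℝ) (v : V), c ≠ 0 → G (c • v) = c ^ m • G v) :
    fderiv ℝ G 0 = 0 := by
  ext v
  have h1 : HasDerivAt (fun c : ℝ => G (c • v)) (fderiv ℝ G 0 v) 0 := by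
    have h2 : HasDerivAt (fun c : ℝ => c • v) v 0 := by
      simpa using (hasDerivAt_id (0 : ℝ)).smul_const v
    have h3 : HasFDerivAt G (fderiv ℝ G 0) ((0 : ℝ) • v) := by
      rw [zero_smul]
      exact hG.hasFDerivAt
    exact h3.comp_hasDerivAt 0 h2
  have h0 : G 0 = 0 := by
    have h2 := h 2 0 two_ne_zero
    rw [smul_zero] at h2
    have h4 : ((2 : ℝ) ^ m - 1) • G 0 = 0 := by rw [sub_smul, one_smul, ← h2, sub_self]
    refine (smul_eq_zero.1 h4).resolve_left ?_
    have : (1 : ℝ) < 2 ^ m := one_lt_pow₀ (by norm_num) (by omega)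
    linarith
  have h2 : (fun c : ℝ => G (c • v)) = fun c => c ^ m • G v := by
    funext c
    rcases eq_or_ne c 0 with rfl | hc
    · rw [zero_smul, h0, zero_pow (by omega), zero_smul]
    · exact h c v hc
  have h3 : HasDerivAt (fun c : ℝ => c ^ m • G v) 0 0 := by
    have := (hasDerivAt_pow m (0 : ℝ)).smul_const (G v)
    rwa [zero_pow (by omega), mul_zero, zero_smul] at this
  rw [h2] at h1
  exact h1.unique h3

/-- Only the part of the series that is linear in both factors contributes, and this is half the
bracket. Antisymmetrizing yields the Lie bracket of left-invariant fields at the identity. -/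
theorem IsNilpotent.fderiv_leftInvField (hL : L.IsNilpotent) {q : ℕ} (x y : L.Points q) :
    fderiv ℝ (L.leftInvField x) 0 y = (2 : ℝ)⁻¹ • ⁅y, x⁆ := by
  obtain ⟨N, hN⟩ := hL.mul_eq_sum
  have hsm : ∀ n, A0Smooth q fun z : L.Points q × L.Points q =>
      bchTerm (fun a b : L.Points q => ⁅a, b⁆) z.1 z.2 n := fun n =>
    A0Smooth_bchTerm (A0Smooth.fst A0Smooth.id) (A0Smooth.snd A0Smooth.id) n
  have hsm2 : ∀ n (g : L.Points q), Differentiable ℝ fun h : L.Points q =>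
      bchTerm (fun a b : L.Points q => ⁅a, b⁆) g h n := fun n g =>
    (A0Smooth_bchTerm (A0Smooth.const g) A0Smooth.id n).differentiable
  set T : ℕ → L.Points q → L.Points q := fun n g =>
    fderiv ℝ (fun h => bchTerm (fun a b : L.Points q => ⁅a, b⁆) g h n) 0 x with hT
  have hTd : ∀ n, Differentiable ℝ (T n) := by
    intro n
    have h : T n = fun g => fderiv ℝ (fun z : L.Points q × L.Points q =>
        bchTerm (fun a b : L.Points q => ⁅a, b⁆) z.1 z.2 n) (g, 0) (0, x) := by
      funext g
      have h2 := ((hsm n).differentiable (g, 0)).hasFDerivAt.comp (0 : L.Points q)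
        (hasFDerivAt_prodMk_right g 0)
      exact (congrArg (fun T => T x) h2.fderiv).trans rfl
    rw [h]
    exact ((hsm n).tangent.comp ((A0Smooth.id.prodMk (A0Smooth.const 0)).prodMk
      ((A0Smooth.const 0).prodMk (A0Smooth.const x)))).differentiable
  have hV : L.leftInvField x = fun g => ∑ n ∈ Finset.range (N + 3), T n g := by
    funext g
    rw [leftInvField, funext (hN q g), fderiv_fun_sum fun n _ => hsm2 n g 0]
    simp [hT]
  have h0 : T 0 = fun _ => 0 := by
    funext g
    simp only [hT, bchTerm_zero]
    simp
  have h1 : T 1 = fun _ => x := by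
    funext g
    simp only [hT, bchTerm_one]
    rw [fderiv_const_add, fderiv_fun_id]
    rfl
  have h2 : T 2 = fun g => (2 : ℝ)⁻¹ • ⁅g, x⁆ := by
    funext g
    simp only [hT, bchTerm_two]
    let B : L.Points q →L[ℝ] L.Points q := LinearMap.toContinuousLinearMap
      ((2 : ℝ)⁻¹ • (LieAlgebra.ad ℝ (L.Points q) g : L.Points q →ₗ[ℝ] L.Points q))
    exact congrArg (fun T => T x) (B.hasFDerivAt (x := 0)).fderiv
  -- A term of total degree `n + 3`, differentiated once in the second factor at the identity, is
  -- homogeneous of degree `n + 2 ≥ 2` in the first.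
  have h3 : ∀ n, fderiv ℝ (T (n + 3)) 0 = 0 := by
    intro n
    refine hasFDerivAt_of_homogeneous (hTd _ 0) (m := n + 2) (by omega) fun c g hc => ?_
    have hfun : (fun h => bchTerm (fun a b : L.Points q => ⁅a, b⁆) (c • g) h (n + 3)) =
        fun h => c ^ (n + 3) • (fun h => bchTerm (fun a b : L.Points q => ⁅a, b⁆) g h (n + 3))
          (c⁻¹ • h) := by
      funext h
      rw [← bchTerm_smul _ c (fun a b => smul_lie c a b) (fun d a b => lie_smul d a b),
        smul_inv_smul₀ hc]
    have hd : HasFDerivAt (fun h => (fun h => bchTerm (fun a b : L.Points q => ⁅a, b⁆) g h (n + 3))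
        (c⁻¹ • h)) ((fderiv ℝ (fun h => bchTerm (fun a b : L.Points q => ⁅a, b⁆) g h (n + 3)) 0).comp
          (c⁻¹ • ContinuousLinearMap.id ℝ (L.Points q))) 0 := by
      refine HasFDerivAt.comp (0 : L.Points q) (f := fun h => c⁻¹ • h)
        (g := fun h => bchTerm (fun a b : L.Points q => ⁅a, b⁆) g h (n + 3)) ?_
        (c⁻¹ • ContinuousLinearMap.id ℝ (L.Points q)).hasFDerivAt
      rw [smul_zero]
      exact (hsm2 _ g 0).hasFDerivAt
    simp only [hT]
    rw [hfun, (hd.fun_const_smul (c ^ (n + 3))).fderiv]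
    simp only [smul_apply, ContinuousLinearMap.comp_apply,
      ContinuousLinearMap.id_apply, map_smul, smul_smul]
    congr 1
    rw [pow_succ, mul_inv_cancel_right₀ hc]
  rw [hV, fderiv_fun_sum fun n _ => hTd n 0, Finset.sum_range_succ', Finset.sum_range_succ',
    Finset.sum_range_succ']
  simp only [h3, Finset.sum_const_zero, zero_add, h0, h1]
  let B : L.Points q →L[ℝ] L.Points q :=
    ((2 : ℝ)⁻¹ • (LieAlgebra.ad ℝ (L.Points q) : L.Points q →ₗ[ℝ] Module.End ℝ (L.Points q)).flip x :
      L.Points q →ₗ[ℝ] L.Points q).toContinuousLinearMap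
  have h2' : fderiv ℝ (T 2) 0 = B := by
    rw [h2]
    exact B.hasFDerivAt.fderiv
  rw [h2']
  simp [B]

/-! ## Left-invariant forms -/

/-- The left-invariant differential form on `N_A` defined by `ω_A`. -/
noncomputable def invariantForm {p : ℕ} (ω : L.evenCochains p) (q : ℕ) (g : L.Points q) :
    (L.Points q) [⋀^Fin p]→L[ℝ] (GrEven q) :=
  ContinuousAlternatingMap.compContinuousLinearMap
    { L.cochainAlt ω q with
      cont := (L.cochainAlt ω q).toMultilinearMap.continuous_of_finiteDimensional' }
    (L.maurerCartan q g)

theorem invariantForm_apply {p : ℕ} (ω : L.evenCochains p) (q : ℕ) (g : L.Points q)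
    (v : Fin p → L.Points q) : L.invariantForm ω q g v = L.leftInvariantForm ω q g v := rfl

theorem leftInvariantForm_eq {p : ℕ} (ω : L.evenCochains p) (q : ℕ) (g : L.Points q)
    (v : Fin p → L.Points q) : L.leftInvariantForm ω q g v =
      L.cochainOnPoints ω q fun k => L.maurerCartan q g (v k) := rfl

theorem IsNilpotent.differentiable_invariantForm (hL : L.IsNilpotent) {p : ℕ}
    (ω : L.evenCochains p) (q : ℕ) : Differentiable ℝ (L.invariantForm ω q) := by
  have h : Differentiable ℝ (L.maurerCartan q) := by
    have h1 : L.maurerCartan q = fun g =>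
        (fderiv ℝ (fun z : L.Points q × L.Points q => L.mul z.1 z.2) (-g, g)).comp
          (ContinuousLinearMap.inr ℝ _ _) := by
      funext g
      ext v
      exact hL.fderiv_mul_left (-g) g v
    rw [h1]
    have h2 : ContDiff ℝ ((⊤ : ℕ∞) : WithTop ℕ∞) fun g : L.Points q =>
        fderiv ℝ (fun z : L.Points q × L.Points q => L.mul z.1 z.2) (-g, g) :=
      ((hL.contDiff_mul q).fderiv_right (by simp)).comp (contDiff_neg.prodMk contDiff_id)
    exact (h2.differentiable (by simp)).clm_comp (differentiable_const _)
  intro g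
  exact (differentiableAt_const _).continuousAlternatingMapCompContinuousLinearMap (h g)

theorem IsNilpotent.leftInvariantForm_mul (hL : L.IsNilpotent) {p : ℕ} (ω : L.evenCochains p)
    {q : ℕ} (g h : L.Points q) (v : Fin p → L.Points q) :
    L.leftInvariantForm ω q h v = L.leftInvariantForm ω q (L.mul g h) fun k =>
      fderiv ℝ (fun k : L.Points q => L.mul g k) h (v k) := by
  simp only [leftInvariantForm_eq, hL.maurerCartan_mul g h]
  rfl

/-- The exterior derivative is evaluated on the left-invariant extensions of the tangent vectors.
The form is constant on these, so only the terms with Lie brackets of vector fields remain. -/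
theorem IsNilpotent.extDeriv_invariantForm_zero (hL : L.IsNilpotent) {m : ℕ}
    (ω : L.evenCochains (m + 1)) (q : ℕ) (x : Fin (m + 2) → L.Points q) :
    extDeriv (L.invariantForm ω q) 0 x = L.pointsCobd ω q x := by
  have h := extDeriv_apply_vectorField (V := fun i => L.leftInvField (x i)) (x := 0)
    (hL.differentiable_invariantForm ω q 0) fun i => hL.differentiable_leftInvField (x i) 0
  simp only [leftInvField_zero] at h
  rw [h]
  have h1 : ∀ i : Fin (m + 2), (fun g => L.invariantForm ω q g
      (i.removeNth fun j => L.leftInvField (x j) g)) =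
        fun _ => L.cochainOnPoints ω q (i.removeNth x) := by
    intro i
    funext g
    rw [invariantForm_apply, leftInvariantForm_eq]
    simp only [Fin.removeNth, hL.maurerCartan_leftInvField]
    rfl
  simp only [h1]
  simp only [fderiv_fun_const, Pi.zero_apply, zero_apply, smul_zero, Finset.sum_const_zero,
    zero_sub, VectorField.lieBracket, leftInvField_zero, hL.fderiv_leftInvField]
  have h2 : ∀ a b : L.Points q, (2 : ℝ)⁻¹ • ⁅a, b⁆ - (2 : ℝ)⁻¹ • ⁅b, a⁆ = ⁅a, b⁆ := by
    intro a b
    rw [← lie_skew b a, smul_neg, sub_neg_eq_add, ← add_smul]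
    norm_num
  simp only [h2, invariantForm_apply, leftInvariantForm_eq, maurerCartan_zero]
  -- The larger index is written as a successor, so that pairs `i < j + 1` become pairs `i ≤ j` as
  -- in the formula for the exterior derivative.
  have h0 : L.pointsCobd ω q x = ∑ j : Fin (m + 1), ∑ i : Fin (m + 1) with i.castSucc < j.succ,
      (-1 : ℝ) ^ ((i : ℕ) + (j.succ : ℕ)) • L.cochainOnPoints ω q
        (Fin.cons ⁅x i.castSucc, x j.succ⁆ fun k => x (j.succ.succAbove (i.succAbove k))) := by
    rw [pointsCobd, Fin.sum_univ_succ]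
    simp
  rw [h0, Finset.sum_comm' (t' := Finset.univ) (s' := fun j => Finset.univ.filter (· ≤ j))
    (by simp), ← Finset.sum_neg_distrib]
  refine Finset.sum_congr rfl fun j _ => ?_
  rw [← Finset.sum_neg_distrib]
  refine Finset.sum_congr (by ext i; simp [Fin.castSucc_lt_succ_iff]) fun i hi => ?_
  have hij : i ≤ j := by simpa [Fin.castSucc_lt_succ_iff] using hi
  have h3 : (j.removeNth (i.castSucc.removeNth fun k => x k)) =
      fun k => x (j.succ.succAbove (i.succAbove k)) := by
    funext k
    simp only [Fin.removeNth]
    congr 1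
    rw [Fin.le_def] at hij
    ext
    simp only [Fin.succAbove, Fin.lt_def]
    split_ifs <;> simp_all <;> omega
  have h4 : (fun k => (ContinuousLinearMap.id ℝ (L.Points q))
      (Matrix.vecCons ⁅x i.castSucc, x j.succ⁆ (fun k => x (j.succ.succAbove (i.succAbove k))) k)) =
      (Fin.cons ⁅x i.castSucc, x j.succ⁆ fun k => x (j.succ.succAbove (i.succAbove k)) :
        Fin (m + 1) → L.Points q) := rfl
  rw [h3, h4, Fin.val_succ, ← add_assoc, pow_succ, mul_neg_one, neg_smul]
  rcases Nat.even_or_odd ((i : ℕ) + j) with he | he <;> simp [he.neg_one_pow]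

/-- The form is its own pullback under translation by `-g`, which moves `g` to the identity, and
exterior derivatives commute with pullback. -/
theorem IsNilpotent.extDeriv_invariantForm (hL : L.IsNilpotent) {m : ℕ}
    (ω : L.evenCochains (m + 1)) (q : ℕ) (g : L.Points q) (v : Fin (m + 2) → L.Points q) :
    extDeriv (L.invariantForm ω q) g v =
      L.pointsCobd ω q fun k => L.maurerCartan q g (v k) := by
  have h := extDeriv_pullback (x := g) (f := fun h => L.mul (-g) h) (r := ((⊤ : ℕ∞) : WithTop ℕ∞))
    (hL.differentiable_invariantForm ω q _) (hL.contDiff_mul_left (-g)).contDiffAt (by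
      rw [minSmoothness_of_isRCLikeNormedField]
      exact WithTop.coe_le_coe.2 le_top)
  have h1 : (fun h => (L.invariantForm ω q (L.mul (-g) h)).compContinuousLinearMap
      (fderiv ℝ (fun h => L.mul (-g) h) h)) = L.invariantForm ω q := by
    funext h
    ext v
    exact congrArg Subtype.val (hL.leftInvariantForm_mul ω (-g) h v).symm
  rw [h1, neg_mul_self] at h
  rw [h, ← hL.extDeriv_invariantForm_zero]
  rfl

/-- The coboundary of an even cochain is an even cochain. -/
theorem IsNilpotent.cobd_mem (hL : L.IsNilpotent) : ∀ (p : ℕ) (ω : L.evenCochains p),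
    L.cobd ω.1 ∈ L.evenCochains (p + 1)
  | 0, _ => Submodule.zero_mem _
  | m + 1, ω => by
    -- Antisymmetry on points need not be checked by hand: the Chevalley-Eilenberg expression is the
    -- value of an exterior derivative, which is alternating.
    refine L.cobd_mem_of_pointsCobd_swap ω fun q i j hij x => ?_
    rw [← hL.extDeriv_invariantForm_zero, ← hL.extDeriv_invariantForm_zero]
    exact (extDeriv (L.invariantForm ω q) 0).map_swap x hij

/-- The exterior derivative of a left-invariant form is the left-invariant form of the
coboundary. -/
theorem IsNilpotent.extDeriv_invariantForm_eq (hL : L.IsNilpotent) {m : ℕ}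
    (ω : L.evenCochains (m + 1)) (q : ℕ) (g : L.Points q) (v : Fin (m + 2) → L.Points q) :
    extDeriv (L.invariantForm ω q) g v =
      L.leftInvariantForm ⟨L.cobd ω.1, hL.cobd_mem (m + 1) ω⟩ q g v := by
  rw [hL.extDeriv_invariantForm]
  exact Subtype.ext (L.coe_pointsCobd ω q _)

end LieSuperalgebra

namespace LieSuperalgebra

/-! ## The corner simplex and the Stokes theorem -/

theorem isClosed_cornerSimplex (p : ℕ) : IsClosed (cornerSimplex p) := by
  have h : cornerSimplex p = (⋂ i, {t | 0 ≤ t i}) ∩ {t | ∑ i, t i ≤ 1} := by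
    ext t
    simp [cornerSimplex]
  rw [h]
  exact (isClosed_iInter fun i => isClosed_le continuous_const (continuous_apply i)).inter
    (isClosed_le (by fun_prop) continuous_const)

theorem isCompact_cornerSimplex (p : ℕ) : IsCompact (cornerSimplex p) := by
  refine (isCompact_Icc (a := (0 : Fin p → ℝ)) (b := 1)).of_isClosed_subset
    (isClosed_cornerSimplex p) fun t ht => ⟨ht.1, fun i => ?_⟩
  exact (Finset.single_le_sum (fun j _ => ht.1 j) (Finset.mem_univ i)).trans ht.2

theorem convex_cornerSimplex (p : ℕ) : Convex ℝ (cornerSimplex p) := by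
  intro x hx y hy a b ha hb hab
  refine ⟨fun i => ?_, ?_⟩
  · exact add_nonneg (mul_nonneg ha (hx.1 i)) (mul_nonneg hb (hy.1 i))
  · simp only [Pi.add_apply, Pi.smul_apply, smul_eq_mul, Finset.sum_add_distrib, ← Finset.mul_sum]
    calc _ ≤ a * 1 + b * 1 := add_le_add (mul_le_mul_of_nonneg_left hx.2 ha)
          (mul_le_mul_of_nonneg_left hy.2 hb)
      _ = 1 := by rw [mul_one, mul_one, hab]

theorem nonempty_interior_cornerSimplex (p : ℕ) : (interior (cornerSimplex p)).Nonempty := by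
  have h : IsOpen ((⋂ i, {t : Fin p → ℝ | 0 < t i}) ∩ {t | ∑ i, t i < 1}) :=
    (isOpen_iInter_of_finite fun i => isOpen_lt continuous_const (continuous_apply i)).inter
      (isOpen_lt (by fun_prop) continuous_const)
  have hs : ((⋂ i, {t : Fin p → ℝ | 0 < t i}) ∩ {t | ∑ i, t i < 1}) ⊆ cornerSimplex p :=
    fun t ht => ⟨fun i => (mem_iInter.1 ht.1 i).le, ht.2.le⟩
  refine ⟨fun _ => ((p : ℝ) + 1)⁻¹, interior_maximal hs h ⟨mem_iInter.2 fun i => ?_, ?_⟩⟩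
  · exact inv_pos.2 (by positivity : (0 : ℝ) < (p : ℝ) + 1)
  · simp only [mem_ofPred_eq, Finset.sum_const, Finset.card_univ, Fintype.card_fin, nsmul_eq_mul]
    rw [← div_eq_mul_inv, div_lt_one (by positivity)]
    linarith

theorem uniqueDiffOn_cornerSimplex (p : ℕ) : UniqueDiffOn ℝ (cornerSimplex p) :=
  uniqueDiffOn_convex (convex_cornerSimplex p) (nonempty_interior_cornerSimplex p)

/-- Needed for the symmetry of second derivatives at boundary points. -/
theorem mem_closure_interior_cornerSimplex {p : ℕ} {t : Fin p → ℝ} (ht : t ∈ cornerSimplex p) :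
    t ∈ closure (interior (cornerSimplex p)) := by
  rw [(convex_cornerSimplex p).closure_interior_eq_closure_of_nonempty_interior
    (nonempty_interior_cornerSimplex p)]
  exact subset_closure ht

theorem insertNth_mem_cornerSimplex {p : ℕ} {i : Fin (p + 1)} {x : ℝ} {s : Fin p → ℝ} :
    (i.insertNth x s : Fin (p + 1) → ℝ) ∈ cornerSimplex (p + 1) ↔
      s ∈ cornerSimplex p ∧ x ∈ Icc 0 (1 - ∑ k, s k) := by
  simp only [cornerSimplex, mem_ofPred_eq, Fin.sum_univ_succAbove _ i, Fin.insertNth_apply_same,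
    Fin.insertNth_apply_succAbove, mem_Icc, Fin.forall_iff_succAbove i]
  constructor
  · rintro ⟨⟨h1, h2⟩, h3⟩
    exact ⟨⟨h2, by linarith⟩, h1, by linarith⟩
  · rintro ⟨⟨h1, h2⟩, h3, h4⟩
    exact ⟨⟨h3, h1⟩, by linarith⟩

variable {F : Type*} [NormedAddCommGroup F] [NormedSpace ℝ F]

/-- Fubini in any chosen coordinate; the slice over `s` is the interval from the coordinate face to
the slanted face. -/
theorem integral_cornerSimplex_succ {p : ℕ} (i : Fin (p + 1)) {g : (Fin (p + 1) → ℝ) → F}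
    (hg : ContinuousOn g (cornerSimplex (p + 1))) :
    ∫ t in cornerSimplex (p + 1), g t =
      ∫ s in cornerSimplex p, ∫ x in (0 : ℝ)..(1 - ∑ k, s k), g (i.insertNth x s) := by
  have hm := (isClosed_cornerSimplex (p + 1)).measurableSet
  have hint : Integrable ((cornerSimplex (p + 1)).indicator g) :=
    (integrable_indicator_iff hm).2 (hg.integrableOn_compact (isCompact_cornerSimplex _))
  have hmp := (volume_preserving_piFinSuccAbove (fun _ : Fin (p + 1) => ℝ) i).symm
  rw [← integral_indicator hm, ← hmp.integral_comp', Measure.volume_eq_prod, integral_prod_symm,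
    ← integral_indicator (isClosed_cornerSimplex p).measurableSet]
  · refine integral_congr_ae (Filter.Eventually.of_forall fun s => ?_)
    have h1 : ∀ x : ℝ, ((MeasurableEquiv.piFinSuccAbove (fun _ : Fin (p + 1) => ℝ) i).symm (x, s)) =
        i.insertNth x s := fun x => rfl
    simp only [h1]
    by_cases hs : s ∈ cornerSimplex p
    · rw [Set.indicator_of_mem hs, intervalIntegral.integral_of_le (by linarith [hs.2]),
        ← integral_Icc_eq_integral_Ioc, ← integral_indicator measurableSet_Icc]
      refine integral_congr_ae (Filter.Eventually.of_forall fun x => ?_)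
      simp only [Set.indicator, insertNth_mem_cornerSimplex, hs, true_and]
    · rw [Set.indicator_of_notMem hs]
      simp [Set.indicator, insertNth_mem_cornerSimplex, hs]
  · exact (hmp.integrable_comp_emb (MeasurableEquiv.measurableEmbedding _)).2 hint

theorem insertNth_slanted_mem {p : ℕ} (i : Fin (p + 1)) {s : Fin p → ℝ} (hs : s ∈ cornerSimplex p) :
    (i.insertNth (1 - ∑ k, s k) s : Fin (p + 1) → ℝ) ∈ cornerSimplex (p + 1) :=
  insertNth_mem_cornerSimplex.2 ⟨hs, by linarith [hs.2], le_rfl⟩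

theorem continuous_insertNth_slanted {p : ℕ} (i : Fin (p + 1)) :
    Continuous fun s : Fin p → ℝ => (i.insertNth (1 - ∑ k, s k) s : Fin (p + 1) → ℝ) := by
  refine continuous_pi fun j => ?_
  induction j using Fin.succAboveCases i with
  | x => simpa using by fun_prop
  | p j => simpa using by fun_prop

theorem insertNth_castSucc_insertNth {p : ℕ} (i : Fin (p + 1)) (x y : ℝ) (r : Fin p → ℝ) :
    (i.castSucc.insertNth y (i.insertNth x r : Fin (p + 1) → ℝ) : Fin (p + 2) → ℝ) =
      i.succ.insertNth x (i.insertNth y r : Fin (p + 1) → ℝ) := by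
  rw [Fin.insertNth_eq_iff]
  refine ⟨?_, ?_⟩
  · have h : i.castSucc = i.succ.succAbove i := by simp
    rw [h, Fin.insertNth_apply_succAbove, Fin.insertNth_apply_same]
  · funext k
    simp only [Fin.removeNth]
    induction k using Fin.succAboveCases i with
    | x => simp
    | p l =>
      have h : i.castSucc.succAbove (i.succAbove l) = i.succ.succAbove (i.succAbove l) := by
        ext
        simp only [Fin.succAbove, Fin.lt_def]
        split_ifs <;> simp_all <;> omega
      rw [h]
      simp

/-- The slanted face can be parametrized by omitting any coordinate. Passing between two
neighbouring choices is the reflection `x ↦ 1 - ∑ r - x` of one variable. -/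
theorem integral_slanted_castSucc {p : ℕ} {f : (Fin (p + 1) → ℝ) → F}
    (hf : ContinuousOn f (cornerSimplex (p + 1))) (i : Fin p) :
    ∫ s in cornerSimplex p, f (i.castSucc.insertNth (1 - ∑ k, s k) s) =
      ∫ s in cornerSimplex p, f (i.succ.insertNth (1 - ∑ k, s k) s) := by
  obtain _ | p := p
  · exact i.elim0
  have hc : ∀ j : Fin (p + 2), ContinuousOn (fun s : Fin (p + 1) → ℝ =>
      f (j.insertNth (1 - ∑ k, s k) s)) (cornerSimplex (p + 1)) := fun j =>
    hf.comp (continuous_insertNth_slanted j).continuousOn fun s hs => insertNth_slanted_mem j hs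
  rw [integral_cornerSimplex_succ i (hc _), integral_cornerSimplex_succ i (hc _)]
  refine integral_congr_ae (Filter.Eventually.of_forall fun r => ?_)
  have h := intervalIntegral.integral_comp_sub_left (a := 0) (b := 1 - ∑ k, r k)
    (fun x => f (i.succ.insertNth (1 - ∑ k, (i.insertNth x r : Fin (p + 1) → ℝ) k)
      (i.insertNth x r : Fin (p + 1) → ℝ))) (1 - ∑ k, r k)
  rw [sub_self, sub_zero] at h
  refine Eq.trans (intervalIntegral.integral_congr fun x _ => ?_) h
  have hsum : ∀ y : ℝ, ∑ k, (i.insertNth y r : Fin (p + 1) → ℝ) k = y + ∑ k, r k := by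
    intro y
    rw [Fin.sum_univ_succAbove _ i]
    simp
  simp only [hsum]
  rw [show 1 - (1 - ∑ k, r k - x + ∑ k, r k) = x by ring,
    show 1 - (x + ∑ k, r k) = 1 - ∑ k, r k - x by ring, insertNth_castSucc_insertNth]

theorem integral_slanted {p : ℕ} {f : (Fin (p + 1) → ℝ) → F}
    (hf : ContinuousOn f (cornerSimplex (p + 1))) (i : Fin (p + 1)) :
    ∫ s in cornerSimplex p, f (i.insertNth (1 - ∑ k, s k) s) =
      ∫ s in cornerSimplex p, f (Fin.cons (1 - ∑ k, s k) s) := by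
  induction i using Fin.induction with
  | zero => simp only [Fin.insertNth_zero]; rfl
  | succ i ih => rw [← integral_slanted_castSucc hf, ih]

/-- The divergence theorem on the corner simplex, for a vector field with one component. -/
theorem integral_cornerSimplex_partial [CompleteSpace F] {p : ℕ} {f : (Fin (p + 1) → ℝ) → F}
    (hf : ContDiffOn ℝ 1 f (cornerSimplex (p + 1))) (i : Fin (p + 1)) :
    ∫ t in cornerSimplex (p + 1), fderivWithin ℝ f (cornerSimplex (p + 1)) t (Pi.single i 1) =
      (∫ s in cornerSimplex p, f (Fin.cons (1 - ∑ k, s k) s)) -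
        ∫ s in cornerSimplex p, f (i.insertNth 0 s) := by
  have hc : ContinuousOn (fun t => fderivWithin ℝ f (cornerSimplex (p + 1)) t (Pi.single i 1))
      (cornerSimplex (p + 1)) :=
    (hf.continuousOn_fderivWithin (uniqueDiffOn_cornerSimplex _) le_rfl).clm_apply
      continuousOn_const
  have hins : ∀ s : Fin p → ℝ, Continuous fun x : ℝ => (i.insertNth x s : Fin (p + 1) → ℝ) := by
    intro s
    refine continuous_pi fun j => ?_
    induction j using Fin.succAboveCases i with
    | x => simpa using continuous_id'
    | p j => simpa using continuous_const
  -- On each slice the fundamental theorem of calculus gives the value on the slanted face minus the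
  -- value on the coordinate face. The slanted term is first rewritten to be parametrized by
  -- omitting coordinate `i`.
  rw [integral_cornerSimplex_succ i hc, ← integral_slanted hf.continuousOn i, ← integral_sub]
  · refine setIntegral_congr_fun (isClosed_cornerSimplex p).measurableSet fun s hs => ?_
    have hle : 0 ≤ 1 - ∑ k, s k := by linarith [hs.2]
    have hmaps : MapsTo (fun x : ℝ => (i.insertNth x s : Fin (p + 1) → ℝ)) (Icc 0 (1 - ∑ k, s k))
        (cornerSimplex (p + 1)) := fun x hx => insertNth_mem_cornerSimplex.2 ⟨hs, hx⟩
    refine intervalIntegral.integral_eq_sub_of_hasDerivAt_of_le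
      (f := fun x => f (i.insertNth x s)) hle (hf.continuousOn.comp (hins s).continuousOn hmaps) ?_ ?_
    · intro x hx
      have hx' := hmaps (Ioo_subset_Icc_self hx)
      have h1 : HasDerivWithinAt (fun x : ℝ => (i.insertNth x s : Fin (p + 1) → ℝ))
          (Pi.single i 1) (Icc 0 (1 - ∑ k, s k)) x := by
        rw [hasDerivWithinAt_pi]
        intro j
        induction j using Fin.succAboveCases i with
        | x =>
          simp only [Fin.insertNth_apply_same, Pi.single_eq_same]
          exact hasDerivWithinAt_id x _
        | p j => simpa [Pi.single_apply] using hasDerivWithinAt_const x _ (s j)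
      exact (((hf.differentiableOn one_ne_zero _ hx').hasFDerivWithinAt).comp_hasDerivWithinAt x h1
        hmaps).hasDerivAt (Icc_mem_nhds hx.1 hx.2)
    · refine ContinuousOn.intervalIntegrable ?_
      rw [uIcc_of_le hle]
      exact hc.comp (hins s).continuousOn hmaps
  · exact (hf.continuousOn.comp (continuous_insertNth_slanted i).continuousOn
      fun s hs => insertNth_slanted_mem i hs).integrableOn_compact (isCompact_cornerSimplex p)
  · refine (hf.continuousOn.comp (t := cornerSimplex (p + 1)) (f := fun s => i.insertNth 0 s) ?_
      fun s hs => insertNth_mem_cornerSimplex.2 ⟨hs, le_rfl, by linarith [hs.2]⟩).integrableOn_compact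
        (isCompact_cornerSimplex p)
    refine (continuous_pi fun j => ?_).continuousOn
    induction j using Fin.succAboveCases i with
    | x => simpa using continuous_const
    | p j => simpa using continuous_apply j

/-- Both sides are values of `l ∧ f`: at `e` it expands to the right side, and at `e 0, e 1 - e 0,
…` only the first term survives since `l` kills differences. Alternation makes the two values equal.
In Stokes' theorem this collects the contributions of the slanted face, whose tangent vectors are
such differences. -/
theorem _root_.AlternatingMap.map_sub_zero_eq_sum {M N : Type*} [AddCommGroup M] [Module ℝ M]
    [AddCommGroup N] [Module ℝ N] {p : ℕ} (f : M [⋀^Fin p]→ₗ[ℝ] N) (e : Fin (p + 1) → M)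
    (l : M →ₗ[ℝ] ℝ) (hl : ∀ i, l (e i) = 1) :
    f (fun k => e k.succ - e 0) = ∑ i : Fin (p + 1), (-1 : ℝ) ^ (i : ℕ) • f (i.removeNth e) := by
  set g := AlternatingMap.alternatizeUncurryFin (l.smulRight f) with hg
  have happ : ∀ v, g v = ∑ i : Fin (p + 1), (-1 : ℝ) ^ (i : ℕ) • l (v i) • f (i.removeNth v) := by
    intro v
    rw [hg, AlternatingMap.alternatizeUncurryFin_apply]
    refine Finset.sum_congr rfl fun i _ => ?_
    rcases Nat.even_or_odd (i : ℕ) with he | he <;> simp [he.neg_one_pow]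
  have h1 : g.curryLeft (e 0) (fun k => e k.succ - e 0) = f (fun k => e k.succ - e 0) := by
    have h := happ (Fin.cons (e 0) fun k => e k.succ - e 0)
    rw [Fin.sum_univ_succ] at h
    refine Eq.trans (?_ : _ = g (Fin.cons (e 0) fun k => e k.succ - e 0)) ?_
    · rfl
    · simpa [hl, Fin.removeNth_zero] using h
  have h2 : g.curryLeft (e 0) (fun k => e k.succ) = ∑ i : Fin (p + 1),
      (-1 : ℝ) ^ (i : ℕ) • f (i.removeNth e) := by
    have h := happ e
    simp only [hl, one_smul] at h
    rw [← h, ← Fin.cons_self_tail e]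
    rfl
  -- The first argument is taken to be `-e 0`, so that every unwanted term in the expansion repeats
  -- an argument literally.
  have h3 : ∀ v : Fin p → M, g.curryLeft (-e 0) (v + fun _ => -e 0) = g.curryLeft (-e 0) v := by
    intro v
    rw [← AlternatingMap.coe_multilinearMap, MultilinearMap.map_add_univ,
      Finset.sum_eq_single Finset.univ]
    · simp
    · intro s _ hs
      obtain ⟨k, hk⟩ : ∃ k, k ∉ s := by
        by_contra! h
        exact hs (Finset.eq_univ_iff_forall.2 h)
      refine g.map_eq_zero_of_eq (i := 0) (j := k.succ) _ ?_ (Fin.succ_ne_zero k).symm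
      simp [Finset.piecewise, hk]
    · simp
  have h4 := h3 fun k => e k.succ
  rw [map_neg, AlternatingMap.neg_apply, AlternatingMap.neg_apply, neg_inj] at h4
  rw [← h1, ← h2, ← h4]
  congr 1
  funext k
  simp [sub_eq_add_neg]

/-- The Stokes theorem on the corner simplex. -/
theorem integral_extDerivWithin_cornerSimplex [CompleteSpace F] {p : ℕ}
    {η : (Fin (p + 1) → ℝ) → (Fin (p + 1) → ℝ) [⋀^Fin p]→L[ℝ] F}
    (hd : DifferentiableOn ℝ η (cornerSimplex (p + 1)))
    (hη : ∀ v, ContDiffOn ℝ 1 (fun t => η t v) (cornerSimplex (p + 1))) :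
    ∫ t in cornerSimplex (p + 1), extDerivWithin η (cornerSimplex (p + 1)) t
        (fun k => Pi.single k 1) =
      (∫ s in cornerSimplex p, η (Fin.cons (1 - ∑ k, s k) s)
        fun k => Pi.single k.succ 1 - Pi.single 0 1) +
      ∑ i : Fin (p + 1), (-1 : ℝ) ^ ((i : ℕ) + 1) • ∫ s in cornerSimplex p,
        η (i.insertNth 0 s) (fun k => Pi.single (i.succAbove k) 1) := by
  set e : Fin (p + 1) → Fin (p + 1) → ℝ := fun k => Pi.single k 1 with he
  have h1 : ∀ t ∈ cornerSimplex (p + 1), extDerivWithin η (cornerSimplex (p + 1)) t e =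
      ∑ i : Fin (p + 1), (-1 : ℝ) ^ (i : ℕ) •
        fderivWithin ℝ (fun t => η t (i.removeNth e)) (cornerSimplex (p + 1)) t (e i) := by
    intro t ht
    rw [extDerivWithin_apply (hd t ht) (uniqueDiffOn_cornerSimplex _ t ht)]
    refine Finset.sum_congr rfl fun i _ => ?_
    rcases Nat.even_or_odd (i : ℕ) with he | he <;> simp [he.neg_one_pow]
  have hface : Continuous fun s : Fin p → ℝ => (Fin.cons (1 - ∑ k, s k) s : Fin (p + 1) → ℝ) := by
    simpa only [Fin.insertNth_zero'] using continuous_insertNth_slanted (0 : Fin (p + 1))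
  have hmem : MapsTo (fun s : Fin p → ℝ => (Fin.cons (1 - ∑ k, s k) s : Fin (p + 1) → ℝ))
      (cornerSimplex p) (cornerSimplex (p + 1)) := by
    intro s hs
    simpa only [Fin.insertNth_zero'] using insertNth_slanted_mem (0 : Fin (p + 1)) hs
  rw [setIntegral_congr_fun (isClosed_cornerSimplex _).measurableSet h1, integral_finsetSum]
  · simp only [integral_smul, he, integral_cornerSimplex_partial (hη _), smul_sub,
      Finset.sum_sub_distrib]
    rw [sub_eq_add_neg, ← Finset.sum_neg_distrib]
    congr 1
    -- All slanted-face terms are integrals over the same domain; their alternating sum is the form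
    -- on the tangent vectors of that face.
    · rw [← he]
      simp only [← integral_smul]
      rw [← integral_finsetSum]
      · refine setIntegral_congr_fun (isClosed_cornerSimplex _).measurableSet fun s hs => ?_
        refine ((η _).toAlternatingMap.map_sub_zero_eq_sum e
          (∑ k, LinearMap.proj k) fun i => ?_).symm
        simp [he, LinearMap.sum_apply]
      · intro i _
        exact (((hη _).continuousOn.comp hface.continuousOn hmem).integrableOn_compact
          (isCompact_cornerSimplex p)).smul _
    · refine Finset.sum_congr rfl fun i _ => ?_
      rw [pow_succ, mul_neg_one, neg_smul]
      rfl
  · intro i _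
    exact (ContinuousOn.integrableOn_compact (isCompact_cornerSimplex _)
      (((hη _).continuousOn_fderivWithin (uniqueDiffOn_cornerSimplex _) le_rfl).clm_apply
        continuousOn_const)).smul _

end LieSuperalgebra

/-! ## Integrals depending on a parameter -/

section Parametric

variable {p : ℕ} {K : Set (Fin p → ℝ)} {V W : Type*} [NormedAddCommGroup V] [NormedSpace ℝ V]
  [NormedAddCommGroup W] [NormedSpace ℝ W] {h : (Fin p → ℝ) × V → W}

theorem hasFDerivAt_snd_of_contDiffOn_prod
    (hh : ContDiffOn ℝ ((⊤ : ℕ∞) : WithTop ℕ∞) h (K ×ˢ univ)) {t : Fin p → ℝ} (ht : t ∈ K) (v : V) :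
    HasFDerivAt (fun v => h (t, v)) ((fderivWithin ℝ h (K ×ˢ univ) (t, v)).comp
      (ContinuousLinearMap.inr ℝ (Fin p → ℝ) V)) v := by
  rw [← hasFDerivWithinAt_univ]
  exact ((hh.differentiableOn (by simp) (t, v) ⟨ht, mem_univ v⟩).hasFDerivWithinAt).comp v
    (hasFDerivAt_prodMk_right t v).hasFDerivWithinAt fun w _ => ⟨ht, mem_univ w⟩

theorem hasFDerivWithinAt_fst_of_contDiffOn_prod
    (hh : ContDiffOn ℝ ((⊤ : ℕ∞) : WithTop ℕ∞) h (K ×ˢ univ)) {t : Fin p → ℝ} (ht : t ∈ K) (v : V) :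
    HasFDerivWithinAt (fun t => h (t, v)) ((fderivWithin ℝ h (K ×ˢ univ) (t, v)).comp
      (ContinuousLinearMap.inl ℝ (Fin p → ℝ) V)) K t :=
  HasFDerivWithinAt.comp t (hh.differentiableOn (by simp) (t, v) ⟨ht, mem_univ v⟩).hasFDerivWithinAt
    (hasFDerivAt_prodMk_left t v).hasFDerivWithinAt fun _ hs => ⟨hs, mem_univ v⟩

theorem contDiffOn_fderivWithin_prod_apply (hu : UniqueDiffOn ℝ K)
    (hh : ContDiffOn ℝ ((⊤ : ℕ∞) : WithTop ℕ∞) h (K ×ˢ univ)) (u : (Fin p → ℝ) × V) :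
    ContDiffOn ℝ ((⊤ : ℕ∞) : WithTop ℕ∞) (fun z => fderivWithin ℝ h (K ×ˢ univ) z u)
      (K ×ˢ univ) :=
  (hh.fderivWithin (hu.prod uniqueDiffOn_univ) (by simp)).clm_apply contDiffOn_const

/-- The derivative is bounded on the compact product of `K` with a closed ball, which gives the
dominating constant. -/
theorem hasFDerivAt_setIntegral_param [FiniteDimensional ℝ V] (hK : IsCompact K)
    (hu : UniqueDiffOn ℝ K) (hh : ContDiffOn ℝ ((⊤ : ℕ∞) : WithTop ℕ∞) h (K ×ˢ univ)) (v₀ : V) :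
    HasFDerivAt (fun v => ∫ t in K, h (t, v))
      (∫ t in K, (fderivWithin ℝ h (K ×ˢ univ) (t, v₀)).comp
        (ContinuousLinearMap.inr ℝ (Fin p → ℝ) V)) v₀ := by
  have hsl : ∀ v : V, ContinuousOn (fun t : Fin p → ℝ => (t, v)) K := fun v => by fun_prop
  have hmap : ∀ v : V, MapsTo (fun t : Fin p → ℝ => (t, v)) K (K ×ˢ univ) :=
    fun v t ht => ⟨ht, mem_univ v⟩
  have hc : ContinuousOn (fun z => (fderivWithin ℝ h (K ×ˢ univ) z).comp
      (ContinuousLinearMap.inr ℝ (Fin p → ℝ) V)) (K ×ˢ univ) :=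
    (hh.continuousOn_fderivWithin (hu.prod uniqueDiffOn_univ) (by simp)).clm_comp continuousOn_const
  obtain ⟨C, hC⟩ := (hK.prod (isCompact_closedBall v₀ 1)).exists_bound_of_continuousOn
    (hc.mono (prod_mono_right (subset_univ _)))
  refine hasFDerivAt_integral_of_dominated_of_fderiv_le (bound := fun _ => C)
    (F' := fun v t => (fderivWithin ℝ h (K ×ˢ univ) (t, v)).comp
        (ContinuousLinearMap.inr ℝ (Fin p → ℝ) V))
    (Metric.closedBall_mem_nhds v₀ one_pos) ?_ ?_ ?_ ?_ ?_ ?_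
  · exact Filter.Eventually.of_forall fun v =>
      (hh.continuousOn.comp (hsl v) (hmap v)).aestronglyMeasurable hK.measurableSet
  · exact (hh.continuousOn.comp (hsl v₀) (hmap v₀)).integrableOn_compact hK
  · exact (hc.comp (hsl v₀) (hmap v₀)).aestronglyMeasurable hK.measurableSet
  · exact (ae_restrict_iff' hK.measurableSet).2 (Filter.Eventually.of_forall fun t ht v hv =>
      hC (t, v) ⟨ht, hv⟩)
  · exact continuousOn_const.integrableOn_compact hK
  · exact (ae_restrict_iff' hK.measurableSet).2 (Filter.Eventually.of_forall fun t ht v _ =>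
      hasFDerivAt_snd_of_contDiffOn_prod hh ht v)

theorem fderiv_setIntegral_param_apply [FiniteDimensional ℝ V] [CompleteSpace W] (hK : IsCompact K)
    (hu : UniqueDiffOn ℝ K) (hh : ContDiffOn ℝ ((⊤ : ℕ∞) : WithTop ℕ∞) h (K ×ˢ univ)) (v₀ v : V) :
    fderiv ℝ (fun v => ∫ t in K, h (t, v)) v₀ v =
      ∫ t in K, fderivWithin ℝ h (K ×ˢ univ) (t, v₀) (0, v) := by
  rw [(hasFDerivAt_setIntegral_param hK hu hh v₀).fderiv]
  refine (ContinuousLinearMap.integral_apply ?_ v).trans rfl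
  refine ContinuousOn.integrableOn_compact hK ?_
  exact ((hh.continuousOn_fderivWithin (hu.prod uniqueDiffOn_univ) (by simp)).comp
    (by fun_prop : ContinuousOn (fun t : Fin p → ℝ => (t, v₀)) K)
      fun t ht => ⟨ht, mem_univ v₀⟩).clm_comp continuousOn_const

/-- Each directional derivative is again an integral of the same kind, so smoothness follows by
induction on the order. -/
theorem contDiff_setIntegral_param [FiniteDimensional ℝ V] [CompleteSpace W] (hK : IsCompact K)
    (hu : UniqueDiffOn ℝ K) (hh : ContDiffOn ℝ ((⊤ : ℕ∞) : WithTop ℕ∞) h (K ×ˢ univ)) :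
    ContDiff ℝ ((⊤ : ℕ∞) : WithTop ℕ∞) fun v => ∫ t in K, h (t, v) := by
  rw [contDiff_infty]
  intro n
  induction n generalizing h with
  | zero =>
    exact contDiff_zero.2 (Differentiable.continuous (𝕜 := ℝ) fun v =>
      (hasFDerivAt_setIntegral_param hK hu hh v).differentiableAt)
  | succ n ih =>
    rw [Nat.cast_add, Nat.cast_one]
    refine contDiff_succ_iff_fderiv_apply.2 ⟨fun v =>
      (hasFDerivAt_setIntegral_param hK hu hh v).differentiableAt, fun hn => absurd hn (WithTop.coe_ne_top (a := (n : ℕ∞))), fun w => ?_⟩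
    simp only [fderiv_setIntegral_param_apply hK hu hh]
    exact ih (contDiffOn_fderivWithin_prod_apply hu hh (0, w))

theorem fderivWithin_fst_eq (hu : UniqueDiffOn ℝ K)
    (hh : ContDiffOn ℝ ((⊤ : ℕ∞) : WithTop ℕ∞) h (K ×ˢ univ)) {t : Fin p → ℝ} (ht : t ∈ K) (v : V)
    (e : Fin p → ℝ) : fderivWithin ℝ (fun t => h (t, v)) K t e =
      fderivWithin ℝ h (K ×ˢ univ) (t, v) (e, 0) := by
  rw [(hasFDerivWithinAt_fst_of_contDiffOn_prod hh ht v).fderivWithin (hu t ht)]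
  rfl

variable {q : ℕ} [Module (GrEven q) V] [Module (GrEven q) W]

theorem fderivWithin_prod_smul
    (hh : ContDiffOn ℝ ((⊤ : ℕ∞) : WithTop ℕ∞) h (K ×ˢ univ))
    (hA : ∀ t ∈ K, A0Smooth q fun v => h (t, v)) {t : Fin p → ℝ} (ht : t ∈ K) (v : V)
    (a : GrEven q) (w : V) : fderivWithin ℝ h (K ×ˢ univ) (t, v) (0, a • w) =
      a • fderivWithin ℝ h (K ×ˢ univ) (t, v) (0, w) := by
  have h1 := (hA t ht).2 v a w
  rwa [(hasFDerivAt_snd_of_contDiffOn_prod hh ht v).fderiv] at h1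

variable [FiniteDimensional ℝ W] [SMulCommClass ℝ (GrEven q) W]

/-- Multiplication by `a` as a continuous linear map. -/
noncomputable def A0Smooth.smulCLM (W : Type*) [NormedAddCommGroup W] [NormedSpace ℝ W]
    [Module (GrEven q) W] [FiniteDimensional ℝ W] [SMulCommClass ℝ (GrEven q) W] (a : GrEven q) :
    W →L[ℝ] W :=
  have := SMulCommClass.symm ℝ (GrEven q) W
  (DistribSMul.toLinearMap ℝ W a).toContinuousLinearMap

theorem A0Smooth.setIntegral [FiniteDimensional ℝ V] (hK : IsCompact K) (hu : UniqueDiffOn ℝ K)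
    (hh : ContDiffOn ℝ ((⊤ : ℕ∞) : WithTop ℕ∞) h (K ×ˢ univ))
    (hA : ∀ t ∈ K, A0Smooth q fun v => h (t, v)) :
    A0Smooth q fun v => ∫ t in K, h (t, v) := by
  have := FiniteDimensional.complete ℝ W
  refine ⟨contDiff_setIntegral_param hK hu hh, fun v a w => ?_⟩
  rw [fderiv_setIntegral_param_apply hK hu hh, fderiv_setIntegral_param_apply hK hu hh,
    setIntegral_congr_fun hK.measurableSet fun t ht => fderivWithin_prod_smul hh hA ht v a w]
  refine (A0Smooth.smulCLM W a).integral_comp_comm ?_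
  exact ((contDiffOn_fderivWithin_prod_apply hu hh (0, w)).continuousOn.comp
    (by fun_prop : ContinuousOn (fun t : Fin p → ℝ => (t, v)) K)
      fun t ht => ⟨ht, mem_univ v⟩).integrableOn_compact hK

/-- Partial derivatives with respect to the other variable of a family of `A₀`-smooth maps are
`A₀`-smooth. -/
theorem A0Smooth.fderivWithin_fst (hu : UniqueDiffOn ℝ K)
    (hcl : ∀ t ∈ K, t ∈ closure (interior K))
    (hh : ContDiffOn ℝ ((⊤ : ℕ∞) : WithTop ℕ∞) h (K ×ˢ univ))
    (hA : ∀ t ∈ K, A0Smooth q fun v => h (t, v)) {t : Fin p → ℝ} (ht : t ∈ K) (e : Fin p → ℝ) :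
    A0Smooth q fun v => fderivWithin ℝ (fun t => h (t, v)) K t e := by
  simp only [fderivWithin_fst_eq hu hh ht]
  have hh' := contDiffOn_fderivWithin_prod_apply hu hh (e, 0)
  have hS : UniqueDiffOn ℝ (K ×ˢ (univ : Set V)) := hu.prod uniqueDiffOn_univ
  refine ⟨?_, fun v a w => ?_⟩
  · rw [← contDiffOn_univ]
    exact hh'.comp (contDiffOn_const.prodMk contDiffOn_id) fun v hv => ⟨ht, hv⟩
  · have hz : ∀ v : V, (t, v) ∈ K ×ˢ (univ : Set V) := fun v => ⟨ht, mem_univ v⟩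
    have hD : ∀ u x : (Fin p → ℝ) × V,
        fderivWithin ℝ (fun z => fderivWithin ℝ h (K ×ˢ univ) z u) (K ×ˢ univ) (t, v) x =
          fderivWithin ℝ (fderivWithin ℝ h (K ×ˢ univ)) (K ×ˢ univ) (t, v) x u := by
      intro u x
      have h1 := ((hh.fderivWithin hS (m := ((⊤ : ℕ∞) : WithTop ℕ∞)) (by simp)).differentiableOn
        (by simp) (t, v) (hz v)).hasFDerivWithinAt
      rw [(h1.clm_apply (hasFDerivWithinAt_const u (t, v) _)).fderivWithin (hS _ (hz v))]
      simp
    -- The mixed second derivatives are interchanged: the derivative in `v` of the `t`-derivative is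
    -- the `t`-derivative of an `A₀`-linear map.
    have hsymm := (hh (t, v) (hz v)).isSymmSndFDerivWithinAt (by
      rw [minSmoothness_of_isRCLikeNormedField]
      exact WithTop.coe_le_coe.2 le_top) hS (by
      rw [interior_prod_eq, closure_prod_eq]
      exact ⟨hcl t ht, by simp⟩) (hz v)
    have key : ∀ w, fderiv ℝ (fun v => fderivWithin ℝ h (K ×ˢ univ) (t, v) (e, 0)) v w =
        fderivWithin ℝ (fun z => fderivWithin ℝ h (K ×ˢ univ) z (0, w)) (K ×ˢ univ) (t, v)
          (e, 0) := by
      intro w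
      rw [(hasFDerivAt_snd_of_contDiffOn_prod hh' ht v).fderiv, hD, ← hsymm.eq, ← hD]
      rfl
    rw [key, key]
    have h2 : EqOn (fun z => fderivWithin ℝ h (K ×ˢ univ) z (0, a • w))
        (fun z => A0Smooth.smulCLM W a (fderivWithin ℝ h (K ×ˢ univ) z (0, w))) (K ×ˢ univ) :=
      fun z hz => fderivWithin_prod_smul hh hA hz.1 z.2 a w
    rw [fderivWithin_congr h2 (h2 (hz v))]
    have h3 := (contDiffOn_fderivWithin_prod_apply hu hh (0, w)).differentiableOn (by simp)
      (t, v) (hz v)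
    have h4 := ((A0Smooth.smulCLM W a).hasFDerivAt.comp_hasFDerivWithinAt (t, v)
      h3.hasFDerivWithinAt).fderivWithin (hS _ (hz v))
    exact congrArg (fun T => T (e, 0)) h4

end Parametric

theorem contDiffOn_comp₂ {A B C V : Type*} [NormedAddCommGroup A] [NormedSpace ℝ A]
    [NormedAddCommGroup B] [NormedSpace ℝ B] [NormedAddCommGroup C] [NormedSpace ℝ C]
    [NormedAddCommGroup V] [NormedSpace ℝ V] {n : WithTop ℕ∞} {Φ : A → B → C}
    (hΦ : ContDiff ℝ n fun z : A × B => Φ z.1 z.2) {s : Set V} {f : V → A} {g : V → B}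
    (hf : ContDiffOn ℝ n f s) (hg : ContDiffOn ℝ n g s) :
    ContDiffOn ℝ n (fun x => Φ (f x) (g x)) s :=
  hΦ.comp_contDiffOn (hf.prodMk hg)

namespace LieSuperalgebra

variable {𝔫 : Type*} [AddCommGroup 𝔫] [Module ℝ 𝔫]

/-! ## Left-invariant forms: `A₀`-linearity, linearity and naturality -/

theorem rid_lTensor_smul {q : ℕ} (l : 𝔫 →ₗ[ℝ] ℝ) (a : Gr q) (x : Gr q ⊗[ℝ] 𝔫) :
    TensorProduct.rid ℝ (Gr q) (LinearMap.lTensor (Gr q) l (a • x)) =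
      a * TensorProduct.rid ℝ (Gr q) (LinearMap.lTensor (Gr q) l x) := by
  induction x using TensorProduct.induction_on with
  | zero => simp
  | add x y hx hy => rw [smul_add, map_add, map_add, hx, hy, map_add, map_add, mul_add]
  | tmul b v => simp [TensorProduct.smul_tmul']

theorem rid_lTensor_map {q r : ℕ} (l : 𝔫 →ₗ[ℝ] ℝ) (f : Gr q →ₐ[ℝ] Gr r) (x : Gr q ⊗[ℝ] 𝔫) :
    TensorProduct.rid ℝ (Gr r)
        (LinearMap.lTensor (Gr r) l (LinearMap.rTensor 𝔫 f.toLinearMap x)) =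
      f (TensorProduct.rid ℝ (Gr q) (LinearMap.lTensor (Gr q) l x)) := by
  induction x using TensorProduct.induction_on with
  | zero => simp
  | add x y hx hy => simp only [map_add, hx, hy]
  | tmul b v => simp

section Coordinates

variable [FiniteDimensional ℝ 𝔫]

theorem tensorExtend_apply {p : ℕ} (ω : MultilinearMap ℝ (fun _ : Fin p => 𝔫) ℝ) (q : ℕ)
    (x : Fin p → Gr q ⊗[ℝ] 𝔫) : tensorExtend ω q x =
      ∑ c : Fin p → Fin (Module.finrank ℝ 𝔫), ω (fun k => Module.finBasis ℝ 𝔫 (c k)) •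
        revProd fun k => TensorProduct.rid ℝ (Gr q)
          (LinearMap.lTensor (Gr q) ((Module.finBasis ℝ 𝔫).coord (c k)) (x k)) := by
  simp only [tensorExtend, sum_apply]
  refine Finset.sum_congr rfl fun c _ => ?_
  simp only [smul_apply, MultilinearMap.compLinearMap_apply, LinearMap.comp_apply,
    LinearEquiv.coe_coe, MultilinearMap.domDomCongr_apply, MultilinearMap.mkPiAlgebraFin_apply,
    Fin.revPerm_apply, revProd]
  congr 2
  refine List.ext_getElem (by simp) fun i h1 h2 => ?_
  simp only [List.getElem_ofFn, List.getElem_reverse, List.length_ofFn]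
  have : (⟨i, by simpa using h1⟩ : Fin p).rev = ⟨p - 1 - i, by simp at h1; omega⟩ := by
    ext
    simp only [Fin.val_rev]
    omega
  rw [this]

theorem revProd_update_mul {q : ℕ} (a : GrEven q) : ∀ {p : ℕ} (x : Fin p → Gr q) (i : Fin p),
    revProd (Function.update x i ((a : Gr q) * x i)) = (a : Gr q) * revProd x
  | 0, _, i => i.elim0
  | p + 1, x, i => by
    induction i using Fin.cases with
    | zero =>
      rw [revProd_succ, revProd_succ, Fin.tail_update_zero, Function.update_self, ← mul_assoc,
        ← grEven_commute, mul_assoc]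
    | succ i =>
      rw [revProd_succ, revProd_succ, Fin.tail_update_succ]
      have ih := revProd_update_mul a (Fin.tail x) i
      rw [show x i.succ = Fin.tail x i from rfl, ih,
        Function.update_of_ne (Fin.succ_ne_zero i).symm, mul_assoc]

theorem tensorExtend_update_smul {p : ℕ} (ω : MultilinearMap ℝ (fun _ : Fin p => 𝔫) ℝ) (q : ℕ)
    (a : GrEven q) (x : Fin p → Gr q ⊗[ℝ] 𝔫) (i : Fin p) :
    tensorExtend ω q (Function.update x i ((a : Gr q) • x i)) =
      (a : Gr q) * tensorExtend ω q x := by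
  rw [tensorExtend_apply, tensorExtend_apply, Finset.mul_sum]
  refine Finset.sum_congr rfl fun c _ => ?_
  rw [mul_smul_comm, ← revProd_update_mul a _ i, ← rid_lTensor_smul]
  congr 2
  funext k
  by_cases hk : k = i
  · subst hk
    simp
  · simp [hk]

theorem tensorExtend_map {p : ℕ} (ω : MultilinearMap ℝ (fun _ : Fin p => 𝔫) ℝ) {q r : ℕ}
    (f : Gr q →ₐ[ℝ] Gr r) (x : Fin p → Gr q ⊗[ℝ] 𝔫) :
    tensorExtend ω r (fun k => LinearMap.rTensor 𝔫 f.toLinearMap (x k)) = f (tensorExtend ω q x) := by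
  rw [tensorExtend_apply, tensorExtend_apply, map_sum]
  refine Finset.sum_congr rfl fun c _ => ?_
  rw [map_smul, revProd, revProd, map_list_prod]
  congr 2
  simp only [rid_lTensor_map, List.map_reverse, List.map_ofFn]
  rfl

theorem tensorExtend_add {p : ℕ} (ω η : MultilinearMap ℝ (fun _ : Fin p => 𝔫) ℝ) (q : ℕ)
    (x : Fin p → Gr q ⊗[ℝ] 𝔫) :
    tensorExtend (ω + η) q x = tensorExtend ω q x + tensorExtend η q x := by
  simp only [tensorExtend_apply, add_apply, add_smul, Finset.sum_add_distrib]

theorem tensorExtend_smul {p : ℕ} (c : ℝ) (ω : MultilinearMap ℝ (fun _ : Fin p => 𝔫) ℝ) (q : ℕ)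
    (x : Fin p → Gr q ⊗[ℝ] 𝔫) : tensorExtend (c • ω) q x = c • tensorExtend ω q x := by
  simp only [tensorExtend_apply, smul_apply, smul_assoc, Finset.smul_sum]

end Coordinates

variable {L : LieSuperalgebra 𝔫}

/-- The map `N_f` as a linear map. -/
noncomputable def mapPointsₗ (L : LieSuperalgebra 𝔫) {q r : ℕ} (f : GrHom q r) :
    L.Points q →ₗ[ℝ] L.Points r where
  toFun := L.mapPoints f
  map_add' x y := Subtype.ext (map_add (LinearMap.rTensor 𝔫 f.toAlgHom.toLinearMap) x.1 y.1)
  map_smul' c x := Subtype.ext (map_smul (LinearMap.rTensor 𝔫 f.toAlgHom.toLinearMap) c x.1)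

theorem mapPoints_lie (L : LieSuperalgebra 𝔫) {q r : ℕ} (f : GrHom q r) (x y : L.Points q) :
    L.mapPoints f ⁅x, y⁆ = ⁅L.mapPoints f x, L.mapPoints f y⁆ := by
  have h : ∀ x y : Gr q ⊗[ℝ] 𝔫, LinearMap.rTensor 𝔫 f.toAlgHom.toLinearMap (L.tensorBracket q x y) =
      L.tensorBracket r (LinearMap.rTensor 𝔫 f.toAlgHom.toLinearMap x)
        (LinearMap.rTensor 𝔫 f.toAlgHom.toLinearMap y) := by
    intro x y
    induction x using TensorProduct.induction_on with
    | zero => simp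
    | add x x' hx hx' => simp only [map_add, LinearMap.add_apply, hx, hx']
    | tmul b v =>
      induction y using TensorProduct.induction_on with
      | zero => simp
      | add y y' hy hy' => simp only [map_add, hy, hy']
      | tmul c w => simp [tensorBracket_tmul]
  exact Subtype.ext (h x.1 y.1)

/-- The same finite number of terms computes the product in both groups, and a Lie homomorphism
preserves each term. -/
theorem IsNilpotent.mapPoints_mul (hL : L.IsNilpotent) {q r : ℕ} (f : GrHom q r)
    (x y : L.Points q) : L.mapPoints f (L.mul x y) = L.mul (L.mapPoints f x) (L.mapPoints f y) := by
  obtain ⟨N, hN⟩ := hL.mul_eq_sum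
  rw [hN, hN]
  refine (map_sum (L.mapPointsₗ f) _ _).trans (Finset.sum_congr rfl fun n _ => ?_)
  exact map_bchTerm (L.mapPointsₗ f) (fun a b => L.mapPoints_lie f a b) x y n

/-- The map `A₀ → B₀` induced by a homomorphism, as a linear map. -/
noncomputable def _root_.GrHom.mapEvenₗ {q r : ℕ} (f : GrHom q r) : GrEven q →ₗ[ℝ] GrEven r where
  toFun := f.mapEven
  map_add' _ _ := Subtype.ext (map_add f.toAlgHom _ _)
  map_smul' c _ := Subtype.ext (map_smul f.toAlgHom c _)

variable [FiniteDimensional ℝ 𝔫]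

theorem mapEven_cochainOnPoints {p : ℕ} (ω : L.evenCochains p) {q r : ℕ} (f : GrHom q r)
    (x : Fin p → L.Points q) : f.mapEven (L.cochainOnPoints ω q x) =
      L.cochainOnPoints ω r fun k => L.mapPoints f (x k) :=
  Subtype.ext (tensorExtend_map ω.1 f.toAlgHom fun k => (x k).1).symm

/-- `N_f` is linear and a group homomorphism, so it is its own derivative and intertwines left
translations. -/
theorem IsNilpotent.mapPoints_maurerCartan (hL : L.IsNilpotent) {q r : ℕ} (f : GrHom q r)
    (g v : L.Points q) : L.mapPoints f (L.maurerCartan q g v) =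
      L.maurerCartan r (L.mapPoints f g) (L.mapPoints f v) := by
  let T : L.Points q →L[ℝ] L.Points r := LinearMap.toContinuousLinearMap (L.mapPointsₗ f)
  have h1 := (T.hasFDerivAt.comp g (hL.differentiable_mul_left (-g) g).hasFDerivAt).fderiv
  have h2 := ((hL.differentiable_mul_left (-(T g)) (T g)).hasFDerivAt.comp g T.hasFDerivAt).fderiv
  have h3 : (T ∘ fun h => L.mul (-g) h) = (fun h => L.mul (-(T g)) h) ∘ T := by
    funext h
    refine (hL.mapPoints_mul f (-g) h).trans ?_
    exact congrArg (fun z => L.mul z (T h)) (map_neg (L.mapPointsₗ f) g)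
  rw [h3] at h1
  exact congrArg (fun T => T v) (h1.symm.trans h2)

theorem IsNilpotent.mapEven_leftInvariantForm (hL : L.IsNilpotent) {p : ℕ} (ω : L.evenCochains p)
    {q r : ℕ} (f : GrHom q r) (g : L.Points q) (v : Fin p → L.Points q) :
    f.mapEven (L.leftInvariantForm ω q g v) =
      L.leftInvariantForm ω r (L.mapPoints f g) fun k => L.mapPoints f (v k) := by
  rw [leftInvariantForm_eq, leftInvariantForm_eq, mapEven_cochainOnPoints]
  simp only [hL.mapPoints_maurerCartan]

theorem leftInvariantForm_add {p : ℕ} (ω η : L.evenCochains p) (q : ℕ) (g : L.Points q)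
    (v : Fin p → L.Points q) : L.leftInvariantForm (ω + η) q g v =
      L.leftInvariantForm ω q g v + L.leftInvariantForm η q g v := by
  simp only [leftInvariantForm_eq]
  exact Subtype.ext (tensorExtend_add ω.1 η.1 q fun k => (L.maurerCartan q g (v k)).1)

theorem leftInvariantForm_smul {p : ℕ} (c : ℝ) (ω : L.evenCochains p) (q : ℕ) (g : L.Points q)
    (v : Fin p → L.Points q) :
    L.leftInvariantForm (c • ω) q g v = c • L.leftInvariantForm ω q g v := by
  simp only [leftInvariantForm_eq]
  exact Subtype.ext (tensorExtend_smul c ω.1 q fun k => (L.maurerCartan q g (v k)).1)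

theorem cochainOnPoints_update_smul (L : LieSuperalgebra 𝔫) {p : ℕ} (ω : L.evenCochains p) (q : ℕ) (a : GrEven q)
    (x : Fin p → L.Points q) (i : Fin p) :
    L.cochainOnPoints ω q (Function.update x i (a • x i)) = a • L.cochainOnPoints ω q x := by
  have h : (fun k => (Function.update x i (a • x i) k).1) =
      Function.update (fun k => (x k).1) i ((a : Gr q) • (x i).1) := by
    funext k
    by_cases hk : k = i
    · subst hk
      simp only [Function.update_self]
      rfl
    · simp only [Function.update_of_ne hk]
  have h2 : (L.cochainOnPoints ω q (Function.update x i (a • x i))).1 =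
      (a : Gr q) * (L.cochainOnPoints ω q x).1 := by
    simp only [cochainOnPoints]
    rw [h, tensorExtend_update_smul]
  exact Subtype.ext h2

theorem A0Smooth_cochainOnPoints {p : ℕ} (ω : L.evenCochains p) (q : ℕ) :
    A0Smooth q (L.cochainOnPoints ω q) :=
  A0Smooth.multilinear (q := q) (⟨(L.cochainAlt ω q).toMultilinearMap,
    (L.cochainAlt ω q).toMultilinearMap.continuous_of_finiteDimensional'⟩ :
    ContinuousMultilinearMap ℝ (fun _ : Fin p => L.Points q) (GrEven q))
      fun a x i => L.cochainOnPoints_update_smul ω q a x i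

theorem IsNilpotent.A0Smooth_leftInvariantForm (hL : L.IsNilpotent) {p : ℕ}
    (ω : L.evenCochains p) {q : ℕ} {V : Type*} [NormedAddCommGroup V] [NormedSpace ℝ V]
    [Module (GrEven q) V] {g : V → L.Points q} {u : Fin p → V → L.Points q} (hg : A0Smooth q g)
    (hu : ∀ k, A0Smooth q (u k)) :
    A0Smooth q fun x => L.leftInvariantForm ω q (g x) fun k => u k x := by
  have h : A0Smooth q fun x => fun k => L.maurerCartan q (g x) (u k x) :=
    A0Smooth.pi fun k => hL.A0Smooth_maurerCartan hg (hu k)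
  exact (A0Smooth_cochainOnPoints ω q).comp h

theorem IsNilpotent.contDiff_leftInvariantForm (hL : L.IsNilpotent) {p : ℕ}
    (ω : L.evenCochains p) (q : ℕ) : ContDiff ℝ ((⊤ : ℕ∞) : WithTop ℕ∞)
      fun z : L.Points q × (Fin p → L.Points q) => L.leftInvariantForm ω q z.1 z.2 :=
  (hL.A0Smooth_leftInvariantForm ω (V := L.Points q × (Fin p → L.Points q)) (g := fun z => z.1)
    (u := fun k z => z.2 k) (A0Smooth.fst A0Smooth.id)
      fun k => (A0Smooth.eval k).comp (A0Smooth.snd A0Smooth.id)).1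

theorem IsNilpotent.contDiffOn_leftInvariantForm (hL : L.IsNilpotent) {p : ℕ}
    (ω : L.evenCochains p) {q : ℕ} {V : Type*} [NormedAddCommGroup V] [NormedSpace ℝ V]
    {s : Set V} {g : V → L.Points q} {u : Fin p → V → L.Points q}
    (hg : ContDiffOn ℝ ((⊤ : ℕ∞) : WithTop ℕ∞) g s)
    (hu : ∀ k, ContDiffOn ℝ ((⊤ : ℕ∞) : WithTop ℕ∞) (u k) s) :
    ContDiffOn ℝ ((⊤ : ℕ∞) : WithTop ℕ∞)
      (fun x => L.leftInvariantForm ω q (g x) fun k => u k x) s :=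
  contDiffOn_comp₂ (Φ := L.leftInvariantForm ω q) (hL.contDiff_leftInvariantForm ω q) hg
    (contDiffOn_pi.2 hu)

end LieSuperalgebra

namespace LieSuperalgebra

/-! ## Simplices -/

theorem simplexChart_mem {p : ℕ} {t : Fin p → ℝ} (ht : t ∈ cornerSimplex p) :
    simplexChart t ∈ stdSimplex ℝ (Fin (p + 1)) := by
  refine ⟨fun i => ?_, ?_⟩
  · induction i using Fin.cases with
    | zero => simpa [simplexChart] using ht.2
    | succ i => simpa [simplexChart] using ht.1 i
  · rw [Fin.sum_univ_succ]
    simp [simplexChart]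

theorem contDiff_simplexChart (p : ℕ) :
    ContDiff ℝ ((⊤ : ℕ∞) : WithTop ℕ∞) (simplexChart : (Fin p → ℝ) → _) := by
  refine contDiff_pi.2 fun i => ?_
  induction i using Fin.cases with
  | zero =>
    simp only [simplexChart, Fin.cons_zero]
    fun_prop
  | succ i =>
    simp only [simplexChart, Fin.cons_succ]
    fun_prop

theorem simplexChart_cons {p : ℕ} (s : Fin p → ℝ) :
    simplexChart (Fin.cons (1 - ∑ k, s k) s : Fin (p + 1) → ℝ) =
      (0 : Fin (p + 2)).insertNth 0 (simplexChart s) := by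
  rw [Fin.insertNth_zero', simplexChart, Fin.sum_cons]
  simp [simplexChart]

/-- The coordinate face `i` of the corner simplex is opposite to the vertex `i + 1`, whereas the
slanted face is opposite to the vertex `0` by `simplexChart_cons`. -/
theorem simplexChart_insertNth {p : ℕ} (i : Fin (p + 1)) (s : Fin p → ℝ) :
    simplexChart (i.insertNth 0 s : Fin (p + 1) → ℝ) = i.succ.insertNth 0 (simplexChart s) := by
  funext j
  have hsum : ∑ k, (i.insertNth 0 s : Fin (p + 1) → ℝ) k = ∑ k, s k := by
    rw [Fin.sum_univ_succAbove _ i]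
    simp
  induction j using Fin.succAboveCases i.succ with
  | x => simp [simplexChart]
  | p j =>
    rw [Fin.insertNth_apply_succAbove]
    induction j using Fin.cases with
    | zero => simp [simplexChart, hsum]
    | succ j => simp [simplexChart]

variable {𝔫 : Type*} [AddCommGroup 𝔫] [Module ℝ 𝔫] [FiniteDimensional ℝ 𝔫]
  {L : LieSuperalgebra 𝔫}

namespace LeftInvariantSimplices

variable (S : L.LeftInvariantSimplices)

/-- The simplex with the given vertices, as a map on the corner simplex. -/
def param (q : ℕ) {p : ℕ} (m : Fin (p + 1) → L.Points q) (t : Fin p → ℝ) : L.Points q :=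
  S.toFun q p (simplexChart t) m

theorem contDiffOn_param_uncurry (q p : ℕ) : ContDiffOn ℝ ((⊤ : ℕ∞) : WithTop ℕ∞)
    (fun z : (Fin p → ℝ) × (Fin (p + 1) → L.Points q) => S.param q z.2 z.1)
      (cornerSimplex p ×ˢ univ) :=
  (S.smooth q p).comp
    (((contDiff_simplexChart p).comp contDiff_fst).prodMk contDiff_snd).contDiffOn
      fun _ hz => ⟨simplexChart_mem hz.1, mem_univ _⟩

theorem contDiffOn_param {q p : ℕ} (m : Fin (p + 1) → L.Points q) :
    ContDiffOn ℝ ((⊤ : ℕ∞) : WithTop ℕ∞) (S.param q m) (cornerSimplex p) :=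
  (S.contDiffOn_param_uncurry q p).comp (contDiffOn_id.prodMk contDiffOn_const)
    fun _ ht => ⟨ht, mem_univ _⟩

theorem A0Smooth_param {q p : ℕ} {t : Fin p → ℝ} (ht : t ∈ cornerSimplex p) :
    A0Smooth q fun m : Fin (p + 1) → L.Points q => S.param q m t :=
  S.A0_smooth q p _ (simplexChart_mem ht)

theorem differentiableWithinAt_param {q p : ℕ} (m : Fin (p + 1) → L.Points q) {t : Fin p → ℝ}
    (ht : t ∈ cornerSimplex p) : DifferentiableWithinAt ℝ (S.param q m) (cornerSimplex p) t :=
  (S.contDiffOn_param m).differentiableOn (by simp) t ht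

/-- The density of the pullback of a left-invariant form to a simplex. -/
noncomputable def density {p : ℕ} (ω : L.evenCochains p) (q : ℕ) (m : Fin (p + 1) → L.Points q)
    (t : Fin p → ℝ) : GrEven q :=
  L.leftInvariantForm ω q (S.param q m t) fun k =>
    fderivWithin ℝ (S.param q m) (cornerSimplex p) t (Pi.single k 1)

theorem integral_eq {p : ℕ} (ω : L.evenCochains p) (q : ℕ) (m : Fin (p + 1) → L.Points q) :
    (L.integral ω q fun x => S.toFun q p x m) = ∫ t in cornerSimplex p, S.density ω q m t := rfl

theorem contDiffOn_density_uncurry (hL : L.IsNilpotent) {p : ℕ} (ω : L.evenCochains p) (q : ℕ) :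
    ContDiffOn ℝ ((⊤ : ℕ∞) : WithTop ℕ∞)
      (fun z : (Fin p → ℝ) × (Fin (p + 1) → L.Points q) => S.density ω q z.2 z.1)
        (cornerSimplex p ×ˢ univ) := by
  have h : ∀ k : Fin p, ContDiffOn ℝ ((⊤ : ℕ∞) : WithTop ℕ∞)
      (fun z : (Fin p → ℝ) × (Fin (p + 1) → L.Points q) =>
        fderivWithin ℝ (S.param q z.2) (cornerSimplex p) z.1 (Pi.single k 1))
          (cornerSimplex p ×ˢ univ) := by
    intro k
    refine (contDiffOn_fderivWithin_prod_apply (uniqueDiffOn_cornerSimplex p)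
      (S.contDiffOn_param_uncurry q p) (Pi.single k 1, 0)).congr fun z hz => ?_
    exact fderivWithin_fst_eq (uniqueDiffOn_cornerSimplex p) (S.contDiffOn_param_uncurry q p)
      hz.1 z.2 (Pi.single k 1)
  exact hL.contDiffOn_leftInvariantForm ω (S.contDiffOn_param_uncurry q p) h

theorem contDiffOn_density (hL : L.IsNilpotent) {p : ℕ} (ω : L.evenCochains p) {q : ℕ}
    (m : Fin (p + 1) → L.Points q) :
    ContDiffOn ℝ ((⊤ : ℕ∞) : WithTop ℕ∞) (S.density ω q m) (cornerSimplex p) :=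
  hL.contDiffOn_leftInvariantForm ω (S.contDiffOn_param m) fun k =>
    ((S.contDiffOn_param m).fderivWithin (uniqueDiffOn_cornerSimplex p) (by simp)).clm_apply
      contDiffOn_const

theorem continuousOn_density (hL : L.IsNilpotent) {p : ℕ} (ω : L.evenCochains p) {q : ℕ}
    (m : Fin (p + 1) → L.Points q) : ContinuousOn (S.density ω q m) (cornerSimplex p) :=
  (S.contDiffOn_density hL ω m).continuousOn

theorem integrableOn_density (hL : L.IsNilpotent) {p : ℕ} (ω : L.evenCochains p) {q : ℕ}
    (m : Fin (p + 1) → L.Points q) : IntegrableOn (S.density ω q m) (cornerSimplex p) :=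
  (S.continuousOn_density hL ω m).integrableOn_compact (isCompact_cornerSimplex p)

/-- For each parameter both the point of the simplex and its partial velocities are `A₀`-smooth in
the vertices, hence so is the integrand. -/
theorem A0Smooth_integral (hL : L.IsNilpotent) {p : ℕ} (ω : L.evenCochains p) (q : ℕ) :
    A0Smooth q fun m : Fin (p + 1) → L.Points q => L.integral ω q fun x => S.toFun q p x m := by
  simp only [integral_eq]
  refine A0Smooth.setIntegral (h := fun z : (Fin p → ℝ) × (Fin (p + 1) → L.Points q) =>
    S.density ω q z.2 z.1) (isCompact_cornerSimplex p) (uniqueDiffOn_cornerSimplex p)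
      (S.contDiffOn_density_uncurry hL ω q) fun t ht => ?_
  exact hL.A0Smooth_leftInvariantForm ω (S.A0Smooth_param ht) fun k =>
    A0Smooth.fderivWithin_fst (h := fun z : (Fin p → ℝ) × (Fin (p + 1) → L.Points q) =>
      S.param q z.2 z.1) (uniqueDiffOn_cornerSimplex p)
        (fun _ => mem_closure_interior_cornerSimplex) (S.contDiffOn_param_uncurry q p)
          (fun _ ht => S.A0Smooth_param ht) ht (Pi.single k 1)

theorem density_map (hL : L.IsNilpotent) {p : ℕ} (ω : L.evenCochains p) {q r : ℕ} (f : GrHom q r)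
    (m : Fin (p + 1) → L.Points q) {t : Fin p → ℝ} (ht : t ∈ cornerSimplex p) :
    S.density ω r (fun k => L.mapPoints f (m k)) t = f.mapEven (S.density ω q m t) := by
  let T : L.Points q →L[ℝ] L.Points r := LinearMap.toContinuousLinearMap (L.mapPointsₗ f)
  have h : EqOn (S.param r fun k => L.mapPoints f (m k)) (T ∘ S.param q m) (cornerSimplex p) :=
    fun s hs => (S.natural q r p f _ (simplexChart_mem hs) m).symm
  rw [density, density, hL.mapEven_leftInvariantForm, fderivWithin_congr h (h ht),
    (T.hasFDerivAt.comp_hasFDerivWithinAt t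
      (S.differentiableWithinAt_param m ht).hasFDerivWithinAt).fderivWithin
        (uniqueDiffOn_cornerSimplex p t ht), h ht]
  rfl

theorem integral_map (hL : L.IsNilpotent) {p : ℕ} (ω : L.evenCochains p) {q r : ℕ} (f : GrHom q r)
    (m : Fin (p + 1) → L.Points q) :
    f.mapEven (L.integral ω q fun x => S.toFun q p x m) =
      L.integral ω r fun x => S.toFun r p x fun k => L.mapPoints f (m k) := by
  let T : GrEven q →L[ℝ] GrEven r := LinearMap.toContinuousLinearMap f.mapEvenₗ
  have := FiniteDimensional.complete ℝ (GrEven q)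
  have := FiniteDimensional.complete ℝ (GrEven r)
  rw [integral_eq, integral_eq, setIntegral_congr_fun (isClosed_cornerSimplex p).measurableSet
    fun t ht => S.density_map hL ω f m ht]
  exact (T.integral_comp_comm (S.integrableOn_density hL ω m)).symm

/-- Left invariance of the simplices and of the form combine through the chain rule. -/
theorem density_mul (hL : L.IsNilpotent) {p : ℕ} (ω : L.evenCochains p) {q : ℕ} (g : L.Points q)
    (m : Fin (p + 1) → L.Points q) {t : Fin p → ℝ} (ht : t ∈ cornerSimplex p) :
    S.density ω q (fun k => L.mul g (m k)) t = S.density ω q m t := by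
  have h : EqOn (S.param q fun k => L.mul g (m k)) ((fun x => L.mul g x) ∘ S.param q m)
      (cornerSimplex p) := fun s hs => (S.left_invariant q p _ (simplexChart_mem hs) g m).symm
  rw [density, density, fderivWithin_congr h (h ht),
    ((hL.differentiable_mul_left g _).hasFDerivAt.comp_hasFDerivWithinAt t
      (S.differentiableWithinAt_param m ht).hasFDerivWithinAt).fderivWithin
        (uniqueDiffOn_cornerSimplex p t ht), h ht]
  exact (hL.leftInvariantForm_mul ω g _ _).symm

theorem integral_mul (hL : L.IsNilpotent) {p : ℕ} (ω : L.evenCochains p) {q : ℕ} (g : L.Points q)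
    (m : Fin (p + 1) → L.Points q) :
    (L.integral ω q fun x => S.toFun q p x fun k => L.mul g (m k)) =
      L.integral ω q fun x => S.toFun q p x m := by
  rw [integral_eq, integral_eq]
  exact setIntegral_congr_fun (isClosed_cornerSimplex p).measurableSet
    fun t ht => S.density_mul hL ω g m ht

/-- The pullback of a left-invariant form to a simplex. -/
noncomputable def pullback {p d : ℕ} (ω : L.evenCochains p) (q : ℕ) (m : Fin (d + 1) → L.Points q)
    (t : Fin d → ℝ) : (Fin d → ℝ) [⋀^Fin p]→L[ℝ] GrEven q :=
  (L.invariantForm ω q (S.param q m t)).compContinuousLinearMap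
    (fderivWithin ℝ (S.param q m) (cornerSimplex d) t)

/-- Stated for an arbitrary parametrization `τ` of a face, so as to cover the slanted face and the
coordinate faces alike. -/
theorem pullback_face {p : ℕ} (ω : L.evenCochains p) {q : ℕ} (m : Fin (p + 2) → L.Points q)
    (j : Fin (p + 2)) {τ : (Fin p → ℝ) → Fin (p + 1) → ℝ}
    {τ' : (Fin p → ℝ) →L[ℝ] (Fin (p + 1) → ℝ)} (hτ : ∀ s, HasFDerivAt τ τ' s)
    (hmap : MapsTo τ (cornerSimplex p) (cornerSimplex (p + 1)))
    (hj : ∀ s, simplexChart (τ s) = j.insertNth 0 (simplexChart s)) {s : Fin p → ℝ}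
    (hs : s ∈ cornerSimplex p) :
    S.pullback ω q m (τ s) (fun k => τ' (Pi.single k 1)) =
      S.density ω q (fun k => m (j.succAbove k)) s := by
  have h : EqOn (S.param q fun k => m (j.succAbove k)) (S.param q m ∘ τ) (cornerSimplex p) := by
    intro s hs
    simp only [param, Function.comp_apply, hj]
    exact (S.face q p _ (simplexChart_mem hs) j m).symm
  rw [density, fderivWithin_congr h (h hs), h hs,
    (((S.differentiableWithinAt_param m (hmap hs)).hasFDerivWithinAt).comp s
      (hτ s).hasFDerivWithinAt hmap).fderivWithin (uniqueDiffOn_cornerSimplex p s hs)]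
  rfl

theorem pullback_apply {p d : ℕ} (ω : L.evenCochains p) (q : ℕ) (m : Fin (d + 1) → L.Points q)
    (t : Fin d → ℝ) (v : Fin p → Fin d → ℝ) : S.pullback ω q m t v =
      L.leftInvariantForm ω q (S.param q m t) fun k =>
        fderivWithin ℝ (S.param q m) (cornerSimplex d) t (v k) := rfl

theorem differentiableOn_pullback (hL : L.IsNilpotent) {p d : ℕ} (ω : L.evenCochains p) {q : ℕ}
    (m : Fin (d + 1) → L.Points q) :
    DifferentiableOn ℝ (S.pullback ω q m) (cornerSimplex d) := by
  intro t ht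
  refine DifferentiableWithinAt.continuousAlternatingMapCompContinuousLinearMap ?_ ?_
  · exact (hL.differentiable_invariantForm ω q _).comp_differentiableWithinAt t
      (S.differentiableWithinAt_param m ht)
  · exact ((S.contDiffOn_param m).fderivWithin (uniqueDiffOn_cornerSimplex d)
      (m := ((⊤ : ℕ∞) : WithTop ℕ∞)) (by simp)).differentiableOn (by simp) t ht

theorem contDiffOn_pullback_apply (hL : L.IsNilpotent) {p d : ℕ} (ω : L.evenCochains p) {q : ℕ}
    (m : Fin (d + 1) → L.Points q) (v : Fin p → Fin d → ℝ) :
    ContDiffOn ℝ 1 (fun t => S.pullback ω q m t v) (cornerSimplex d) := by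
  simp only [pullback_apply]
  exact (hL.contDiffOn_leftInvariantForm ω (S.contDiffOn_param m) fun k =>
    ((S.contDiffOn_param m).fderivWithin (uniqueDiffOn_cornerSimplex d) (by simp)).clm_apply
      (contDiffOn_const (c := v k))).of_le (WithTop.coe_le_coe.2 le_top)

/-- Exterior derivatives commute with pullback, also within the closed simplex, and on `N_A` the
exterior derivative of the form is the form of the coboundary. -/
theorem density_cobd (hL : L.IsNilpotent) {n : ℕ} (ω : L.evenCochains (n + 1)) {q : ℕ}
    (m : Fin (n + 3) → L.Points q) {t : Fin (n + 2) → ℝ} (ht : t ∈ cornerSimplex (n + 2)) :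
    S.density ⟨L.cobd ω.1, hL.cobd_mem (n + 1) ω⟩ q m t =
      extDerivWithin (S.pullback ω q m) (cornerSimplex (n + 2)) t fun k => Pi.single k 1 := by
  have htop : minSmoothness ℝ 2 ≤ ((⊤ : ℕ∞) : WithTop ℕ∞) := by
    rw [minSmoothness_of_isRCLikeNormedField]
    exact WithTop.coe_le_coe.2 le_top
  have h2 := extDerivWithin_pullback (x := t) (f := S.param q m) (t := univ)
    (hL.differentiable_invariantForm ω q _).differentiableWithinAt (S.contDiffOn_param m t ht)
      htop (uniqueDiffOn_cornerSimplex _) (mem_closure_interior_cornerSimplex ht) ht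
        (mapsTo_univ _ _)
  refine Eq.trans ?_ (congrArg (fun T => T fun k => Pi.single k 1) h2).symm
  rw [extDerivWithin_univ]
  exact (hL.extDeriv_invariantForm_eq ω q _ _).symm

theorem integral_pullback_face_zero {p : ℕ} (ω : L.evenCochains p) {q : ℕ}
    (m : Fin (p + 2) → L.Points q) :
    (∫ s in cornerSimplex p, S.pullback ω q m (Fin.cons (1 - ∑ k, s k) s)
      fun k => Pi.single k.succ 1 - Pi.single 0 1) =
        L.integral ω q fun x => S.toFun q p x fun k => m ((0 : Fin (p + 2)).succAbove k) := by
  refine setIntegral_congr_fun (isClosed_cornerSimplex p).measurableSet fun s hs => ?_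
  have hmap : MapsTo (fun s : Fin p → ℝ => (Fin.cons (1 - ∑ k, s k) s : Fin (p + 1) → ℝ))
      (cornerSimplex p) (cornerSimplex (p + 1)) := by
    intro s hs
    simpa only [Fin.insertNth_zero'] using insertNth_slanted_mem (0 : Fin (p + 1)) hs
  let l : (Fin p → ℝ) →L[ℝ] ℝ := -∑ k, ContinuousLinearMap.proj k
  have hl : ∀ s, l s = -∑ k, s k := fun s => by simp [l]
  refine Eq.trans ?_ (S.pullback_face ω m 0
    (τ' := ContinuousLinearMap.pi (Fin.cons l fun k => ContinuousLinearMap.proj k)) (fun s => ?_)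
    hmap simplexChart_cons hs)
  · congr 1
    funext k j
    induction j using Fin.cases with
    | zero => simp [hl]
    | succ j => simp [Pi.single_apply]
  · rw [hasFDerivAt_pi']
    intro j
    induction j using Fin.cases with
    | zero =>
      have := (l.hasFDerivAt (x := s)).const_add 1
      simp only [hl, ← sub_eq_add_neg] at this
      exact this
    | succ j => exact hasFDerivAt_apply j s

theorem integral_pullback_face_succ {p : ℕ} (ω : L.evenCochains p) {q : ℕ}
    (m : Fin (p + 2) → L.Points q) (i : Fin (p + 1)) :
    (∫ s in cornerSimplex p, S.pullback ω q m (i.insertNth 0 s)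
      fun k => Pi.single (i.succAbove k) 1) =
        L.integral ω q fun x => S.toFun q p x fun k => m (i.succ.succAbove k) := by
  refine setIntegral_congr_fun (isClosed_cornerSimplex p).measurableSet fun s hs => ?_
  refine Eq.trans ?_ (S.pullback_face ω m i.succ (τ := fun s => i.insertNth 0 s)
    (τ' := ContinuousLinearMap.pi (i.insertNth 0 fun k => ContinuousLinearMap.proj k)) (fun s => ?_)
    (fun s hs => insertNth_mem_cornerSimplex.2 ⟨hs, le_rfl, by linarith [hs.2]⟩)
    (simplexChart_insertNth i) hs)
  · congr 1
    funext k j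
    induction j using Fin.succAboveCases i with
    | x => simp
    | p j => simp [Pi.single_apply]
  · rw [hasFDerivAt_pi']
    intro j
    induction j using Fin.succAboveCases i with
    | x => simpa using hasFDerivAt_const (0 : ℝ) s
    | p j => simpa using hasFDerivAt_apply j s

/-- The Stokes theorem for left-invariant forms. -/
theorem integral_cobd (hL : L.IsNilpotent) {n : ℕ} (ω : L.evenCochains (n + 1)) {q : ℕ}
    (m : Fin (n + 3) → L.Points q) :
    (L.integral ⟨L.cobd ω.1, hL.cobd_mem (n + 1) ω⟩ q fun x => S.toFun q (n + 2) x m) =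
      ∑ j : Fin (n + 3), (-1 : ℝ) ^ (j : ℕ) •
        L.integral ω q fun x => S.toFun q (n + 1) x fun k => m (j.succAbove k) := by
  have := FiniteDimensional.complete ℝ (GrEven q)
  have h := integral_extDerivWithin_cornerSimplex (S.differentiableOn_pullback hL ω m)
    (S.contDiffOn_pullback_apply hL ω m)
  rw [integral_eq, setIntegral_congr_fun (isClosed_cornerSimplex _).measurableSet
    fun t ht => S.density_cobd hL ω m ht, h, Fin.sum_univ_succ (n := n + 2),
    S.integral_pullback_face_zero ω m]
  simp only [S.integral_pullback_face_succ ω m, Fin.val_zero, pow_zero, one_smul, Fin.val_succ]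

end LeftInvariantSimplices

end LieSuperalgebra

namespace LieSuperalgebra

variable {𝔫 : Type*} [AddCommGroup 𝔫] [Module ℝ 𝔫] {L : LieSuperalgebra 𝔫}

/-! ## Vertices and the group coboundary -/

theorem mapPoints_contractNth (hL : L.IsNilpotent) {q r p : ℕ} (f : GrHom q r) (i : Fin (p + 1))
    (g : Fin (p + 1) → L.Points q) (k : Fin p) : L.mapPoints f (Fin.contractNth i L.mul g k) =
      Fin.contractNth i L.mul (fun k => L.mapPoints f (g k)) k := by
  simp only [Fin.contractNth]
  split_ifs
  · rfl
  · exact hL.mapPoints_mul f _ _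
  · rfl

theorem vertices_zero {q p : ℕ} (n : Fin p → L.Points q) : L.vertices n 0 = 0 := rfl

theorem vertices_succ {q p : ℕ} (n : Fin p → L.Points q) (k : Fin p) :
    L.vertices n k.succ = L.mul (L.vertices n k.castSucc) (n k) :=
  Fin.induction_succ _ _ _

theorem vertices_castSucc {q p : ℕ} (g : Fin (p + 1) → L.Points q) (k : Fin (p + 1)) :
    L.vertices g k.castSucc = L.vertices (fun k => g k.castSucc) k := by
  induction k using Fin.induction with
  | zero => rfl
  | succ k ih => rw [← Fin.succ_castSucc, vertices_succ, vertices_succ, ih]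

/-- Identifies the face opposite to the vertex `1` as a left translate by `g 0`, which does not
affect the integral. -/
theorem IsNilpotent.vertices_succ_tail (hL : L.IsNilpotent) {q p : ℕ}
    (g : Fin (p + 1) → L.Points q) (k : Fin (p + 1)) :
    L.vertices g k.succ = L.mul (g 0) (L.vertices (fun k => g k.succ) k) := by
  induction k using Fin.induction with
  | zero =>
    rw [vertices_succ, Fin.castSucc_zero, vertices_zero, vertices_zero, zero_mul_left,
      mul_zero_right]
  | succ k ih => rw [vertices_succ, vertices_succ, ← Fin.succ_castSucc, ih, hL.mul_assoc]

/-- Omitting an inner partial product amounts to multiplying the two factors adjacent to it;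
associativity enters only at that position. -/
theorem IsNilpotent.vertices_contractNth (hL : L.IsNilpotent) {q p : ℕ}
    (g : Fin (p + 1) → L.Points q) (i : Fin p) (k : Fin (p + 1)) :
    L.vertices g (i.castSucc.succ.succAbove k) =
      L.vertices (Fin.contractNth i.castSucc L.mul g) k := by
  induction k using Fin.induction with
  | zero => rw [Fin.succ_succAbove_zero, vertices_zero, vertices_zero]
  | succ k ih =>
    rw [vertices_succ, ← ih, Fin.succ_succAbove_succ]
    rcases lt_trichotomy (k : ℕ) (i : ℕ) with h | h | h
    · have h1 : i.castSucc.succ.succAbove k.castSucc = k.castSucc.castSucc := by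
        ext; simp only [Fin.succAbove, Fin.lt_def]; (split_ifs <;> simp_all); omega
      have h2 : i.castSucc.succAbove k = k.castSucc := by
        ext; simp only [Fin.succAbove, Fin.lt_def]; split_ifs <;> simp_all
      rw [h1, h2, vertices_succ, Fin.contractNth_apply_of_lt _ _ _ _ h]
    · have h1 : i.castSucc.succ.succAbove k.castSucc = k.castSucc.castSucc := by
        ext; simp only [Fin.succAbove, Fin.lt_def]; split_ifs <;> simp_all
      have h2 : i.castSucc.succAbove k = k.succ := by
        ext; simp only [Fin.succAbove, Fin.lt_def]; split_ifs <;> simp_all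
      rw [h1, h2, vertices_succ, ← Fin.succ_castSucc, vertices_succ,
        Fin.contractNth_apply_of_eq _ _ _ _ h, hL.mul_assoc]
    · have h1 : i.castSucc.succ.succAbove k.castSucc = k.succ.castSucc := by
        ext; simp only [Fin.succAbove, Fin.lt_def]; (split_ifs <;> simp_all); omega
      have h2 : i.castSucc.succAbove k = k.succ := by
        ext; simp only [Fin.succAbove, Fin.lt_def]; (split_ifs <;> simp_all); omega
      rw [h1, h2, vertices_succ, Fin.contractNth_apply_of_gt _ _ _ _ h]

theorem IsNilpotent.mapPoints_vertices (hL : L.IsNilpotent) {q r p : ℕ} (f : GrHom q r)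
    (n : Fin p → L.Points q) (k : Fin (p + 1)) :
    L.mapPoints f (L.vertices n k) = L.vertices (fun k => L.mapPoints f (n k)) k := by
  induction k using Fin.induction with
  | zero => exact map_zero (L.mapPointsₗ f)
  | succ k ih => rw [vertices_succ, vertices_succ, hL.mapPoints_mul, ih]

variable [FiniteDimensional ℝ 𝔫]

theorem IsNilpotent.A0Smooth_vertices (hL : L.IsNilpotent) {q p : ℕ} :
    A0Smooth q fun n : Fin p → L.Points q => L.vertices n := by
  refine A0Smooth.pi fun k => ?_
  induction k using Fin.induction with
  | zero => exact A0Smooth.const 0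
  | succ k ih =>
    simp only [vertices_succ]
    exact hL.A0Smooth_mul ih (A0Smooth.eval k)

theorem IsNilpotent.groupCobd_mem (hL : L.IsNilpotent) (p : ℕ) (F : L.groupCochains p) :
    L.groupCobd F.1 ∈ L.groupCochains (p + 1) := by
  obtain ⟨F, hnat, hsm⟩ := F
  refine ⟨fun q r f g => ?_, fun q => ?_⟩
  · simp only [groupCobd]
    change f.mapEvenₗ _ = _
    simp only [map_add, map_sum, map_smul]
    have h : ∀ g, f.mapEvenₗ (F q g) = F r fun i => L.mapPoints f (g i) := hnat q r f
    simp only [h, mapPoints_contractNth hL]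
  · have h1 : A0Smooth q fun g : Fin (p + 1) → L.Points q => F q fun k => g k.succ :=
      (hsm q).comp (A0Smooth.pi fun k => A0Smooth.eval k.succ)
    have h2 : A0Smooth q fun g : Fin (p + 1) → L.Points q => F q fun k => g k.castSucc :=
      (hsm q).comp (A0Smooth.pi fun k => A0Smooth.eval k.castSucc)
    have h3 : ∀ i : Fin p, A0Smooth q fun g : Fin (p + 1) → L.Points q =>
        F q (Fin.contractNth i.castSucc L.mul g) := by
      intro i
      refine (hsm q).comp (A0Smooth.pi fun k => ?_)
      simp only [Fin.contractNth]
      split_ifs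
      · exact A0Smooth.eval _
      · exact hL.A0Smooth_mul (A0Smooth.eval _) (A0Smooth.eval _)
      · exact A0Smooth.eval _
    exact (h1.add (A0Smooth.sum fun i _ => (h3 i).const_smul _)).add (h2.const_smul _)

/-! ## The integration map -/

variable (S : L.LeftInvariantSimplices)

/-- The integration map from Lie superalgebra cochains to supergroup cochains. -/
noncomputable def integrationMap (hL : L.IsNilpotent) (p : ℕ) :
    L.evenCochains p →ₗ[ℝ] L.groupCochains p where
  toFun ω := ⟨fun q n => L.integral ω q fun x => S.toFun q p x (L.vertices n),
    fun q r f n => by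
      rw [S.integral_map hL]
      simp only [hL.mapPoints_vertices],
    fun q => (S.A0Smooth_integral hL ω q).comp hL.A0Smooth_vertices⟩
  map_add' ω η := by
    refine Subtype.ext (funext fun q => funext fun n => ?_)
    have h : ∀ t, S.density (ω + η) q (L.vertices n) t =
        S.density ω q (L.vertices n) t + S.density η q (L.vertices n) t := fun t =>
      leftInvariantForm_add ω η q _ _
    change (∫ t in cornerSimplex p, S.density (ω + η) q (L.vertices n) t) = _
    simp only [h]
    exact integral_add (S.integrableOn_density hL ω _) (S.integrableOn_density hL η _)
  map_smul' c ω := by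
    refine Subtype.ext (funext fun q => funext fun n => ?_)
    have h : ∀ t, S.density (c • ω) q (L.vertices n) t = c • S.density ω q (L.vertices n) t :=
      fun t => leftInvariantForm_smul c ω q _ _
    change (∫ t in cornerSimplex p, S.density (c • ω) q (L.vertices n) t) = _
    simp only [h]
    exact integral_smul c _

theorem integrationMap_apply (hL : L.IsNilpotent) {p : ℕ} (ω : L.evenCochains p) (q : ℕ)
    (n : Fin p → L.Points q) : (L.integrationMap S hL p ω).1 q n =
      L.integral ω q fun x => S.toFun q p x (L.vertices n) := rfl

/-- The faces in Stokes' theorem match the terms of the group coboundary one by one, with the same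
signs. -/
theorem integrationMap_cobd (hL : L.IsNilpotent) (p : ℕ) (ω : L.evenCochains p) :
    L.integrationMap S hL (p + 1) ⟨L.cobd ω.1, hL.cobd_mem p ω⟩ =
      ⟨L.groupCobd (L.integrationMap S hL p ω).1,
        hL.groupCobd_mem p (L.integrationMap S hL p ω)⟩ := by
  obtain _ | p := p
  -- In degree zero both sides vanish: the coboundary of a constant is zero by definition, and the
  -- two outer terms of the group coboundary cancel.
  · have h : (⟨L.cobd ω.1, hL.cobd_mem 0 ω⟩ : L.evenCochains 1) = 0 := rfl
    rw [h, map_zero]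
    refine Subtype.ext (funext fun q => funext fun g => ?_)
    change 0 = L.groupCobd (L.integrationMap S hL 0 ω).1 q g
    have h2 : (fun k : Fin 0 => g k.succ) = fun k => g k.castSucc := funext fun k => k.elim0
    simp [groupCobd, h2]
  · refine Subtype.ext (funext fun q => funext fun g => ?_)
    rw [integrationMap_apply, S.integral_cobd hL, Fin.sum_univ_succ, Fin.sum_univ_castSucc]
    simp only [groupCobd, integrationMap_apply]
    -- This face starts at `g 0` instead of the identity and is translated back.
    have h0 : (L.integral ω q fun x => S.toFun q (p + 1) x fun k =>
        L.vertices g ((0 : Fin (p + 3)).succAbove k)) =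
          L.integral ω q fun x => S.toFun q (p + 1) x (L.vertices fun k => g k.succ) := by
      have h : (fun k => L.vertices g ((0 : Fin (p + 3)).succAbove k)) = fun k =>
          L.mul (g 0) (L.vertices (fun k => g k.succ) k) := by
        funext k
        rw [Fin.succAbove_zero]
        exact hL.vertices_succ_tail g k
      rw [h]
      exact S.integral_mul hL ω (g 0) (L.vertices fun k => g k.succ)
    have h1 : ∀ i : Fin (p + 1), (fun k => L.vertices g (i.castSucc.succ.succAbove k)) =
        L.vertices (Fin.contractNth i.castSucc L.mul g) := fun i =>
      funext (hL.vertices_contractNth g i)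
    have h2 : (fun k => L.vertices g ((Fin.last (p + 1)).succ.succAbove k)) =
        L.vertices fun k => g k.castSucc := by
      funext k
      rw [Fin.succ_last, Fin.succAbove_last, vertices_castSucc]
    rw [h0, h2, Fin.val_zero, pow_zero, one_smul]
    simp only [h1, Fin.val_succ, Fin.val_castSucc, Fin.val_last]
    exact (add_assoc (G := GrEven q) _ _ _).symm

end LieSuperalgebra

theorem mainTheorem2 {𝔫 : Type*} [AddCommGroup 𝔫] [Module ℝ 𝔫] [FiniteDimensional ℝ 𝔫]
    (L : LieSuperalgebra 𝔫) (hL : L.IsNilpotent) (S : L.LeftInvariantSimplices) :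
    ∃ (hd : ∀ (p : ℕ) (ω : L.evenCochains p), L.cobd ω.1 ∈ L.evenCochains (p + 1))
      (hδ : ∀ (p : ℕ) (F : L.groupCochains p), L.groupCobd F.1 ∈ L.groupCochains (p + 1))
      (I : ∀ p : ℕ, L.evenCochains p →ₗ[ℝ] L.groupCochains p),
      (∀ (p : ℕ) (ω : L.evenCochains p) (q : ℕ) (n : Fin p → L.Points q),
        (I p ω).1 q n = L.integral ω q fun x => S.toFun q p x (L.vertices n)) ∧
      ∀ (p : ℕ) (ω : L.evenCochains p),
        I (p + 1) ⟨L.cobd ω.1, hd p ω⟩ = ⟨L.groupCobd (I p ω).1, hδ p (I p ω)⟩ :=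
  ⟨hL.cobd_mem, hL.groupCobd_mem, L.integrationMap S hL, fun _ _ _ _ => rfl,
    L.integrationMap_cobd S hL⟩
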